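/- **Lemma 3.4 (Harnack-type estimate for the singular system).** Let $n\ge 2$, $0<m<1$, $\lambda_i>0$, $\beta_i>0$ with $$1-\frac1{\beta_i}<m<1,\qquad \theta_i=n\beta_i(m-1)+2>0,$$ let $\alpha\in(-1,0)$ be such that $\beta_i(m-1)+1+\alpha$, $1+\alpha$ and $\beta_i(m-1)+1-\alpha$ lie in $(0,1)$, and let $\mathbf c>0$, $\mathbf C_2,\mathbf C_3,\mathbf C_4\ge 0$, $\Lambda>0$. Then there is a constant $\gamma>0$, depending only on $n,m,\alpha,\lambda_i,\beta_i,\mathbf c,\mathbf C_2,\mathbf C_3,\mathbf C_4$ and $\Lambda$, with the following property. Let $E\subset\mathbb R^n$ be open, $T>0$, $E_T=E\times(0,T]$, $k\in\mathbb N$, $1\le i\le k$, let $\lambda_j>0$, $\beta_j\ge0$ $(1\le j\le k)$ be constants that take the given values for $j=i$, let $U:[0,\infty)^k\to\mathbb R$ be continuous, and let $\mathcal A(p,z,x,t)\in\mathbb R^n$ ($p\in\mathbb R^n$, $z\ge 0$, $(x,t)\in E_T$) be measurable in $(x,t)$, continuous in $(p,z)$ for almost every $(x,t)$, and satisfy,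 for almost every $(x,t)\in E_T$ and all $p\in\mathbb R^n$, $z\ge0$, $$\mathcal A(p,z,x,t)\cdot p\ge\mathbf c|p|^2-\mathbf C_2z^2,\qquad |\mathcal A(p,z,x,t)|\le\mathbf C_3|p|+\mathbf C_4z .$$ Let $\mathbf u=(u^1,\dots,u^k)$ be a weak solution in $E_T$ of $$(u^j)_t=\nabla\cdot\big(mU^{m-1}\mathcal A(\nabla u^j,u^j,x,t)\big),\qquad 1\le j\le k,\quad U=U(u^1,\dots,u^k);$$ that is, for every $j$, $u^j$ is locally integrable with a locally integrable weak spatial gradient $\nabla u^j$ in $E\times(0,T)$, $U^{m-1}\mathcal A(\nabla u^j,u^j,x,t)\in L^2(E_T)$, and $$\int_{E_T}\big\{mU^{m-1}\mathcal A(\nabla u^j,u^j,x,t)\cdot\nabla\varphi-u^j\varphi_t\big\}\,dx\,dt=0\qquad\forall\varphi\in C_c^\infty(E\times(0,T)).$$ Suppose that a.e. in $E_T$, for every $j$, $u^j\ge0$ and $\lambda_j(u^j)^{\beta_j}\le U(u^1,\dots,u^k)$, that every $u^j$ is bounded, and that $U(u^1,\dots,u^k)\le\Lambda$ a.e. in $E_T$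 (because the $u^j$ are bounded and $U$ is continuous, such a $\Lambda$ always exists). Then for every cylinder $B_{4\rho}(y)\times(2s-t,t]\subset E_T$ with $\rho>0$, $s<t$, $$\begin{aligned}\sup_{B_\rho(y)\times(s,t]}u^i\le\gamma\Bigg[&\frac{(2+(\mathbf C_2+\mathbf C_4)\rho^2)^{\frac{n+2}{\theta_i}}(t-s+\rho^2)^{\frac{n+2}{\theta_i}}}{(t-s)^{\frac{2(n+1)}{\theta_i}}}\left(\inf_{2s-t<\tau<t}\int_{B_{4\rho}(y)}u^i(x,\tau)\,dx\right)^{\frac2{\theta_i}}\\&+\left(1+\frac{(2+(\mathbf C_2+\mathbf C_4)\rho^2)^{\frac{n+2}{\theta_i}}(t-s+\rho^2)^{\frac{n+2}{\theta_i}}}{(t-s)^{\frac{n+2}{\theta_i}}}\Big(\sqrt{1+\mathbf C_4}+\big(\mathbf C_4+\sqrt{\mathbf C_2+\mathbf C_4}\big)\rho^{\frac1{\beta_i(1-m)}}\Big)^{\frac2{\theta_i}}\right)\left(\frac{t-s}{\rho^2}\right)^{\frac1{\beta_i(1-m)}}\Bigg],\end{aligned}$$ where $\sup$ and $\inf$ are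 the essential supremum and the essential infimum. -/

import Mathlib

open MeasureTheory Set
open scoped ContDiff RealInnerProductSpace

noncomputable section

namespace SingularSystem

/-- The space `ℝⁿ` with its Euclidean norm. -/
abbrev Space (n : ℕ) : Type := EuclideanSpace ℝ (Fin n)

/-- Space-time `ℝⁿ × ℝ`; a point is `z = (x, t)`. -/
abbrev SpaceTime (n : ℕ) : Type := Space n × ℝ

/-- The parabolic domain `E_T = E × (0, T]`. -/
def parDomain {n : ℕ} (E : Set (Space n)) (T : ℝ) : Set (SpaceTime n) := E ×ˢ Ioc 0 T

/-- The cylinder `B_ρ(y) × (a, b]`. -/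
def cylinder {n : ℕ} (y : Space n) (ρ a b : ℝ) : Set (SpaceTime n) :=
  Metric.ball y ρ ×ˢ Ioc a b

/-- Smooth test functions with compact support in `E × (0, T)`. -/
structure IsTestFunction {n : ℕ} (E : Set (Space n)) (T : ℝ) (φ : SpaceTime n → ℝ) : Prop where
  smooth : ContDiff ℝ ∞ φ
  compact : HasCompactSupport φ
  support : tsupport φ ⊆ E ×ˢ Ioo 0 T

/-- The time derivative `φ_t`. -/
def timeDeriv {n : ℕ} (φ : SpaceTime n → ℝ) (z : SpaceTime n) : ℝ :=
  deriv (fun τ => φ (z.1, τ)) z.2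

/-- The gradient `∇φ` in the space variable. -/
def spaceGrad {n : ℕ} (φ : SpaceTime n → ℝ) (z : SpaceTime n) : Space n :=
  gradient (fun x => φ (x, z.2)) z.1

/-- `g` is the weak (distributional) spatial gradient of `v` in `E × (0, T)`. -/
structure HasWeakSpaceGrad {n : ℕ} (E : Set (Space n)) (T : ℝ) (v : SpaceTime n → ℝ)
    (g : SpaceTime n → Space n) : Prop where
  locallyIntegrable : LocallyIntegrableOn v (E ×ˢ Ioo 0 T)
  locallyIntegrable_grad : LocallyIntegrableOn g (E ×ˢ Ioo 0 T)
  integral_eq : ∀ φ : SpaceTime n → ℝ, IsTestFunction E T φ →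
    ∫ z in parDomain E T, v z • spaceGrad φ z = -∫ z in parDomain E T, φ z • g z

/-- Weak (energy) solutions `u = (u¹, …, uᵏ)` in `E_T` of the system
`(uⁱ)_t = ∇ · (m U^{m-1} 𝒜(∇uⁱ, uⁱ, x, t))`, `1 ≤ i ≤ k`, where `U = U(u¹, …, uᵏ)`.
For `m < 1` the real power `U ^ (m - 1)` is read as `0` where `U = 0`; under the hypotheses of the
theorem `uⁱ = 0`, `∇uⁱ = 0` and `𝒜(∇uⁱ, uⁱ, x, t) = 0` almost everywhere on that set, so the flux
there is `0` in any convention. -/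
def IsWeakSolution {n k : ℕ} (E : Set (Space n)) (T m : ℝ) (U : (Fin k → ℝ) → ℝ)
    (A : Space n → ℝ → Space n → ℝ → Space n) (u : Fin k → SpaceTime n → ℝ) : Prop :=
  ∃ Du : Fin k → SpaceTime n → Space n, ∀ i,
    HasWeakSpaceGrad E T (u i) (Du i) ∧
    MemLp (fun z => (U fun j => u j z) ^ (m - 1) • A (Du i z) (u i z) z.1 z.2) 2
      (volume.restrict (parDomain E T)) ∧
    ∀ φ : SpaceTime n → ℝ, IsTestFunction E T φ →
      ∫ z in parDomain E T,
        (m * (U fun j => u j z) ^ (m - 1) * ⟪A (Du i z) (u i z) z.1 z.2, spaceGrad φ z⟫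
          - u i z * timeDeriv φ z) = 0

/-- The structure conditions on `𝒜(p, w, x, t)`, `p ∈ ℝⁿ`, `w ≥ 0`, `(x, t) ∈ E_T`: measurable in
`(x, t)`, continuous in `(p, w)`, coercive, and of linear growth. -/
structure FluxStructure {n : ℕ} (E : Set (Space n)) (T c C₂ C₃ C₄ : ℝ)
    (A : Space n → ℝ → Space n → ℝ → Space n) : Prop where
  measurable : ∀ (p : Space n) (w : ℝ), 0 ≤ w →
    AEStronglyMeasurable (fun z : SpaceTime n => A p w z.1 z.2) (volume.restrict (parDomain E T))
  continuous : ∀ᵐ z ∂volume.restrict (parDomain E T),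
    ContinuousOn (fun q : Space n × ℝ => A q.1 q.2 z.1 z.2) (univ ×ˢ Ici 0)
  coercive : ∀ᵐ z ∂volume.restrict (parDomain E T), ∀ (p : Space n) (w : ℝ), 0 ≤ w →
    c * ‖p‖ ^ 2 - C₂ * w ^ 2 ≤ ⟪A p w z.1 z.2, p⟫
  growth : ∀ᵐ z ∂volume.restrict (parDomain E T), ∀ (p : Space n) (w : ℝ), 0 ≤ w →
    ‖A p w z.1 z.2‖ ≤ C₃ * ‖p‖ + C₄ * w

/-- The relation between the diffusion coefficient and the components:
`uʲ ≥ 0` and `λ_j (uʲ)^{β_j} ≤ U(u¹, …, uᵏ)` almost everywhere in `E_T`, for every `j`. -/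
def Dominates {n k : ℕ} (E : Set (Space n)) (T : ℝ) (lam bet : Fin k → ℝ)
    (U : (Fin k → ℝ) → ℝ) (u : Fin k → SpaceTime n → ℝ) : Prop :=
  ∀ᵐ z ∂volume.restrict (parDomain E T), ∀ j,
    0 ≤ u j z ∧ lam j * u j z ^ bet j ≤ U fun l => u l z

/-- Bounded nonnegative components have a bounded `U(u¹, …, uᵏ)`: an upper bound `Λ` always
exists. -/
theorem exists_upper_bound {n k : ℕ} (E : Set (Space n)) (T : ℝ) (U : (Fin k → ℝ) → ℝ)
    (hU : ContinuousOn U {ξ | ∀ j, 0 ≤ ξ j}) (u : Fin k → SpaceTime n → ℝ)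
    (h0 : ∀ᵐ z ∂volume.restrict (parDomain E T), ∀ j, 0 ≤ u j z)
    (hb : ∀ j, ∃ M : ℝ, ∀ᵐ z ∂volume.restrict (parDomain E T), u j z ≤ M) :
    ∃ L : ℝ, 0 < L ∧ ∀ᵐ z ∂volume.restrict (parDomain E T), (U fun j => u j z) ≤ L := by
  choose M hM using hb
  have hc : IsCompact (Icc (0 : Fin k → ℝ) M) := isCompact_Icc
  obtain ⟨C, hC⟩ := hc.exists_bound_of_continuousOn (hU.mono fun ξ hξ j => hξ.1 j)
  refine ⟨max C 1, lt_max_of_lt_right one_pos, ?_⟩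
  filter_upwards [h0, ae_all_iff.2 hM] with z h1 h2
  exact (le_abs_self _).trans ((hC _ ⟨h1, h2⟩).trans (le_max_left _ _))

end SingularSystem

end

/-! Write q = β_i (1 - m), which lies in (0, 1), and u for the component uⁱ. Then u solves a scalar
equation u_t = ∇ · (D A) with D = m U^{m-1}. The other components enter only through D, and D is
controlled from both sides: U ≤ Λ bounds it below by a positive constant, and λ u^β ≤ U bounds it
above by a multiple of u^{-q}. The bound on U also gives u ≤ K = (Λ/λ)^{1/β}.

If t - s ≥ ρ², the bound u ≤ K alone proves the estimate, because the last term on the right is then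
at least γ. Otherwise put ε = (t - s)/ρ² ≤ 1 and M = ε^{1/q}, and pass to v(x, τ) = u(y + ρx, s + (t
- s)τ)/M on B₄ × (-1, 1). Since M^q = ε, the upper bound v^{-q} on the diffusion is scale invariant;
the price is that the lower bound degenerates like ε, and the lower order terms are measured by R =
2 + (C₂ + C₄)ρ². The nonnegative density E = ⟪F, ∇v⟫ + C R v^{2-q} then satisfies ε|∇v|² ≤ C E and
|F| ≤ C (v^{-q/2} √E + √R v^{1-q}).

Two estimates are combined in the normalized cylinder. The first is an L¹ Harnack inequality
(`exists_mass_le_mass`). Testing with a slowly decaying function of v bounds a weighted integral of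
E, and hence ∫|F|, by powers of the mass S with exponent below 1 (`exists_mass_le_add`). As these
powers are sublinear, they are absorbed over a sequence of radii. The flux bound does not see the
direction of time, so the mass at any time is controlled by the mass at any other time, earlier or
later, plus R^{1/(2q)}. The second is De Giorgi's iteration for the truncations (v - k)₊ with k ≥ 1,
where the singular factor v^{-q} is at most 1 (`exists_truncation_step`,
`exists_le_of_truncation_small`). After interpolation it bounds sup v by 1 + N ∫∫ v, with N = R
(R/ε)^{n/2} (`exists_le_mass`). Together they give `exists_le_mass_slice`, a bound that is linear in
the mass at almost any single time. Undoing the scaling (`exists_le_mass_cylinder`) and using X ≤ 1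
+ X^{2/θ} (`linear_le_power`) produces the stated powers.

All identities are justified by mollification in space-time. The relations ∇v = g and v_t = ∇ · F
are linear, so they hold exactly for the mollified functions, and the nonlinear energy identity
passes to the limit between almost all pairs of times (`BoxSolution.energy_identity`). No time
derivative or Steklov average of v is needed. On {v = 0}, where D is not controlled, the gradient
vanishes almost everywhere (`WeakGradOn.ae_eq_zero`), and therefore so does the flux. -/

namespace SingularSystem

open Filter Topology

/-! ### Iteration lemmas, cutoffs, generalized dominated convergence and a Faber–Krahn inequality.
-/

noncomputable section

/-- Absorption of a small multiple of the left-hand side by iteration over radii. -/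
theorem absorb_of_forall_lt {f : ℝ → ℝ} {r₀ r₁ S A b δ : ℝ} (hr : r₀ < r₁)
    (hA : 0 ≤ A) (hδ : 0 ≤ δ) (hδb : δ * 2 ^ b ≤ 1 / 2) (hδ1 : δ < 1)
    (hS : ∀ r ∈ Icc r₀ r₁, f r ≤ S)
    (h : ∀ r r', r₀ ≤ r → r < r' → r' ≤ r₁ → f r ≤ δ * f r' + A * (r' - r) ^ (-b)) :
    f r₀ ≤ 2 * 2 ^ b * (r₁ - r₀) ^ (-b) * A := by
  set B := A * (r₁ - r₀) ^ (-b) with hB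
  -- Gaps that halve cost a factor 2^b per step. Against δ^j with δ 2^b ≤ 1/2 the costs sum as a
  -- geometric series, and the remainder δ^j f(ρ_j) dies because f is bounded by S.
  set ρ : ℕ → ℝ := fun j => r₁ - (r₁ - r₀) * (1 / 2) ^ j with hρ
  have hpow : ∀ j : ℕ, 0 < (1 / 2 : ℝ) ^ j ∧ (1 / 2 : ℝ) ^ j ≤ 1 := fun j =>
    ⟨by positivity, pow_le_one₀ (by norm_num) (by norm_num)⟩
  have hmem : ∀ j, ρ j ∈ Icc r₀ r₁ := fun j => by
    have := hpow j
    constructor <;> simp only [hρ] <;> nlinarith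
  have hdiff : ∀ j, ρ (j + 1) - ρ j = (r₁ - r₀) * (1 / 2) ^ (j + 1) := fun j => by
    simp only [hρ, pow_succ]; ring
  have hstep : ∀ j, f (ρ j) ≤ δ * f (ρ (j + 1)) + B * (2 ^ b) ^ (j + 1) := fun j => by
    have h1 := h (ρ j) (ρ (j + 1)) (hmem j).1
      (by have := hdiff j; have := hpow (j + 1); nlinarith) (hmem (j + 1)).2
    rw [hdiff, Real.mul_rpow (by linarith) (hpow _).1.le] at h1
    have : ((1 / 2 : ℝ) ^ (j + 1)) ^ (-b) = (2 ^ b) ^ (j + 1) := by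
      rw [one_div, inv_pow, Real.inv_rpow (by positivity), Real.rpow_neg (by positivity), inv_inv,
        ← Real.rpow_natCast, ← Real.rpow_mul (by norm_num), mul_comm, Real.rpow_mul (by norm_num),
        Real.rpow_natCast]
    rw [this] at h1
    rw [hB]; linarith
  have key : ∀ j, f r₀ ≤ δ ^ j * f (ρ j) + 2 * 2 ^ b * B * (1 - (1 / 2) ^ j) := by
    intro j
    induction j with
    | zero => simp [hρ]
    | succ j ih =>
      refine ih.trans ?_
      have h2 := mul_le_mul_of_nonneg_left (hstep j) (pow_nonneg hδ j)
      have h3 : δ ^ j * (2 ^ b) ^ j ≤ (1 / 2) ^ j := by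
        rw [← mul_pow]; exact pow_le_pow_left₀ (by positivity) hδb j
      have h4 : δ ^ j * (B * (2 ^ b) ^ (j + 1)) ≤ 2 ^ b * B * (1 / 2) ^ j := by
        calc _ = (2 ^ b * B) * (δ ^ j * (2 ^ b) ^ j) := by ring
          _ ≤ _ := mul_le_mul_of_nonneg_left h3 (by positivity)
      calc _ ≤ δ ^ j * (δ * f (ρ (j + 1)) + B * (2 ^ b) ^ (j + 1))
            + 2 * 2 ^ b * B * (1 - (1 / 2) ^ j) := by linarith
        _ ≤ _ := by
          rw [pow_succ δ, pow_succ (1 / 2 : ℝ)]; nlinarith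
  have lim : Tendsto (fun j : ℕ => δ ^ j * |S| + 2 * 2 ^ b * B) atTop
      (𝓝 (0 * |S| + 2 * 2 ^ b * B)) :=
    ((tendsto_pow_atTop_nhds_zero_of_lt_one hδ hδ1).mul_const _).add_const _
  have := ge_of_tendsto' lim fun j => (key j).trans (add_le_add
    (mul_le_mul_of_nonneg_left ((hS _ (hmem j)).trans (le_abs_self S)) (pow_nonneg hδ j))
    (mul_le_of_le_one_right (by positivity) (by linarith [(hpow j).1])))
  rw [hB] at this; linarith

/-- Young's inequality with a free small parameter. -/
theorem mul_rpow_le_add {x y s δ : ℝ} (hx : 0 ≤ x) (hy : 0 ≤ y) (hs : 0 < s) (hs1 : s < 1)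
    (hδ : 0 < δ) : y * x ^ (1 - s) ≤ δ * x + δ ^ (-(1 - s) / s) * y ^ (1 / s) := by
  rcases hx.eq_or_lt with rfl | hx
  · rw [Real.zero_rpow (by linarith)]; simp; positivity
  -- Either the product is already below δx, or x^s < y/δ and x can be eliminated.
  by_cases h : y ≤ δ * x ^ s
  · calc y * x ^ (1 - s) ≤ δ * x ^ s * x ^ (1 - s) := by gcongr
      _ = δ * x := by rw [mul_assoc, ← Real.rpow_add hx]; simp
      _ ≤ _ := le_add_of_nonneg_right (by positivity)
  · push Not at h
    have hy0 : 0 < y := lt_of_le_of_lt (by positivity) h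
    have h1 : x ^ s ≤ y / δ := by rw [le_div_iff₀ hδ]; linarith
    have h2 : x ^ (1 - s) ≤ (y / δ) ^ ((1 - s) / s) := by
      calc x ^ (1 - s) = (x ^ s) ^ ((1 - s) / s) := by
            rw [← Real.rpow_mul hx.le]; congr 1; field_simp
        _ ≤ _ := Real.rpow_le_rpow (by positivity) h1 (div_nonneg (by linarith) hs.le)
    calc y * x ^ (1 - s) ≤ y * (y / δ) ^ ((1 - s) / s) := by gcongr
      _ = δ ^ (-(1 - s) / s) * y ^ (1 / s) := by
        rw [Real.div_rpow hy hδ.le, neg_div, Real.rpow_neg hδ.le]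
        have : (1 : ℝ) / s = 1 + (1 - s) / s := by field_simp; ring
        rw [this, Real.rpow_add hy0, Real.rpow_one]; field_simp
      _ ≤ _ := le_add_of_nonneg_left (by positivity)

/-- Fast geometric convergence. -/
theorem tendsto_zero_of_superlinear {Y : ℕ → ℝ} {A b δ : ℝ} (hY : ∀ j, 0 ≤ Y j) (hA : 0 ≤ A)
    (hb : 1 < b) (hδ : 0 < δ) (h : ∀ j, Y (j + 1) ≤ A * b ^ j * Y j ^ (1 + δ))
    (h0 : A * Y 0 ^ δ * b ^ (1 / δ) ≤ 1) : Tendsto Y atTop (𝓝 0) := by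
  have hb0 : 0 < b := by linarith
  -- This ratio satisfies c^δ = 1/b, so along Y_j ≤ Y_0 c^j the gain Y_j^δ cancels the growth b^j
  -- exactly.
  set c := b ^ (-(1 / δ)) with hc
  have hc0 : 0 < c := Real.rpow_pos_of_pos hb0 _
  have hc1 : c < 1 := Real.rpow_lt_one_of_one_lt_of_neg hb (by simp [hδ])
  have hcδ : c ^ δ = b⁻¹ := by
    rw [hc, ← Real.rpow_mul hb0.le, neg_mul, one_div_mul_cancel hδ.ne', Real.rpow_neg_one]
  have hAc : A * Y 0 ^ δ ≤ c := by
    rw [hc, Real.rpow_neg hb0.le, ← one_div, le_div_iff₀ (by positivity)]; exact h0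
  have key : ∀ j, Y j ≤ Y 0 * c ^ j := by
    intro j
    induction j with
    | zero => simp
    | succ j ih =>
      have h1 : Y j ^ δ ≤ Y 0 ^ δ * (b ^ j)⁻¹ := by
        calc Y j ^ δ ≤ (Y 0 * c ^ j) ^ δ := Real.rpow_le_rpow (hY j) ih hδ.le
          _ = Y 0 ^ δ * (c ^ δ) ^ j := by
            rw [Real.mul_rpow (hY 0) (by positivity), ← Real.rpow_natCast, ← Real.rpow_mul hc0.le,
              mul_comm (j : ℝ), Real.rpow_mul hc0.le, Real.rpow_natCast]
          _ = _ := by rw [hcδ, inv_pow]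
      calc Y (j + 1) ≤ A * b ^ j * Y j ^ (1 + δ) := h j
        _ = A * b ^ j * (Y j * Y j ^ δ) := by
          rw [Real.rpow_add_of_nonneg (hY j) zero_le_one hδ.le, Real.rpow_one]
        _ ≤ A * b ^ j * (Y j * (Y 0 ^ δ * (b ^ j)⁻¹)) := by have := hY j; gcongr
        _ = A * Y 0 ^ δ * Y j := by field_simp
        _ ≤ c * (Y 0 * c ^ j) := mul_le_mul hAc ih (hY j) hc0.le
        _ = _ := by rw [pow_succ]; ring
  have lim := (tendsto_pow_atTop_nhds_zero_of_lt_one hc0.le hc1).const_mul (Y 0)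
  rw [mul_zero] at lim
  exact squeeze_zero hY key lim

theorem exists_bound_deriv_smoothTransition :
    ∃ C : ℝ, 0 < C ∧ ∀ s, |deriv Real.smoothTransition s| ≤ C := by
  have hc : Continuous (deriv Real.smoothTransition) :=
    (Real.smoothTransition.contDiff (n := 1)).continuous_deriv le_rfl
  obtain ⟨C, hC⟩ := isCompact_Icc.exists_bound_of_continuousOn (s := Icc (0 : ℝ) 1) hc.continuousOn
  have hC0 : 0 ≤ C := (norm_nonneg _).trans (hC 0 (by simp))
  refine ⟨C + 1, by linarith, fun s => ?_⟩
  by_cases hs : s ∈ Icc (0 : ℝ) 1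
  · exact (hC s hs).trans (by linarith)
  · have : deriv Real.smoothTransition s = 0 := by
      rw [mem_Icc, not_and_or] at hs
      rcases hs with hs | hs <;> push Not at hs
      · have : Real.smoothTransition =ᶠ[𝓝 s] fun _ => 0 := by
          filter_upwards [Iio_mem_nhds hs] with x hx using
            Real.smoothTransition.zero_of_nonpos (le_of_lt hx)
        rw [this.deriv_eq]; simp
      · have : Real.smoothTransition =ᶠ[𝓝 s] fun _ => 1 := by
          filter_upwards [Ioi_mem_nhds hs] with x hx using
            Real.smoothTransition.one_of_one_le (le_of_lt hx)
        rw [this.deriv_eq]; simp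
    rw [this]; simp; linarith

/-- Cutoffs in time with controlled derivative. -/
theorem exists_time_cutoff : ∃ C : ℝ, 0 < C ∧ ∀ a b : ℝ, a < b →
    ∃ χ : ℝ → ℝ, ContDiff ℝ ∞ χ ∧ (∀ t, χ t ∈ Icc (0 : ℝ) 1) ∧ (∀ t ≤ a, χ t = 0) ∧
      (∀ t, b ≤ t → χ t = 1) ∧ ∀ t, |deriv χ t| ≤ C / (b - a) := by
  obtain ⟨C, hC0, hC⟩ := exists_bound_deriv_smoothTransition
  refine ⟨C, hC0, fun a b hab => ⟨fun t => Real.smoothTransition ((t - a) / (b - a)), ?_, ?_, ?_,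
    ?_, ?_⟩⟩
  · exact Real.smoothTransition.contDiff.comp (by fun_prop)
  · exact fun t => ⟨Real.smoothTransition.nonneg _, Real.smoothTransition.le_one _⟩
  · exact fun t ht => Real.smoothTransition.zero_of_nonpos
      (div_nonpos_of_nonpos_of_nonneg (by linarith) (by linarith))
  · exact fun t ht => Real.smoothTransition.one_of_one_le
      ((one_le_div (by linarith)).2 (by linarith))
  · intro t
    have h1 : HasDerivAt (fun t => (t - a) / (b - a)) (1 / (b - a)) t :=
      ((hasDerivAt_id t).sub_const a).div_const _
    have h2 : HasDerivAt Real.smoothTransition _ ((t - a) / (b - a)) :=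
      ((Real.smoothTransition.contDiff (n := 1)).differentiable (by simp) _).hasDerivAt
    have h3 := (h2.comp t h1).deriv
    simp only [Function.comp_def] at h3
    rw [h3, abs_mul, abs_of_pos (a := 1 / (b - a)) (by
      apply one_div_pos.2; linarith), mul_one_div]
    exact div_le_div_of_nonneg_right (hC _) (by linarith)

/-- Cutoffs between concentric balls with controlled gradient. -/
theorem exists_space_cutoff (n : ℕ) : ∃ C : ℝ, 0 < C ∧ ∀ r r' : ℝ, 0 < r → r < r' →
    ∃ η : Space n → ℝ, ContDiff ℝ ∞ η ∧ (∀ x, η x ∈ Icc (0 : ℝ) 1) ∧ (∀ x, ‖x‖ ≤ r → η x = 1) ∧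
      (∀ x, r' ≤ ‖x‖ → η x = 0) ∧ ∀ x, ‖fderiv ℝ η x‖ ≤ C / (r' - r) := by
  obtain ⟨C, hC0, hC⟩ := exists_bound_deriv_smoothTransition
  refine ⟨2 * C, by linarith, fun r r' hr hrr' => ?_⟩
  -- Squared norms keep the cutoff smooth at the origin. Factoring this difference gives the
  -- gradient bound 2r'/((r' - r)(r' + r)) ≤ 2/(r' - r), up to the constant C.
  have hD : 0 < r' ^ 2 - r ^ 2 := by nlinarith
  have hzero : ∀ x : Space n, r' ≤ ‖x‖ →
      Real.smoothTransition ((r' ^ 2 - ‖x‖ ^ 2) / (r' ^ 2 - r ^ 2)) = 0 := fun x hx =>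
    Real.smoothTransition.zero_of_nonpos (div_nonpos_of_nonpos_of_nonneg (by nlinarith) hD.le)
  refine ⟨fun x => Real.smoothTransition ((r' ^ 2 - ‖x‖ ^ 2) / (r' ^ 2 - r ^ 2)), ?_, ?_, ?_,
    hzero, ?_⟩
  · exact Real.smoothTransition.contDiff.comp
      ((contDiff_const.sub (contDiff_norm_sq ℝ)).div_const _)
  · exact fun t => ⟨Real.smoothTransition.nonneg _, Real.smoothTransition.le_one _⟩
  · exact fun x hx => Real.smoothTransition.one_of_one_le
      ((one_le_div hD).2 (by nlinarith [norm_nonneg x]))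
  · intro x
    by_cases hx : ‖x‖ ≤ r'
    · have h1 : HasFDerivAt (fun x : Space n => (r' ^ 2 - ‖x‖ ^ 2) * (r' ^ 2 - r ^ 2)⁻¹)
          ((r' ^ 2 - r ^ 2)⁻¹ • -((2 : ℕ) • (innerSL ℝ x : Space n →L[ℝ] ℝ))) x :=
        ((hasStrictFDerivAt_norm_sq x).hasFDerivAt.const_sub _).mul_const _
      have h2 : HasDerivAt Real.smoothTransition _ ((r' ^ 2 - ‖x‖ ^ 2) * (r' ^ 2 - r ^ 2)⁻¹) :=
        ((Real.smoothTransition.contDiff (n := 1)).differentiable (by simp) _).hasDerivAt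
      simp only [div_eq_mul_inv (r' ^ 2 - ‖_‖ ^ 2)]
      have h3 := (h2.comp_hasFDerivAt x h1).fderiv
      simp only [Function.comp_def] at h3
      rw [h3, norm_smul, norm_smul, norm_neg, norm_inv]
      have h4 : ‖(2 : ℕ) • innerSL ℝ x‖ ≤ 2 * r' := by
        rw [two_nsmul]
        refine (norm_add_le _ _).trans ?_
        rw [innerSL_apply_norm]; linarith
      have hd : (0 : ℝ) < r' - r := by linarith
      calc _ ≤ C * (‖r' ^ 2 - r ^ 2‖⁻¹ * (2 * r')) := by
            gcongr; exact hC _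
        _ = C * (2 * r' / ((r' - r) * (r' + r))) := by
            rw [Real.norm_of_nonneg hD.le, ← div_eq_inv_mul]
            congr 2; ring
        _ ≤ C * (2 / (r' - r)) := by
            refine mul_le_mul_of_nonneg_left ?_ hC0.le
            rw [div_le_div_iff₀ (mul_pos hd (by linarith)) hd]
            nlinarith [mul_pos hd hr]
        _ = _ := by ring
    · push Not at hx
      have : (fun x : Space n => Real.smoothTransition ((r' ^ 2 - ‖x‖ ^ 2) / (r' ^ 2 - r ^ 2)))
          =ᶠ[𝓝 x] fun _ => 0 := by
        filter_upwards [(isOpen_lt continuous_const continuous_norm).mem_nhds hx] with z hz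
        exact hzero z (le_of_lt hz)
      rw [this.fderiv_eq]; simp
      exact div_nonneg (by linarith) (by linarith)

/-- Dominated convergence with a convergent sequence of dominating functions. -/
theorem tendsto_integral_of_dominated_seq {X : Type*} [MeasurableSpace X] {μ : Measure X}
    {f : ℕ → X → ℝ} {f' : X → ℝ} {G : ℕ → X → ℝ} {G' : X → ℝ}
    (hf : ∀ j, AEStronglyMeasurable (f j) μ) (hG : ∀ j, Integrable (G j) μ)
    (hG' : Integrable G' μ) (hfG : ∀ᶠ j in atTop, ∀ᵐ x ∂μ, |f j x| ≤ G j x)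
    (hlim : ∀ᵐ x ∂μ, Tendsto (fun j => f j x) atTop (𝓝 (f' x)))
    (hGlim : ∀ᵐ x ∂μ, Tendsto (fun j => G j x) atTop (𝓝 (G' x)))
    (hGint : Tendsto (fun j => ∫ x, G j x ∂μ) atTop (𝓝 (∫ x, G' x ∂μ))) :
    Tendsto (fun j => ∫ x, f j x ∂μ) atTop (𝓝 (∫ x, f' x ∂μ)) := by
  -- Everything is clamped to [-|G'|, |G'|], where the usual theorem applies. Since |f_j| ≤ G_j,
  -- clamping moves f_j no further than it moves G_j, and that displacement tends to 0 in L¹ because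
  -- the integrals of G_j converge.
  have habs : Integrable (fun x => |G' x|) μ := hG'.abs
  have h1 : Tendsto (fun j => ∫ x, max (-|G' x|) (min (G j x) |G' x|) ∂μ) atTop
      (𝓝 (∫ x, G' x ∂μ)) := by
    refine tendsto_integral_of_dominated_convergence (fun x => |G' x|) (fun j => ?_) habs
      (fun j => ae_of_all _ fun x => ?_) ?_
    · exact habs.aestronglyMeasurable.neg.sup ((hG j).aestronglyMeasurable.inf
        habs.aestronglyMeasurable)
    · rw [Real.norm_eq_abs, abs_le]
      exact ⟨le_max_left _ _, max_le (by linarith [abs_nonneg (G' x)]) (min_le_right _ _)⟩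
    · filter_upwards [hGlim] with x hx
      have := (tendsto_const_nhds (x := -|G' x|)).max (hx.min (tendsto_const_nhds (x := |G' x|)))
      rwa [min_eq_left (le_abs_self _), max_eq_right (neg_abs_le _)] at this
  have h2 : Tendsto (fun j => ∫ x, max (-|G' x|) (min (f j x) |G' x|) ∂μ) atTop
      (𝓝 (∫ x, f' x ∂μ)) := by
    refine tendsto_integral_of_dominated_convergence (fun x => |G' x|) (fun j => ?_) habs
      (fun j => ae_of_all _ fun x => ?_) ?_
    · exact habs.aestronglyMeasurable.neg.sup ((hf j).inf habs.aestronglyMeasurable)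
    · rw [Real.norm_eq_abs, abs_le]
      exact ⟨le_max_left _ _, max_le (by linarith [abs_nonneg (G' x)]) (min_le_right _ _)⟩
    · have hall : ∀ᵐ x ∂μ, ∀ᶠ j in atTop, |f j x| ≤ G j x := by
        obtain ⟨N, hN⟩ := eventually_atTop.1 hfG
        have : ∀ᵐ x ∂μ, ∀ j, N ≤ j → |f j x| ≤ G j x := by
          rw [ae_all_iff]; intro j
          by_cases hj : N ≤ j
          · filter_upwards [hN j hj] with x hx _ using hx
          · exact ae_of_all _ fun x h => absurd h hj
        filter_upwards [this] with x hx
        exact eventually_atTop.2 ⟨N, hx⟩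
      filter_upwards [hlim, hGlim, hall] with x hx hGx hb
      have hle : |f' x| ≤ |G' x| :=
        (le_of_tendsto_of_tendsto hx.abs hGx hb).trans (le_abs_self _)
      have := (tendsto_const_nhds (x := -|G' x|)).max (hx.min (tendsto_const_nhds (x := |G' x|)))
      rwa [min_eq_left ((le_abs_self _).trans hle), max_eq_right (by
        linarith [neg_abs_le (f' x)])] at this
  have h3 : Tendsto (fun j => (∫ x, G j x ∂μ) - ∫ x, max (-|G' x|) (min (G j x) |G' x|) ∂μ) atTop
      (𝓝 0) := by simpa using hGint.sub h1
  have hcl : ∀ {g : X → ℝ}, AEStronglyMeasurable g μ →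
      Integrable (fun x => max (-|G' x|) (min (g x) |G' x|)) μ := fun hg =>
    habs.mono' (habs.aestronglyMeasurable.neg.sup (hg.inf habs.aestronglyMeasurable))
      (ae_of_all _ fun x => by
        rw [Real.norm_eq_abs, abs_le]
        exact ⟨le_max_left _ _, max_le (by linarith [abs_nonneg (G' x)]) (min_le_right _ _)⟩)
  have h4 : Tendsto (fun j => (∫ x, f j x ∂μ) - ∫ x, max (-|G' x|) (min (f j x) |G' x|) ∂μ) atTop
      (𝓝 0) := by
    refine squeeze_zero_norm' ?_ h3
    filter_upwards [hfG] with j hj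
    have hfi : Integrable (f j) μ := (hG j).mono' (hf j) (by simpa using hj)
    rw [← integral_sub hfi (hcl (hf j)), ← integral_sub (hG j) (hcl (hG j).aestronglyMeasurable)]
    refine norm_integral_le_of_norm_le ((hG j).sub (hcl (hG j).aestronglyMeasurable)) ?_
    filter_upwards [hj] with x hx
    rw [Real.norm_eq_abs]
    have ha := abs_nonneg (G' x)
    have := abs_le.1 hx
    rw [abs_le]
    rcases le_total (G j x) |G' x| with hg | hg <;> rcases le_total (f j x) |G' x| with hh | hh <;>
      simp only [min_eq_left, min_eq_right, hg, hh] <;>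
      rcases le_total (-|G' x|) (f j x) with hk | hk <;>
      rcases le_total (-|G' x|) (G j x) with hl | hl <;>
      simp only [max_eq_left, max_eq_right, hk, hl,
        max_eq_right (show -|G' x| ≤ |G' x| by linarith)]
        <;> constructor <;> linarith
  simpa using h4.add h2

/-- Hölder's inequality for the measure restricted to `S`, which carries the whole norm. -/
theorem eLpNorm_le_mul_measure_of_eq_zero {X F : Type*} [MeasurableSpace X] {μ : Measure X}
    [NormedAddCommGroup F] {f : X → F} {S : Set X} {p q : ENNReal} (hpq : p ≤ q)
    (hf : AEStronglyMeasurable f μ) (hfS : ∀ x, x ∉ S → f x = 0) :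
    eLpNorm f p μ ≤ eLpNorm f q μ * μ S ^ (1 / p.toReal - 1 / q.toReal) := by
  have hsupp : Function.support f ⊆ S := fun x hx => by
    by_contra h; exact hx (hfS x h)
  rw [← eLpNorm_restrict_eq_of_support_subset hsupp,
    ← eLpNorm_restrict_eq_of_support_subset (p := q) hsupp]
  simpa using eLpNorm_le_eLpNorm_mul_rpow_measure_univ (μ := μ.restrict S) hpq hf.restrict

/-- A Faber–Krahn inequality for nonnegative functions vanishing outside a set `S`. -/
theorem exists_faberKrahn (n : ℕ) (hn : 2 ≤ n) : ∃ C : ℝ, 0 < C ∧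
    ∀ (p : Space n → ℝ) (S : Set (Space n)), ContDiff ℝ 1 p → HasCompactSupport p →
      (∀ x, 0 ≤ p x) → MeasurableSet S → volume S ≠ ⊤ → (∀ x, x ∉ S → p x = 0) →
      ∫ x, p x ^ 2 ≤ C * volume.real S ^ (2 / n : ℝ) * ∫ x, ‖fderiv ℝ p x‖ ^ 2 := by
  -- The exponent whose Sobolev conjugate is 2. It is at least 1 exactly because n ≥ 2, and Hölder
  -- from L² down to L^P on S costs |S|^{1/n}.
  set P : NNReal := 2 * n / (n + 2) with hP
  have hPr : (P : ℝ) = 2 * n / (n + 2) := by simp [hP]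
  have hP1 : 1 ≤ P := by
    rw [← NNReal.coe_le_coe, hPr, NNReal.coe_one, one_le_div (by positivity)]
    have : (2 : ℝ) ≤ n := by exact_mod_cast hn
    linarith
  have hP2 : (P : ℝ) ≤ 2 := by
    rw [hPr, div_le_iff₀ (by positivity)]; linarith
  have hfr : Module.finrank ℝ (Space n) = n := by simp
  set K : NNReal := eLpNormLESNormFDerivOfEqInnerConst (volume : Measure (Space n)) P
  refine ⟨(K : ℝ) ^ 2 + 1, by positivity, fun p S hp hpc hp0 hS hSf hpS => ?_⟩
  -- Nonnegativity makes every zero of p a minimum, so the gradient also vanishes off S without any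
  -- assumption on the boundary of S.
  have hd : ∀ x, x ∉ S → fderiv ℝ p x = 0 := fun x hx =>
    IsLocalMin.fderiv_eq_zero (Eventually.of_forall fun z => by rw [hpS x hx]; exact hp0 z)
  have hdc : Continuous (fderiv ℝ p) := hp.continuous_fderiv (by simp)
  have hdcs : HasCompactSupport (fderiv ℝ p) := hpc.fderiv ℝ
  have h1 : eLpNorm p 2 volume ≤ K * eLpNorm (fderiv ℝ p) P volume := by
    have := eLpNorm_le_eLpNorm_fderiv_of_eq_inner (volume : Measure (Space n)) hp hpc
      (p := P) (p' := 2) hP1 (by rw [hfr]; omega) (by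
        rw [hfr, NNReal.coe_inv, hPr]; push_cast; field_simp; ring)
    exact_mod_cast this
  have h2 : eLpNorm (fderiv ℝ p) P volume ≤
      eLpNorm (fderiv ℝ p) 2 volume * volume S ^ (1 / n : ℝ) := by
    refine (eLpNorm_le_mul_measure_of_eq_zero (q := 2) (by exact_mod_cast hP2)
      hdc.aestronglyMeasurable hd).trans_eq ?_
    congr 2
    simp only [ENNReal.coe_toReal, hPr, ENNReal.toReal_ofNat]
    field_simp
    ring
  have e1 : ∀ {F : Type} [NormedAddCommGroup F] {f : Space n → F}, Continuous f →
      HasCompactSupport f → eLpNorm f 2 volume ^ 2 = ENNReal.ofReal (∫ x, ‖f x‖ ^ 2) := by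
    intro F _ f hf hfc
    rw [(hf.memLp_of_hasCompactSupport hfc).eLpNorm_eq_integral_rpow_norm (by simp) (by simp)]
    rw [← ENNReal.ofReal_pow (by positivity), ← Real.rpow_natCast, ← Real.rpow_mul
      (integral_nonneg fun _ => by positivity)]
    simp
  have h3 : eLpNorm p 2 volume ^ 2 ≤
      (K * (eLpNorm (fderiv ℝ p) 2 volume * volume S ^ (1 / n : ℝ))) ^ 2 := by
    gcongr; exact h1.trans (by gcongr)
  rw [mul_pow, mul_pow, e1 hp.continuous hpc, e1 hdc hdcs] at h3
  have hS' : (volume S ^ (1 / n : ℝ)) ^ 2 = ENNReal.ofReal (volume.real S ^ (2 / n : ℝ)) := by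
    rw [← ENNReal.ofReal_rpow_of_nonneg measureReal_nonneg (by positivity), measureReal_def,
      ENNReal.ofReal_toReal hSf, ← ENNReal.rpow_natCast, ← ENNReal.rpow_mul]
    congr 1; push_cast; ring
  have hK : (K : ENNReal) ^ 2 = ENNReal.ofReal ((K : ℝ) ^ 2) := by
    rw [ENNReal.ofReal_pow (NNReal.coe_nonneg K), ENNReal.ofReal_coe_nnreal]
  have hI : 0 ≤ ∫ x, ‖fderiv ℝ p x‖ ^ 2 := integral_nonneg fun _ => by positivity
  rw [hS', hK, ← ENNReal.ofReal_mul hI, ← ENNReal.ofReal_mul (by positivity),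
    ENNReal.ofReal_le_ofReal_iff (by positivity)] at h3
  simp only [Real.norm_eq_abs, sq_abs] at h3
  refine h3.trans ?_
  have : 0 ≤ volume.real S ^ (2 / n : ℝ) := by positivity
  nlinarith [mul_nonneg hI this]

end

/-! ### Space-time mollification and the equations satisfied by mollified solutions. -/

noncomputable section

open scoped Convolution

instance (n : ℕ) : (volume : Measure (SpaceTime n)).IsAddHaarMeasure :=
  inferInstanceAs (((volume : Measure (Space n)).prod (volume : Measure ℝ)).IsAddHaarMeasure)

/-- `g` is the weak spatial gradient of `u` in the open set `O` of space-time. -/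
def WeakGradOn {n : ℕ} (O : Set (SpaceTime n)) (u : SpaceTime n → ℝ)
    (g : SpaceTime n → Space n) : Prop :=
  ∀ φ : SpaceTime n → ℝ, ContDiff ℝ ∞ φ → HasCompactSupport φ → tsupport φ ⊆ O →
    ∀ v : Space n, ∫ z, u z * fderiv ℝ φ z (v, 0) = -∫ z, φ z * ⟪g z, v⟫

/-- `u_t = ∇ · F` weakly in the open set `O` of space-time. -/
def WeakDivOn {n : ℕ} (O : Set (SpaceTime n)) (u : SpaceTime n → ℝ)
    (F : SpaceTime n → Space n) : Prop :=
  ∀ φ : SpaceTime n → ℝ, ContDiff ℝ ∞ φ → HasCompactSupport φ → tsupport φ ⊆ O →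
    ∫ z, u z * fderiv ℝ φ z (0, 1) = ∫ z, fderiv ℝ φ z (F z, 0)

/-- A bump function of radius `1 / (j + 1)` in space-time. -/
def bump (n j : ℕ) : ContDiffBump (0 : SpaceTime n) where
  rIn := 1 / (2 * (j + 1))
  rOut := 1 / (j + 1)
  rIn_pos := by positivity
  rIn_lt_rOut := by
    apply one_div_lt_one_div_of_lt <;> [positivity; skip]
    have : (0 : ℝ) ≤ j := by positivity
    linarith

/-- The standard mollifier of radius `1 / (j + 1)`. -/
def mollifier (n j : ℕ) : SpaceTime n → ℝ := (bump n j).normed volume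

/-- Space-time mollification. -/
def mollify {n : ℕ} {E : Type*} [NormedAddCommGroup E] [NormedSpace ℝ E] (j : ℕ)
    (f : SpaceTime n → E) (z : SpaceTime n) : E := ∫ w, mollifier n j (z - w) • f w

section
variable {n : ℕ} {E : Type*} [NormedAddCommGroup E] [NormedSpace ℝ E] {j : ℕ}
  {f : SpaceTime n → E}

theorem mollifier_contDiff : ContDiff ℝ ∞ (mollifier n j) := (bump n j).contDiff_normed

theorem mollifier_hasCompactSupport : HasCompactSupport (mollifier n j) :=
  (bump n j).hasCompactSupport_normed

theorem mollifier_nonneg (z : SpaceTime n) : 0 ≤ mollifier n j z := (bump n j).nonneg_normed z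

theorem mollifier_continuous : Continuous (mollifier n j) := mollifier_contDiff.continuous

theorem integral_mollifier_sub (z : SpaceTime n) : ∫ w, mollifier n j (z - w) = 1 := by
  rw [integral_sub_left_eq_self]; exact (bump n j).integral_normed

theorem mollify_eq_convolution :
    mollify j f = (mollifier n j) ⋆[ContinuousLinearMap.lsmul ℝ ℝ] f := by
  ext z; rw [convolution_lsmul_swap]; rfl

theorem mollify_eq_convolution_right :
    mollify j f = f ⋆[(ContinuousLinearMap.lsmul ℝ ℝ).flip] (mollifier n j) := by
  rw [convolution_flip, mollify_eq_convolution]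

theorem integrable_mollifier_smul (hf : Integrable f) (z : SpaceTime n) :
    Integrable fun w => mollifier n j (z - w) • f w := by
  obtain ⟨C, hC⟩ := mollifier_continuous.bounded_above_of_compact_support
    (mollifier_hasCompactSupport (n := n) (j := j))
  exact hf.bdd_smul C (mollifier_continuous.comp (by fun_prop)).aestronglyMeasurable
    (ae_of_all _ fun w => hC _)

theorem mollify_contDiff (hf : Integrable f) : ContDiff ℝ ∞ (mollify j f) := by
  rw [mollify_eq_convolution]
  exact mollifier_hasCompactSupport.contDiff_convolution_left _ mollifier_contDiff
    hf.locallyIntegrable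

/-- Putting the derivative on the kernel lets the weak formulations be tested with the kernel
itself. -/
theorem fderiv_mollify (hf : Integrable f) (z v : SpaceTime n) :
    fderiv ℝ (mollify j f) z v = ∫ w, fderiv ℝ (mollifier n j) (z - w) v • f w := by
  have h := mollifier_hasCompactSupport.hasFDerivAt_convolution_right
    ((ContinuousLinearMap.lsmul ℝ ℝ).flip : E →L[ℝ] ℝ →L[ℝ] E) hf.locallyIntegrable
    ((mollifier_contDiff (n := n) (j := j)).of_le (by simp)) z
  rw [mollify_eq_convolution_right, h.fderiv, convolution_precompR_apply _ hf.locallyIntegrable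
    (mollifier_hasCompactSupport.fderiv ℝ) (mollifier_contDiff.continuous_fderiv (by simp))]
  rfl

/-- Lebesgue differentiation: the supports shrink to the origin while the ratio of outer to inner
radius stays equal to 2. -/
theorem mollify_tendsto [CompleteSpace E] (hf : Integrable f) :
    ∀ᵐ z, Tendsto (fun j => mollify j f z) atTop (𝓝 (f z)) := by
  simp only [mollify_eq_convolution]
  refine ContDiffBump.ae_convolution_tendsto_right_of_locallyIntegrable (φ := bump n) (K := 2)
    ?_ ?_ hf.locallyIntegrable
  · exact tendsto_one_div_add_atTop_nhds_zero_nat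
  · exact Eventually.of_forall fun j => by
      simp only [bump]; field_simp; rfl

theorem mollify_integrable (hf : Integrable f) : Integrable (mollify j f) := by
  rw [mollify_eq_convolution]
  exact Integrable.integrable_convolution _ (mollifier_continuous.integrable_of_hasCompactSupport
    mollifier_hasCompactSupport) hf

theorem integral_mollify [CompleteSpace E] (hf : Integrable f) :
    ∫ z, mollify j f z = ∫ z, f z := by
  rw [mollify_eq_convolution, integral_convolution _
    (mollifier_continuous.integrable_of_hasCompactSupport mollifier_hasCompactSupport) hf]
  simp [mollifier, (bump n j).integral_normed]

theorem mollify_inner_eq {F : SpaceTime n → Space n} (hF : Integrable F) (z : SpaceTime n)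
    (v : Space n) : ⟪mollify j F z, v⟫ = ∫ w, mollifier n j (z - w) * ⟪F w, v⟫ := by
  rw [real_inner_comm, mollify, ← integral_inner (integrable_mollifier_smul hF z)]
  simp only [inner_smul_right, real_inner_comm]

theorem mollify_mem_Icc {u : SpaceTime n → ℝ} {K : ℝ} (hu : Integrable u)
    (h : ∀ z, u z ∈ Icc 0 K) (z : SpaceTime n) : mollify j u z ∈ Icc 0 K := by
  constructor
  · exact integral_nonneg fun w => mul_nonneg (mollifier_nonneg _) (h w).1
  · calc mollify j u z ≤ ∫ w, mollifier n j (z - w) * K := by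
          refine integral_mono (integrable_mollifier_smul hu z) ?_ fun w =>
            mul_le_mul_of_nonneg_left (h w).2 (mollifier_nonneg _)
          refine Integrable.mul_const ?_ _
          exact (mollifier_continuous.integrable_of_hasCompactSupport
            mollifier_hasCompactSupport).comp_sub_left z
      _ = K := by rw [integral_mul_const, integral_mollifier_sub, one_mul]

/-- Jensen's inequality for the kernel as a probability density. It follows by averaging ‖F‖ ≤
‖F‖²/(2c) + c/2 with c the norm of the average. It dominates quadratic terms by a mollified
integrable function. -/
theorem norm_mollify_sq_le {F : SpaceTime n → E}
    (hF2 : Integrable fun z => ‖F z‖ ^ 2) (z : SpaceTime n) :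
    ‖mollify j F z‖ ^ 2 ≤ mollify j (fun w => ‖F w‖ ^ 2) z := by
  set c := ‖mollify j F z‖ with hc
  rcases (norm_nonneg (mollify j F z)).eq_or_lt with h0 | h0
  · rw [hc, ← h0]; simp
    exact integral_nonneg fun w => mul_nonneg (mollifier_nonneg _) (by positivity)
  rw [← hc] at h0
  have hm : Integrable fun w => mollifier n j (z - w) :=
    (mollifier_continuous.integrable_of_hasCompactSupport
      mollifier_hasCompactSupport).comp_sub_left z
  have h1 : c ≤ ∫ w, (mollifier n j (z - w) • ‖F w‖ ^ 2) * (2 * c)⁻¹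
      + mollifier n j (z - w) * (c / 2) := by
    refine norm_integral_le_of_norm_le (((integrable_mollifier_smul hF2 z).mul_const _).add
      (hm.mul_const _)) (ae_of_all _ fun w => ?_)
    rw [norm_smul, Real.norm_of_nonneg (mollifier_nonneg _), smul_eq_mul, mul_assoc, ← mul_add]
    refine mul_le_mul_of_nonneg_left ?_ (mollifier_nonneg _)
    have : 0 ≤ (‖F w‖ - c) ^ 2 * (2 * c)⁻¹ := by positivity
    have e : (‖F w‖ - c) ^ 2 * (2 * c)⁻¹ = ‖F w‖ ^ 2 * (2 * c)⁻¹ + c / 2 - ‖F w‖ := by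
      field_simp; ring
    linarith
  rw [integral_add ((integrable_mollifier_smul hF2 z).mul_const _) (hm.mul_const _),
    integral_mul_const, integral_mul_const, integral_mollifier_sub] at h1
  change c ≤ mollify j (fun w => ‖F w‖ ^ 2) z * (2 * c)⁻¹ + 1 * (c / 2) at h1
  have h2 : c / 2 ≤ mollify j (fun w => ‖F w‖ ^ 2) z * (2 * c)⁻¹ := by linarith
  rw [← div_eq_mul_inv, le_div_iff₀ (by positivity)] at h2
  nlinarith

end

section
variable {n j : ℕ}

theorem fderiv_mollifier_sub (z w : SpaceTime n) (v : SpaceTime n) :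
    fderiv ℝ (fun w => mollifier n j (z - w)) w v = -fderiv ℝ (mollifier n j) (z - w) v := by
  have h1 : HasFDerivAt (mollifier n j) (fderiv ℝ (mollifier n j) (z - w)) (z - w) :=
    (mollifier_contDiff.differentiable (by simp) _).hasFDerivAt
  have h2 := h1.comp w ((hasFDerivAt_id w).const_sub z)
  have h3 := h2.fderiv
  simp only [Function.comp_def] at h3
  rw [h3]; simp

/-- For `z` in a compact subset of `O`, the mollifiers centred at `z` are eventually admissible
test functions in `O`. -/
theorem eventually_tsupport_mollifier_subset {O K : Set (SpaceTime n)} (hO : IsOpen O)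
    (hK : IsCompact K) (hKO : K ⊆ O) :
    ∀ᶠ j in atTop, ∀ z ∈ K, tsupport (fun w => mollifier n j (z - w)) ⊆ O := by
  obtain ⟨δ, hδ, hKδ⟩ := hK.exists_cthickening_subset_open hO hKO
  have h1 : ∀ᶠ j : ℕ in atTop, 1 / ((j : ℝ) + 1) < δ :=
    (tendsto_one_div_add_atTop_nhds_zero_nat).eventually_lt_const hδ
  filter_upwards [h1] with j hj z hz
  refine Subset.trans (closure_minimal ?_ Metric.isClosed_closedBall)
    ((Metric.closedBall_subset_cthickening hz δ).trans hKδ)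
  intro w hw
  have hw' : z - w ∈ Function.support (mollifier n j) := hw
  rw [mollifier, (bump n j).support_normed_eq, mem_ball_zero_iff] at hw'
  rw [Metric.mem_closedBall, dist_comm, dist_eq_norm]
  exact hw'.le.trans hj.le

theorem hasCompactSupport_mollifier_sub (z : SpaceTime n) :
    HasCompactSupport (fun w => mollifier n j (z - w)) :=
  mollifier_hasCompactSupport.comp_homeomorph (Homeomorph.subLeft z)

/-- The weak identity is tested with w ↦ kernel(z - w), whose derivative in w is minus that of the
kernel. The radius for which this is admissible is uniform for z in the compact set K. -/
theorem WeakGradOn.fderiv_mollify_eq {O K : Set (SpaceTime n)} {u : SpaceTime n → ℝ}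
    {g : SpaceTime n → Space n} (h : WeakGradOn O u g) (hO : IsOpen O) (hK : IsCompact K)
    (hKO : K ⊆ O) (hu : Integrable u) (hg : Integrable g) :
    ∀ᶠ j in atTop, ∀ z ∈ K, ∀ v : Space n,
      fderiv ℝ (mollify j u) z (v, 0) = ⟪mollify j g z, v⟫ := by
  filter_upwards [eventually_tsupport_mollifier_subset hO hK hKO] with j hj z hz v
  have := h (fun w => mollifier n j (z - w)) (mollifier_contDiff.comp (by fun_prop))
      (hasCompactSupport_mollifier_sub z)
    (hj z hz) v
  simp only [fderiv_mollifier_sub, mul_neg, integral_neg, neg_inj] at this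
  rw [fderiv_mollify hu, mollify_inner_eq hg, ← this]
  simp only [smul_eq_mul, mul_comm]

/-- The spatial divergence of a vector field on space-time. -/
def spaceDiv (F : SpaceTime n → Space n) (z : SpaceTime n) : ℝ :=
  ∑ i, ⟪EuclideanSpace.basisFun (Fin n) ℝ i,
    fderiv ℝ F z (EuclideanSpace.basisFun (Fin n) ℝ i, 0)⟫

/-- Same argument for the equation. It produces a classical time derivative for the mollified
function although u itself has none; the vector field is expanded in an orthonormal basis to
recognize the divergence. -/
theorem WeakDivOn.fderiv_mollify_eq {O K : Set (SpaceTime n)} {u : SpaceTime n → ℝ}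
    {F : SpaceTime n → Space n} (h : WeakDivOn O u F) (hO : IsOpen O) (hK : IsCompact K)
    (hKO : K ⊆ O) (hu : Integrable u) (hF : Integrable F) :
    ∀ᶠ j in atTop, ∀ z ∈ K, fderiv ℝ (mollify j u) z (0, 1) = spaceDiv (mollify j F) z := by
  filter_upwards [eventually_tsupport_mollifier_subset hO hK hKO] with j hj z hz
  have := h (fun w => mollifier n j (z - w)) (mollifier_contDiff.comp (by fun_prop))
      (hasCompactSupport_mollifier_sub z)
    (hj z hz)
  simp only [fderiv_mollifier_sub, mul_neg, integral_neg, neg_inj] at this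
  have hint : ∀ v : SpaceTime n, Integrable fun w => fderiv ℝ (mollifier n j) (z - w) v • F w := by
    intro v
    have hc : Continuous fun w => fderiv ℝ (mollifier n j) w v :=
      (mollifier_contDiff.continuous_fderiv (by simp)).clm_apply continuous_const
    obtain ⟨C, hC⟩ := hc.bounded_above_of_compact_support
      ((mollifier_hasCompactSupport.fderiv ℝ).comp_left (g := fun L => L v) (by simp))
    exact hF.bdd_smul C (hc.comp (by fun_prop)).aestronglyMeasurable (ae_of_all _ fun w => hC _)
  simp only [spaceDiv, fderiv_mollify hF]
  rw [fderiv_mollify hu]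
  calc ∫ w, fderiv ℝ (mollifier n j) (z - w) (0, 1) • u w
      = ∫ w, u w * fderiv ℝ (mollifier n j) (z - w) (0, 1) := by simp only [smul_eq_mul, mul_comm]
    _ = ∫ w, fderiv ℝ (mollifier n j) (z - w) (F w, 0) := this
    _ = ∫ w, ∑ i, ⟪EuclideanSpace.basisFun (Fin n) ℝ i,
          fderiv ℝ (mollifier n j) (z - w) (EuclideanSpace.basisFun (Fin n) ℝ i, 0) • F w⟫ := by
        congr 1; ext w
        conv_lhs => rw [← (EuclideanSpace.basisFun (Fin n) ℝ).sum_repr' (F w)]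
        have e : ∀ x : Space n, fderiv ℝ (mollifier n j) (z - w) (x, 0) =
          ((fderiv ℝ (mollifier n j) (z - w)).comp (ContinuousLinearMap.inl ℝ (Space n) ℝ)) x :=
          fun x => rfl
        simp only [e, map_sum, map_smul, inner_smul_right, smul_eq_mul, mul_comm]
    _ = ∑ i, ∫ w, ⟪EuclideanSpace.basisFun (Fin n) ℝ i,
          fderiv ℝ (mollifier n j) (z - w) (EuclideanSpace.basisFun (Fin n) ℝ i, 0) • F w⟫ :=
        integral_finsetSum _ fun i _ => (hint _).const_inner _
    _ = _ := by
        refine Finset.sum_congr rfl fun i _ => ?_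
        exact integral_inner (hint _) _

end

end

/-! ### The energy identity for smooth functions. -/

noncomputable section

/-- The slab `ℝⁿ × (a, b]`. -/
def slab (n : ℕ) (a b : ℝ) : Set (SpaceTime n) := univ ×ˢ Ioc a b

/-- The compact cylinder `{‖x‖ ≤ 3} × [a, b]`. -/
def coreBox (n : ℕ) (a b : ℝ) : Set (SpaceTime n) := Metric.closedBall 0 3 ×ˢ Icc a b

/-- A twice differentiable nonlinearity on `[0, ∞)` with its derivatives. -/
structure IsNonlinearity (f f' f'' : ℝ → ℝ) : Prop where
  deriv₁ : ∀ x, 0 ≤ x → HasDerivAt f (f' x) x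
  deriv₂ : ∀ x, 0 ≤ x → HasDerivAt f' (f'' x) x
  cont : ContinuousOn f'' (Ici 0)

section slab
variable {n : ℕ} {a b : ℝ}

theorem measurableSet_slab : MeasurableSet (slab n a b) := MeasurableSet.univ.prod measurableSet_Ioc

theorem isCompact_coreBox : IsCompact (coreBox n a b) :=
  (isCompact_closedBall _ _).prod isCompact_Icc

theorem volume_restrict_slab : (volume : Measure (SpaceTime n)).restrict (slab n a b) =
    (volume : Measure (Space n)).prod (volume.restrict (Ioc a b)) := by
  rw [slab, Measure.volume_eq_prod, ← Measure.prod_restrict, Measure.restrict_univ]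

/-- Cutoffs vanish for ‖x‖ > 3 throughout, so on a slab only the compact `coreBox`, which stays away
from the lateral boundary of B₄, contributes. -/
theorem integrableOn_slab {E : Type*} [NormedAddCommGroup E] {h : SpaceTime n → E}
    (hc : Continuous h) (hz : ∀ z, 3 < ‖z.1‖ → h z = 0) : IntegrableOn h (slab n a b) := by
  have h1 : IntegrableOn h (coreBox n a b) := hc.continuousOn.integrableOn_compact isCompact_coreBox
  refine h1.of_forall_sdiff_eq_zero measurableSet_slab fun z hz' => hz z ?_
  by_contra hcon
  push Not at hcon
  exact hz'.2 ⟨by simpa using hcon, Ioc_subset_Icc_self hz'.1.2⟩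

theorem hasCompactSupport_slice {E : Type*} [Zero E] {h : SpaceTime n → E}
    (hz : ∀ z, 3 < ‖z.1‖ → h z = 0) (τ : ℝ) : HasCompactSupport fun x => h (x, τ) :=
  HasCompactSupport.intro (isCompact_closedBall (0 : Space n) 3) fun x hx => hz _ (by
    simpa using hx)

theorem integrable_slice {E : Type*} [NormedAddCommGroup E] {h : SpaceTime n → E}
    (hc : Continuous h) (hz : ∀ z, 3 < ‖z.1‖ → h z = 0) (τ : ℝ) : Integrable fun x => h (x, τ) :=
  (hc.comp (by fun_prop)).integrable_of_hasCompactSupport (hasCompactSupport_slice hz τ)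

theorem hasFDerivAt_slice {E : Type*} [NormedAddCommGroup E] [NormedSpace ℝ E]
    {h : SpaceTime n → E} {L : SpaceTime n →L[ℝ] E} {z : SpaceTime n} (hh : HasFDerivAt h L z) :
    HasFDerivAt (fun x => h (x, z.2)) (L.comp (ContinuousLinearMap.inl ℝ (Space n) ℝ)) z.1 :=
  HasFDerivAt.comp (f := fun x : Space n => (x, z.2)) (x := z.1) (g := h) (by exact hh)
    (hasFDerivAt_prodMk_left z.1 z.2)

end slab

section identity
variable {n : ℕ} {f f' f'' : ℝ → ℝ} {U ζ : SpaceTime n → ℝ} {V W : SpaceTime n → Space n}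

theorem IsNonlinearity.continuousOn (hf : IsNonlinearity f f' f'') : ContinuousOn f (Ici 0) :=
  fun x hx => (hf.deriv₁ x hx).continuousAt.continuousWithinAt

theorem IsNonlinearity.continuousOn_deriv (hf : IsNonlinearity f f' f'') :
    ContinuousOn f' (Ici 0) :=
  fun x hx => (hf.deriv₂ x hx).continuousAt.continuousWithinAt

/-- Integration by parts in space for a smooth flux. -/
theorem integral_mul_spaceDiv (hf : IsNonlinearity f f' f'') (hU : ContDiff ℝ ∞ U)
    (hU0 : ∀ z, 0 ≤ U z) (hV : ContDiff ℝ ∞ V) (hζ : ContDiff ℝ ∞ ζ)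
    (hζ0 : ∀ z, 3 < ‖z.1‖ → ζ z = 0) (τ : ℝ) :
    ∫ x, f' (U (x, τ)) * ζ (x, τ) * spaceDiv V (x, τ) =
      -∫ x, (f'' (U (x, τ)) * ζ (x, τ) * fderiv ℝ U (x, τ) (V (x, τ), 0)
        + f' (U (x, τ)) * fderiv ℝ ζ (x, τ) (V (x, τ), 0)) := by
  set e := EuclideanSpace.basisFun (Fin n) ℝ with he
  have hUd : ∀ z, HasFDerivAt U (fderiv ℝ U z) z := fun z =>
    (hU.differentiable (by simp) z).hasFDerivAt
  have hVd : ∀ z, HasFDerivAt V (fderiv ℝ V z) z := fun z =>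
    (hV.differentiable (by simp) z).hasFDerivAt
  have hζd : ∀ z, HasFDerivAt ζ (fderiv ℝ ζ z) z := fun z =>
    (hζ.differentiable (by simp) z).hasFDerivAt
  have hdζ0 : ∀ z, 3 < ‖z.1‖ → fderiv ℝ ζ z = 0 := fun z hz => by
    have : ζ =ᶠ[𝓝 z] fun _ => 0 := by
      filter_upwards [(isOpen_lt continuous_const continuous_fst.norm).mem_nhds hz] with y hy
      exact hζ0 y hy
    rw [this.fderiv_eq]; simp
  have hcU : Continuous (fderiv ℝ U) := hU.continuous_fderiv (by simp)
  have hcV : Continuous (fderiv ℝ V) := hV.continuous_fderiv (by simp)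
  have hcζ : Continuous (fderiv ℝ ζ) := hζ.continuous_fderiv (by simp)
  have hc1 : Continuous fun z => f' (U z) :=
    hf.continuousOn_deriv.comp_continuous hU.continuous hU0
  have hc2 : Continuous fun z => f'' (U z) := hf.cont.comp_continuous hU.continuous hU0
  have hp : ∀ z, HasFDerivAt (fun z => f' (U z) * ζ z)
      (f' (U z) • fderiv ℝ ζ z + ζ z • (f'' (U z) • fderiv ℝ U z)) z := fun z =>
    ((hf.deriv₂ _ (hU0 z)).comp_hasFDerivAt z (hUd z)).mul (hζd z)
  have hps : ∀ x, HasFDerivAt (fun x => f' (U (x, τ)) * ζ (x, τ)) _ x := fun x =>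
    hasFDerivAt_slice (hp (x, τ))
  have hg : ∀ (i : Fin n) z, HasFDerivAt (fun z => ⟪e i, V z⟫)
      ((innerSL ℝ (e i)).comp (fderiv ℝ V z)) z := fun i z =>
    (innerSL ℝ (e i)).hasFDerivAt.comp z (hVd z)
  have hgs : ∀ (i : Fin n) x, HasFDerivAt (fun x => ⟪e i, V (x, τ)⟫) _ x := fun i x =>
    hasFDerivAt_slice (hg i (x, τ))
  have hV1 : ∀ i, Continuous fun z => ⟪e i, fderiv ℝ V z (e i, 0)⟫ := fun i =>
    continuous_const.inner (hcV.clm_apply continuous_const)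
  have hA : ∀ i, Integrable fun x => f' (U (x, τ)) * ζ (x, τ)
      * ⟪e i, fderiv ℝ V (x, τ) (e i, 0)⟫ := fun i =>
    integrable_slice (h := fun z => f' (U z) * ζ z * ⟪e i, fderiv ℝ V z (e i, 0)⟫)
      ((hc1.mul hζ.continuous).mul (hV1 i)) (fun z hz => by simp [hζ0 z hz]) τ
  have hB : ∀ i, Integrable fun x => (f' (U (x, τ)) * fderiv ℝ ζ (x, τ) (e i, 0)
      + ζ (x, τ) * (f'' (U (x, τ)) * fderiv ℝ U (x, τ) (e i, 0))) * ⟪e i, V (x, τ)⟫ := fun i =>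
    integrable_slice (h := fun z => (f' (U z) * fderiv ℝ ζ z (e i, 0)
      + ζ z * (f'' (U z) * fderiv ℝ U z (e i, 0))) * ⟪e i, V z⟫)
      (((hc1.mul (hcζ.clm_apply continuous_const)).add (hζ.continuous.mul
        (hc2.mul (hcU.clm_apply continuous_const)))).mul (continuous_const.inner hV.continuous))
      (fun z hz => by simp [hζ0 z hz, hdζ0 z hz]) τ
  have key : ∀ i, ∫ x, f' (U (x, τ)) * ζ (x, τ) * ⟪e i, fderiv ℝ V (x, τ) (e i, 0)⟫ =
      -∫ x, (f' (U (x, τ)) * fderiv ℝ ζ (x, τ) (e i, 0)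
      + ζ (x, τ) * (f'' (U (x, τ)) * fderiv ℝ U (x, τ) (e i, 0))) * ⟪e i, V (x, τ)⟫ := by
    intro i
    have e1 : ∀ x, fderiv ℝ (fun x => ⟪e i, V (x, τ)⟫) x (e i) =
        ⟪e i, fderiv ℝ V (x, τ) (e i, 0)⟫ := fun x => by rw [(hgs i x).fderiv]; simp
    have e2 : ∀ x, fderiv ℝ (fun x => f' (U (x, τ)) * ζ (x, τ)) x (e i) =
        f' (U (x, τ)) * fderiv ℝ ζ (x, τ) (e i, 0)
          + ζ (x, τ) * (f'' (U (x, τ)) * fderiv ℝ U (x, τ) (e i, 0)) := fun x => by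
      rw [(hps x).fderiv]; simp
    have := integral_mul_fderiv_eq_neg_fderiv_mul_of_integrable
      (μ := (volume : Measure (Space n))) (f := fun x => f' (U (x, τ)) * ζ (x, τ))
      (g := fun x => ⟪e i, V (x, τ)⟫) (v := e i) (by simp only [e2]; exact hB i)
      (by simp only [e1]; exact hA i)
      (integrable_slice (h := fun z => f' (U z) * ζ z * ⟪e i, V z⟫)
        ((hc1.mul hζ.continuous).mul (continuous_const.inner hV.continuous))
        (fun z hz => by simp [hζ0 z hz]) τ)
      (fun x _ => (hps x).differentiableAt) (fun x _ => (hgs i x).differentiableAt)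
    simpa only [e1, e2] using this
  have hsum : ∀ (L : SpaceTime n →L[ℝ] ℝ) (v : Space n), L (v, 0) = ∑ i, L (e i, 0) * ⟪e i, v⟫ := by
    intro L v
    have h1 : ∀ x : Space n, L (x, 0) = (L.comp (ContinuousLinearMap.inl ℝ (Space n) ℝ)) x :=
      fun x => rfl
    conv_lhs => rw [← e.sum_repr' v]
    simp only [h1, map_sum, map_smul, smul_eq_mul, mul_comm]
  simp only [spaceDiv, Finset.mul_sum]
  rw [integral_finsetSum _ fun i _ => hA i, Finset.sum_congr rfl fun i _ => key i,
    Finset.sum_neg_distrib, ← integral_finsetSum _ fun i _ => hB i]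
  congr 2
  ext x
  rw [hsum (fderiv ℝ U (x, τ)), hsum (fderiv ℝ ζ (x, τ)), Finset.mul_sum, Finset.mul_sum,
    ← Finset.sum_add_distrib]
  exact Finset.sum_congr rfl fun i _ => by ring

/-- The energy identity for smooth functions. -/
theorem energy_identity_of_smooth (hf : IsNonlinearity f f' f'') (hU : ContDiff ℝ ∞ U)
    (hU0 : ∀ z, 0 ≤ U z) (hV : ContDiff ℝ ∞ V) (hζ : ContDiff ℝ ∞ ζ)
    (hζ0 : ∀ z, 3 < ‖z.1‖ → ζ z = 0) {a b : ℝ} (hab : a ≤ b)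
    (hdiv : ∀ z ∈ coreBox n a b, fderiv ℝ U z (0, 1) = spaceDiv V z)
    (hgrad : ∀ z ∈ coreBox n a b, ∀ v : Space n, fderiv ℝ U z (v, 0) = ⟪W z, v⟫) :
    (∫ x, f (U (x, b)) * ζ (x, b)) - ∫ x, f (U (x, a)) * ζ (x, a) =
      ∫ z in slab n a b, (f (U z) * fderiv ℝ ζ z (0, 1) - (f'' (U z) * ζ z * ⟪V z, W z⟫
        + f' (U z) * fderiv ℝ ζ z (V z, 0))) := by
  have hUd : ∀ z, HasFDerivAt U (fderiv ℝ U z) z := fun z =>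
    (hU.differentiable (by simp) z).hasFDerivAt
  have hζd : ∀ z, HasFDerivAt ζ (fderiv ℝ ζ z) z := fun z =>
    (hζ.differentiable (by simp) z).hasFDerivAt
  have hdζ0 : ∀ z, 3 < ‖z.1‖ → fderiv ℝ ζ z = 0 := fun z hz => by
    have : ζ =ᶠ[𝓝 z] fun _ => 0 := by
      filter_upwards [(isOpen_lt continuous_const continuous_fst.norm).mem_nhds hz] with y hy
      exact hζ0 y hy
    rw [this.fderiv_eq]; simp
  have hcU : Continuous (fderiv ℝ U) := hU.continuous_fderiv (by simp)
  have hcV : Continuous (fderiv ℝ V) := hV.continuous_fderiv (by simp)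
  have hcζ : Continuous (fderiv ℝ ζ) := hζ.continuous_fderiv (by simp)
  have hc0 : Continuous fun z => f (U z) := hf.continuousOn.comp_continuous hU.continuous hU0
  have hc1 : Continuous fun z => f' (U z) :=
    hf.continuousOn_deriv.comp_continuous hU.continuous hU0
  have hc2 : Continuous fun z => f'' (U z) := hf.cont.comp_continuous hU.continuous hU0
  have hcsD : Continuous (spaceDiv V) := continuous_finsetSum _ fun i _ =>
    continuous_const.inner (hcV.clm_apply continuous_const)
  have hi1 : IntegrableOn (fun z => f (U z) * fderiv ℝ ζ z (0, 1)) (slab n a b) :=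
    integrableOn_slab (hc0.mul (hcζ.clm_apply continuous_const)) fun z hz => by
      simp [hdζ0 z hz]
  have hi2 : IntegrableOn (fun z => f' (U z) * ζ z * spaceDiv V z) (slab n a b) :=
    integrableOn_slab ((hc1.mul hζ.continuous).mul hcsD) fun z hz => by simp [hζ0 z hz]
  have hi3 : IntegrableOn (fun z => f'' (U z) * ζ z * fderiv ℝ U z (V z, 0)
      + f' (U z) * fderiv ℝ ζ z (V z, 0)) (slab n a b) :=
    integrableOn_slab (((hc2.mul hζ.continuous).mul (hcU.clm_apply (hV.continuous.prodMk
      continuous_const))).add (hc1.mul (hcζ.clm_apply (hV.continuous.prodMk continuous_const))))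
      fun z hz => by simp [hζ0 z hz, hdζ0 z hz]
  -- The fundamental theorem of calculus on each vertical line, with the time derivative replaced by
  -- the divergence. The equation is used only on `coreBox`, since ζ vanishes elsewhere on the slab.
  have hftc : ∀ x, f (U (x, b)) * ζ (x, b) - f (U (x, a)) * ζ (x, a) =
      ∫ τ in Ioc a b, (f (U (x, τ)) * fderiv ℝ ζ (x, τ) (0, 1)
        + f' (U (x, τ)) * ζ (x, τ) * spaceDiv V (x, τ)) := by
    intro x
    have hd : ∀ τ, HasDerivAt (fun τ => f (U (x, τ)) * ζ (x, τ))
        (f (U (x, τ)) * fderiv ℝ ζ (x, τ) (0, 1)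
          + f' (U (x, τ)) * ζ (x, τ) * fderiv ℝ U (x, τ) (0, 1)) τ := by
      intro τ
      have hγ : HasDerivAt (fun τ : ℝ => (x, τ)) ((0 : Space n), (1 : ℝ)) τ :=
        (hasDerivAt_const τ x).prodMk (hasDerivAt_id τ)
      have := (((hf.deriv₁ _ (hU0 (x, τ))).comp_hasFDerivAt _ (hUd (x, τ))).mul
        (hζd (x, τ))).comp_hasDerivAt τ hγ
      refine this.congr_deriv ?_
      simp; ring
    have hc : Continuous fun τ => f (U (x, τ)) * fderiv ℝ ζ (x, τ) (0, 1)
          + f' (U (x, τ)) * ζ (x, τ) * fderiv ℝ U (x, τ) (0, 1) :=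
      ((hc0.mul (hcζ.clm_apply continuous_const)).add ((hc1.mul hζ.continuous).mul
        (hcU.clm_apply continuous_const))).comp (by fun_prop : Continuous fun τ : ℝ => (x, τ))
    rw [← intervalIntegral.integral_eq_sub_of_hasDerivAt (fun τ _ => hd τ)
      (hc.intervalIntegrable _ _), intervalIntegral.integral_of_le hab]
    refine setIntegral_congr_fun measurableSet_Ioc fun τ hτ => ?_
    by_cases hx : 3 < ‖x‖
    · rw [hζ0 (x, τ) hx]; simp
    · rw [hdiv (x, τ) ⟨by simpa using hx, Ioc_subset_Icc_self hτ⟩]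
  have hsl : ∀ {h : SpaceTime n → ℝ}, IntegrableOn h (slab n a b) →
      ∫ z in slab n a b, h z = ∫ x, ∫ τ in Ioc a b, h (x, τ) := fun {h} hh => by
    rw [IntegrableOn, volume_restrict_slab] at hh
    rw [volume_restrict_slab, integral_prod _ hh]
  have hsl' : ∀ {h : SpaceTime n → ℝ}, IntegrableOn h (slab n a b) →
      ∫ z in slab n a b, h z = ∫ τ in Ioc a b, ∫ x, h (x, τ) := fun {h} hh => by
    rw [IntegrableOn, volume_restrict_slab] at hh
    rw [volume_restrict_slab, integral_prod_symm _ hh]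
  have hs : ∀ τ, Integrable fun x => f (U (x, τ)) * ζ (x, τ) := fun τ =>
    integrable_slice (h := fun z => f (U z) * ζ z) (hc0.mul hζ.continuous)
      (fun z hz => by simp [hζ0 z hz]) τ
  rw [← integral_sub (hs b) (hs a)]
  simp only [hftc]
  rw [← hsl (h := fun z => f (U z) * fderiv ℝ ζ z (0, 1) + f' (U z) * ζ z * spaceDiv V z)
    (hi1.add hi2), integral_add hi1 hi2, hsl' hi2]
  simp only [integral_mul_spaceDiv hf hU hU0 hV hζ hζ0]
  rw [integral_neg, ← hsl' hi3, ← sub_eq_add_neg, ← integral_sub hi1 hi3]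
  refine setIntegral_congr_fun measurableSet_slab fun z hz => ?_
  by_cases hx : 3 < ‖z.1‖
  · rw [hζ0 z hx]; simp
  · rw [hgrad z ⟨by simpa using hx, Ioc_subset_Icc_self hz.2⟩, real_inner_comm]

end identity

end

/-! ### Solutions in the normalized cylinder and the energy identity in the limit. -/

noncomputable section

/-- The normalized cylinder `B₄ × (-1, 1)`. -/
def unitBox (n : ℕ) : Set (SpaceTime n) := Metric.ball 0 4 ×ˢ Ioo (-1) 1

/-- A bounded nonnegative solution `u` of `u_t = ∇ · F`, `∇u = g`, in the normalized cylinder, with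
square-integrable flux and gradient; everything is extended by `0`. -/
structure BoxSolution {n : ℕ} (K : ℝ) (u : SpaceTime n → ℝ) (F g : SpaceTime n → Space n) :
    Prop where
  u_meas : Measurable u
  F_meas : Measurable F
  g_meas : Measurable g
  u_mem : ∀ z, u z ∈ Icc 0 K
  u_zero : ∀ z, z ∉ unitBox n → u z = 0
  F_zero : ∀ z, z ∉ unitBox n → F z = 0
  g_zero : ∀ z, z ∉ unitBox n → g z = 0
  F_sq : Integrable fun z => ‖F z‖ ^ 2
  g_sq : Integrable fun z => ‖g z‖ ^ 2
  grad : WeakGradOn (unitBox n) u g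
  div : WeakDivOn (unitBox n) u F

/-- The times at which the mollifications converge almost everywhere in space. -/
def goodTimes {n : ℕ} (u : SpaceTime n → ℝ) : Set ℝ :=
  {τ | τ ∈ Ioo (-1) 1 ∧ ∀ᵐ x, Tendsto (fun j => mollify j u (x, τ)) atTop (𝓝 (u (x, τ)))}

theorem ae_time_of_ae {n : ℕ} {p : SpaceTime n → Prop} (h : ∀ᵐ z, p z) :
    ∀ᵐ τ : ℝ, ∀ᵐ x : Space n, p (x, τ) := by
  have h1 : ∀ᵐ z : ℝ × Space n ∂((volume : Measure ℝ).prod volume), p z.swap :=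
    (Measure.measurePreserving_swap (μ := (volume : Measure ℝ))
      (ν := (volume : Measure (Space n)))).quasiMeasurePreserving.ae h
  exact Measure.ae_ae_of_ae_prod h1

theorem isOpen_unitBox {n : ℕ} : IsOpen (unitBox n) := Metric.isOpen_ball.prod isOpen_Ioo

theorem volume_unitBox_lt_top {n : ℕ} : volume (unitBox n) < ⊤ := by
  rw [unitBox, Measure.volume_eq_prod, Measure.prod_prod]
  exact ENNReal.mul_lt_top Metric.isBounded_ball.measure_lt_top (by simp)

theorem coreBox_subset_unitBox {n : ℕ} {a b : ℝ} (ha : -1 < a) (hb : b < 1) :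
    coreBox n a b ⊆ unitBox n := fun z hz =>
  ⟨by have := hz.1; simp at this ⊢; linarith, lt_of_lt_of_le ha hz.2.1, lt_of_le_of_lt hz.2.2 hb⟩

theorem fderiv_eq_zero_of_forall {n : ℕ} {ζ : SpaceTime n → ℝ} (hζ0 : ∀ z, 3 < ‖z.1‖ → ζ z = 0)
    (z : SpaceTime n) (hz : 3 < ‖z.1‖) : fderiv ℝ ζ z = 0 := by
  have : ζ =ᶠ[𝓝 z] fun _ => 0 := by
    filter_upwards [(isOpen_lt continuous_const continuous_fst.norm).mem_nhds hz] with y hy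
    exact hζ0 y hy
  rw [this.fderiv_eq]; simp

/-- Passage to the limit in integrals controlled by a mollified integrable function. -/
theorem tendsto_setIntegral_of_le_mollify {n : ℕ} {G₀ : SpaceTime n → ℝ} (hG₀ : Integrable G₀)
    (hG₀' : ∀ z, 0 ≤ G₀ z) {S K₀ : Set (SpaceTime n)} (hS : MeasurableSet S)
    (hK₀ : IsCompact K₀) {H : ℕ → SpaceTime n → ℝ} {H' : SpaceTime n → ℝ} {C : ℝ} (hC : 0 ≤ C)
    (hm : ∀ j, AEStronglyMeasurable (H j))
    (hb : ∀ᶠ j in atTop, ∀ z ∈ S, |H j z| ≤ C * (mollify j G₀ z + K₀.indicator 1 z))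
    (hl : ∀ᵐ z, z ∈ S → Tendsto (fun j => H j z) atTop (𝓝 (H' z))) :
    Tendsto (fun j => ∫ z in S, H j z) atTop (𝓝 (∫ z in S, H' z)) := by
  have hind : Integrable (K₀.indicator (1 : SpaceTime n → ℝ)) :=
    (integrable_indicator_iff hK₀.measurableSet).2
      (integrableOn_const hK₀.measure_lt_top.ne)
  simp only [← integral_indicator hS]
  -- The dominating functions vary with j, but mollification preserves the integral, so their
  -- integrals are constant in j.
  refine tendsto_integral_of_dominated_seq
    (G := fun j z => C * (mollify j G₀ z + K₀.indicator 1 z))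
    (G' := fun z => C * (G₀ z + K₀.indicator 1 z)) (fun j => (hm j).indicator hS)
    (fun j => ((mollify_integrable hG₀).add hind).const_mul C) ((hG₀.add hind).const_mul C) ?_ ?_
    ?_ ?_
  · filter_upwards [hb] with j hj
    refine ae_of_all _ fun z => ?_
    by_cases hz : z ∈ S
    · rw [indicator_of_mem hz]; exact hj z hz
    · rw [indicator_of_notMem hz, abs_zero]
      refine mul_nonneg hC (add_nonneg (integral_nonneg fun w =>
        mul_nonneg (mollifier_nonneg _) (hG₀' w)) (indicator_nonneg (fun _ _ => zero_le_one) _))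
  · filter_upwards [hl] with z hz
    by_cases hzS : z ∈ S
    · simpa only [indicator_of_mem hzS] using hz hzS
    · simp only [indicator_of_notMem hzS]; exact tendsto_const_nhds
  · filter_upwards [mollify_tendsto hG₀] with z hz
    exact (hz.add_const _).const_mul C
  · simp only [integral_const_mul]
    rw [integral_add hG₀ hind]
    refine (tendsto_const_nhds (x := C * ((∫ z, G₀ z) + _))).congr fun j => ?_
    rw [integral_add (mollify_integrable hG₀) hind, integral_mollify hG₀]

namespace BoxSolution
variable {n : ℕ} {K : ℝ} {u : SpaceTime n → ℝ} {F g : SpaceTime n → Space n}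

theorem integrable_of_sq {V : SpaceTime n → Space n} (hm : Measurable V)
    (h0 : ∀ z, z ∉ unitBox n → V z = 0) (h2 : Integrable fun z => ‖V z‖ ^ 2) : Integrable V := by
  have hind : Integrable ((unitBox n).indicator (1 : SpaceTime n → ℝ)) :=
    (integrable_indicator_iff isOpen_unitBox.measurableSet).2
      (integrableOn_const volume_unitBox_lt_top.ne)
  refine (hind.add h2).mono' hm.aestronglyMeasurable (ae_of_all _ fun z => ?_)
  by_cases hz : z ∈ unitBox n
  · simp only [Pi.add_apply, indicator_of_mem hz, Pi.one_apply]
    nlinarith [sq_nonneg (‖V z‖ - 1), norm_nonneg (V z)]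
  · simp [h0 z hz, hz]

theorem u_int (h : BoxSolution K u F g) : Integrable u := by
  have hind : Integrable ((unitBox n).indicator (fun _ => K : SpaceTime n → ℝ)) :=
    (integrable_indicator_iff isOpen_unitBox.measurableSet).2
      (integrableOn_const volume_unitBox_lt_top.ne)
  refine hind.mono' h.u_meas.aestronglyMeasurable (ae_of_all _ fun z => ?_)
  by_cases hz : z ∈ unitBox n
  · rw [indicator_of_mem hz, Real.norm_of_nonneg (h.u_mem z).1]; exact (h.u_mem z).2
  · simp [h.u_zero z hz, hz]

theorem F_int (h : BoxSolution K u F g) : Integrable F := integrable_of_sq h.F_meas h.F_zero h.F_sq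

theorem g_int (h : BoxSolution K u F g) : Integrable g := integrable_of_sq h.g_meas h.g_zero h.g_sq

theorem ae_mem_goodTimes (h : BoxSolution K u F g) : ∀ᵐ τ : ℝ,
    τ ∈ Ioo (-1 : ℝ) 1 → τ ∈ goodTimes u := by
  filter_upwards [ae_time_of_ae (mollify_tendsto h.u_int)] with τ hτ hmem
  exact ⟨hmem, hτ⟩

/-- Convergence of spatial integrals at good times. -/
theorem tendsto_integral_slice (h : BoxSolution K u F g) {f : ℝ → ℝ} {ζ : SpaceTime n → ℝ}
    (hf : ContinuousOn f (Ici 0))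
    (hζ : Continuous ζ) (hζ0 : ∀ z, 3 < ‖z.1‖ → ζ z = 0) {τ : ℝ} (hτ : τ ∈ goodTimes u) :
    Tendsto (fun j => ∫ x, f (mollify j u (x, τ)) * ζ (x, τ)) atTop
      (𝓝 (∫ x, f (u (x, τ)) * ζ (x, τ))) := by
  obtain ⟨C, hC⟩ := (isCompact_Icc (a := (0 : ℝ)) (b := K)).exists_bound_of_continuousOn
    (hf.mono fun x hx => hx.1)
  have hmem : ∀ j z, mollify j u z ∈ Icc 0 K := fun j z => mollify_mem_Icc h.u_int h.u_mem z
  have hcont : ∀ j, Continuous fun z => f (mollify j u z) := fun j =>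
    hf.comp_continuous (mollify_contDiff h.u_int).continuous fun z => (hmem j z).1
  refine tendsto_integral_of_dominated_convergence (fun x => C * ‖ζ (x, τ)‖) (fun j => ?_)
    ((integrable_slice hζ hζ0 τ).norm.const_mul C) (fun j => ae_of_all _ fun x => ?_) ?_
  · exact (((hcont j).mul hζ).comp (by fun_prop : Continuous fun x : Space n =>
      (x, τ))).aestronglyMeasurable
  · rw [norm_mul]; exact mul_le_mul_of_nonneg_right (hC _ (hmem j _)) (norm_nonneg _)
  · filter_upwards [hτ.2] with x hx
    refine Tendsto.mul_const _ ?_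
    exact ((hf (u (x, τ)) (h.u_mem _).1).tendsto).comp
      (tendsto_nhdsWithin_iff.2 ⟨hx, Eventually.of_forall fun j => (hmem j _).1⟩)

theorem exists_bound_slice {f : ℝ → ℝ} {ζ : SpaceTime n → ℝ} (hf : ContinuousOn f (Ici 0))
    (hζ : Continuous ζ) (a b : ℝ) : ∃ C, 0 ≤ C ∧
      (∀ x ∈ Icc 0 K, |f x| ≤ C) ∧ ∀ z ∈ coreBox n a b, |ζ z| ≤ C := by
  obtain ⟨C, hC⟩ := (isCompact_Icc (a := (0 : ℝ)) (b := K)).exists_bound_of_continuousOn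
    (hf.mono fun x hx => hx.1)
  obtain ⟨D, hD⟩ := (isCompact_coreBox (n := n) (a := a) (b := b)).exists_bound_of_continuousOn
    hζ.continuousOn
  exact ⟨max (max C D) 0, le_max_right _ _, fun x hx =>
    (hC x hx).trans ((le_max_left _ _).trans (le_max_left _ _)), fun z hz =>
    (hD z hz).trans ((le_max_right _ _).trans (le_max_left _ _))⟩

theorem tendsto_comp (h : BoxSolution K u F g) {f : ℝ → ℝ} (hf : ContinuousOn f (Ici 0))
    {z : SpaceTime n}
    (hz : Tendsto (fun j => mollify j u z) atTop (𝓝 (u z))) :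
    Tendsto (fun j => f (mollify j u z)) atTop (𝓝 (f (u z))) :=
  ((hf (u z) (h.u_mem _).1).tendsto).comp (tendsto_nhdsWithin_iff.2
    ⟨hz, Eventually.of_forall fun _ => (mollify_mem_Icc h.u_int h.u_mem z).1⟩)

/-- The energy identity for nonlinear functions of the solution. -/
theorem energy_identity (h : BoxSolution K u F g) {f f' f'' : ℝ → ℝ} {ζ : SpaceTime n → ℝ}
    (hf : IsNonlinearity f f' f'')
    (hζ : ContDiff ℝ ∞ ζ) (hζ0 : ∀ z, 3 < ‖z.1‖ → ζ z = 0) {a b : ℝ} (ha : a ∈ goodTimes u)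
    (hb : b ∈ goodTimes u) (hab : a ≤ b) :
    (∫ x, f (u (x, b)) * ζ (x, b)) - ∫ x, f (u (x, a)) * ζ (x, a) =
      ∫ z in slab n a b, (f (u z) * fderiv ℝ ζ z (0, 1) - (f'' (u z) * ζ z * ⟪F z, g z⟫
        + f' (u z) * fderiv ℝ ζ z (F z, 0))) := by
  have hcore := coreBox_subset_unitBox (n := n) ha.1.1 hb.1.2
  have hmem : ∀ j z, mollify j u z ∈ Icc 0 K := fun j z => mollify_mem_Icc h.u_int h.u_mem z
  -- The boundary terms live on single time slices; this is the only point of the argument that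
  -- restricts a and b to good times.
  have hlhs := (h.tendsto_integral_slice hf.continuousOn hζ.continuous hζ0 hb).sub
    (h.tendsto_integral_slice hf.continuousOn hζ.continuous hζ0 ha)
  refine tendsto_nhds_unique hlhs ?_
  have hcζ : Continuous (fderiv ℝ ζ) := hζ.continuous_fderiv (by simp)
  obtain ⟨C₀, hC₀, h00, -⟩ := exists_bound_slice (K := K) hf.continuousOn hζ.continuous a b
  obtain ⟨C₁, hC₁, h10, h11⟩ := exists_bound_slice (K := K) hf.continuousOn_deriv hcζ.norm a b
  obtain ⟨C₂, hC₂, h20, h21⟩ := exists_bound_slice (K := K) hf.cont hζ.continuous a b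
  -- By Jensen, the product of the mollified flux and gradient is dominated by the mollification of
  -- this function; u is bounded, so all other factors are bounded on the core.
  have hG : Integrable fun z => ‖F z‖ ^ 2 + ‖g z‖ ^ 2 := h.F_sq.add h.g_sq
  have hlim : Tendsto (fun j => ∫ z in slab n a b, (f (mollify j u z) * fderiv ℝ ζ z (0, 1)
      - (f'' (mollify j u z) * ζ z * ⟪mollify j F z, mollify j g z⟫
        + f' (mollify j u z) * fderiv ℝ ζ z (mollify j F z, 0)))) atTop
      (𝓝 (∫ z in slab n a b, (f (u z) * fderiv ℝ ζ z (0, 1) - (f'' (u z) * ζ z * ⟪F z, g z⟫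
        + f' (u z) * fderiv ℝ ζ z (F z, 0))))) := by
    refine tendsto_setIntegral_of_le_mollify (C := C₀ * C₁ + C₂ * C₂ + C₁ * C₁)
      (K₀ := coreBox n a b) hG (fun z => by positivity) measurableSet_slab isCompact_coreBox
      (by positivity) (fun j => ?_) (Eventually.of_forall fun j z hz => ?_) ?_
    · have hcu := (mollify_contDiff (j := j) h.u_int).continuous
      have hcF := (mollify_contDiff (j := j) h.F_int).continuous
      have hcg := (mollify_contDiff (j := j) h.g_int).continuous
      exact (((hf.continuousOn.comp_continuous hcu fun z => (hmem j z).1).mul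
        (hcζ.clm_apply continuous_const)).sub ((((hf.cont.comp_continuous hcu fun z =>
        (hmem j z).1).mul hζ.continuous).mul (hcF.inner hcg)).add
        ((hf.continuousOn_deriv.comp_continuous hcu fun z => (hmem j z).1).mul
        (hcζ.clm_apply (hcF.prodMk continuous_const))))).aestronglyMeasurable
    · have hGz : ‖mollify j F z‖ ^ 2 + ‖mollify j g z‖ ^ 2 ≤
          mollify j (fun z => ‖F z‖ ^ 2 + ‖g z‖ ^ 2) z := by
        have : mollify j (fun z => ‖F z‖ ^ 2 + ‖g z‖ ^ 2) z =
            mollify j (fun z => ‖F z‖ ^ 2) z + mollify j (fun z => ‖g z‖ ^ 2) z := by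
          simp only [mollify, smul_add]
          exact integral_add (integrable_mollifier_smul h.F_sq z)
            (integrable_mollifier_smul h.g_sq z)
        rw [this]
        exact add_le_add (norm_mollify_sq_le h.F_sq z) (norm_mollify_sq_le h.g_sq z)
      by_cases hx : 3 < ‖z.1‖
      · rw [hζ0 z hx, fderiv_eq_zero_of_forall hζ0 z hx]
        simp only [zero_apply, mul_zero, zero_mul, add_zero, sub_zero, abs_zero]
        refine mul_nonneg (by positivity) (add_nonneg (le_trans (by positivity) hGz)
          (indicator_nonneg (fun _ _ => zero_le_one) _))
      · have hz' : z ∈ coreBox n a b := ⟨by simpa using hx, Ioc_subset_Icc_self hz.2⟩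
        rw [indicator_of_mem hz', Pi.one_apply]
        have hd : ‖fderiv ℝ ζ z‖ ≤ C₁ := (le_abs_self _).trans (h11 z hz')
        have t1 : |f (mollify j u z) * fderiv ℝ ζ z (0, 1)| ≤ C₀ * C₁ := by
          rw [abs_mul]
          refine mul_le_mul (h00 _ (hmem j z)) ?_ (abs_nonneg _) hC₀
          refine ((fderiv ℝ ζ z).le_opNorm _).trans ?_
          simpa [Prod.norm_def] using hd
        have t2 : |f'' (mollify j u z) * ζ z * ⟪mollify j F z, mollify j g z⟫| ≤
            C₂ * C₂ * (‖mollify j F z‖ * ‖mollify j g z‖) := by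
          rw [abs_mul, abs_mul]
          refine mul_le_mul (mul_le_mul (h20 _ (hmem j z)) (h21 z hz') (abs_nonneg _) hC₂)
            (abs_real_inner_le_norm _ _) (abs_nonneg _) (by positivity)
        have t3 : |f' (mollify j u z) * fderiv ℝ ζ z (mollify j F z, 0)| ≤
            C₁ * (C₁ * ‖mollify j F z‖) := by
          rw [abs_mul]
          refine mul_le_mul (h10 _ (hmem j z)) ?_ (abs_nonneg _) hC₁
          refine ((fderiv ℝ ζ z).le_opNorm _).trans ?_
          refine (mul_le_mul_of_nonneg_right hd (norm_nonneg _)).trans ?_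
          simp [Prod.norm_def]
        have hM : 0 ≤ mollify j (fun z => ‖F z‖ ^ 2 + ‖g z‖ ^ 2) z :=
          le_trans (by positivity) hGz
        have s1 : ‖mollify j F z‖ * ‖mollify j g z‖ ≤
            mollify j (fun z => ‖F z‖ ^ 2 + ‖g z‖ ^ 2) z + 1 := by
          nlinarith [sq_nonneg (‖mollify j F z‖ - ‖mollify j g z‖)]
        have s2 : ‖mollify j F z‖ ≤ mollify j (fun z => ‖F z‖ ^ 2 + ‖g z‖ ^ 2) z + 1 := by
          nlinarith [sq_nonneg (‖mollify j F z‖ - 1), sq_nonneg ‖mollify j g z‖]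
        calc _ ≤ C₀ * C₁ + (C₂ * C₂ * (‖mollify j F z‖ * ‖mollify j g z‖)
              + C₁ * (C₁ * ‖mollify j F z‖)) := by
              refine (abs_sub _ _).trans (add_le_add t1 ((abs_add_le _ _).trans (add_le_add t2 t3)))
          _ ≤ _ := by
              rw [← mul_assoc C₁ C₁]
              have := mul_le_mul_of_nonneg_left s1 (mul_nonneg hC₂ hC₂)
              have := mul_le_mul_of_nonneg_left s2 (mul_nonneg hC₁ hC₁)
              have : 0 ≤ C₀ * C₁ * mollify j (fun z => ‖F z‖ ^ 2 + ‖g z‖ ^ 2) z := by positivity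
              linarith
    · filter_upwards [mollify_tendsto h.u_int, mollify_tendsto h.F_int,
        mollify_tendsto h.g_int] with z hu hF hg _
      refine ((h.tendsto_comp hf.continuousOn hu).mul_const _).sub
        ((((h.tendsto_comp hf.cont hu).mul_const _).mul (hF.inner hg)).add
        ((h.tendsto_comp hf.continuousOn_deriv hu).mul ?_))
      exact ((fderiv ℝ ζ z).continuous.tendsto _).comp (hF.prodMk_nhds tendsto_const_nhds)
  refine hlim.congr' ?_
  filter_upwards [h.div.fderiv_mollify_eq isOpen_unitBox isCompact_coreBox hcore h.u_int h.F_int,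
    h.grad.fderiv_mollify_eq isOpen_unitBox isCompact_coreBox hcore h.u_int h.g_int] with j h1 h2
  exact (energy_identity_of_smooth hf (mollify_contDiff h.u_int) (fun z => (hmem j z).1)
    (mollify_contDiff h.F_int) hζ hζ0 hab h1 h2).symm

end BoxSolution

end

/-! ### The Faber–Krahn inequality on time slices. -/

noncomputable section

theorem measurable_comp_of_continuousOn {X : Type*} [MeasurableSpace X] {f : ℝ → ℝ} {u : X → ℝ}
    (hf : ContinuousOn f (Ici 0)) (hu : Measurable u) (h0 : ∀ z, 0 ≤ u z) :
    Measurable fun z => f (u z) := by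
  have hc : Continuous fun x : ℝ => f (max x 0) :=
    hf.comp_continuous (by fun_prop) fun x => mem_Ici.2 (le_max_right _ _)
  have := hc.measurable.comp hu
  simpa only [Function.comp_def, max_eq_left (h0 _)] using this

theorem continuous_integral_slice {n : ℕ} {H : SpaceTime n → ℝ} (hc : Continuous H)
    (hz : ∀ z, 3 < ‖z.1‖ → H z = 0) : Continuous fun τ => ∫ x, H (x, τ) := by
  have h1 : ∀ τ, ∫ x, H (x, τ) = ∫ x in Metric.closedBall 0 3, H (x, τ) := fun τ =>
    (setIntegral_eq_integral_of_forall_compl_eq_zero fun x hx => hz _ (by simpa using hx)).symm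
  simp only [h1]
  exact continuous_parametric_integral_of_continuous (f := fun τ x => H (x, τ))
    (hc.comp continuous_swap) (isCompact_closedBall _ _)

theorem setIntegral_slab {n : ℕ} {a b : ℝ} {H : SpaceTime n → ℝ}
    (hH : IntegrableOn H (slab n a b)) :
    ∫ z in slab n a b, H z = ∫ τ in Ioc a b, ∫ x, H (x, τ) := by
  rw [IntegrableOn, volume_restrict_slab] at hH
  rw [volume_restrict_slab, integral_prod_symm _ hH]

theorem integrableOn_integral_slice {n : ℕ} {a b : ℝ} {H : SpaceTime n → ℝ}
    (hH : IntegrableOn H (slab n a b)) : IntegrableOn (fun τ => ∫ x, H (x, τ)) (Ioc a b) := by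
  rw [IntegrableOn, volume_restrict_slab] at hH
  exact hH.integral_prod_right

/-- The slice-wise Faber–Krahn inequality for nonlinear functions of the solution, integrated in
time. -/
theorem exists_faberKrahn_slab (n : ℕ) (hn : 2 ≤ n) : ∃ C : ℝ, 0 < C ∧
    ∀ {K : ℝ} {u : SpaceTime n → ℝ} {F g : SpaceTime n → Space n} (_ : BoxSolution K u F g)
      {p p' ψ : ℝ → ℝ} {ζ ξ : SpaceTime n → ℝ} {a b P : ℝ},
      (∀ x, 0 ≤ x → HasDerivAt p (p' x) x) → ContinuousOn p' (Ici 0) → (∀ x, 0 ≤ x → 0 ≤ p x) →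
      ContinuousOn ψ (Ici 0) → (∀ x, 0 ≤ x → 0 ≤ ψ x) → (∀ x, 0 ≤ x → p x ≠ 0 → 1 ≤ ψ x) →
      ContDiff ℝ ∞ ζ → (∀ z, 0 ≤ ζ z) → (∀ z, 3 < ‖z.1‖ → ζ z = 0) →
      Continuous ξ → (∀ z, 0 ≤ ξ z) → (∀ z, 3 < ‖z.1‖ → ξ z = 0) →
      (∀ z, ζ z ≠ 0 → 1 ≤ ξ z) → -1 < a → b < 1 →
      (∀ τ ∈ goodTimes u, τ ∈ Ioc a b → ∫ x, ψ (u (x, τ)) * ξ (x, τ) ≤ P) →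
      ∫ z in slab n a b, (p (u z) * ζ z) ^ 2 ≤ C * P ^ (2 / n : ℝ) *
        ∫ z in slab n a b, (2 * (p' (u z) * ζ z) ^ 2 * ‖g z‖ ^ 2
          + 2 * p (u z) ^ 2 * ‖fderiv ℝ ζ z‖ ^ 2) := by
  obtain ⟨C, hC0, hC⟩ := exists_faberKrahn n hn
  refine ⟨C, hC0, ?_⟩
  intro K u F g h p p' ψ ζ ξ a b P hp hp' hp0 hψ hψ0 hψ1 hζ hζn hζ0 hξ hξn hξ0 hζξ ha hb hP
  have he : (0 : ℝ) ≤ 2 / n := by positivity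
  have hpc : ContinuousOn p (Ici 0) := fun x hx => (hp x hx).continuousAt.continuousWithinAt
  have hmem : ∀ j z, mollify j u z ∈ Icc 0 K := fun j z => mollify_mem_Icc h.u_int h.u_mem z
  have hcζ : Continuous (fderiv ℝ ζ) := hζ.continuous_fderiv (by simp)
  have hdζ := fderiv_eq_zero_of_forall hζ0
  have hcu : ∀ j, Continuous (mollify j u) := fun j => (mollify_contDiff h.u_int).continuous
  have hcg : ∀ j, Continuous (mollify j g) := fun j => (mollify_contDiff h.g_int).continuous
  have hcp : ∀ j, Continuous fun z => p (mollify j u z) := fun j =>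
    hpc.comp_continuous (hcu j) fun z => (hmem j z).1
  have hcp' : ∀ j, Continuous fun z => p' (mollify j u z) := fun j =>
    hp'.comp_continuous (hcu j) fun z => (hmem j z).1
  have hcψ : ∀ j, Continuous fun z => ψ (mollify j u z) := fun j =>
    hψ.comp_continuous (hcu j) fun z => (hmem j z).1
  set B : ℕ → SpaceTime n → ℝ := fun j z => 2 * (p' (mollify j u z) * ζ z) ^ 2 *
    ‖mollify j g z‖ ^ 2 + 2 * p (mollify j u z) ^ 2 * ‖fderiv ℝ ζ z‖ ^ 2 with hB
  have hcB : ∀ j, Continuous (B j) := fun j =>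
    ((continuous_const.mul (((hcp' j).mul hζ.continuous).pow 2)).mul ((hcg j).norm.pow 2)).add
      ((continuous_const.mul ((hcp j).pow 2)).mul (hcζ.norm.pow 2))
  have hB0 : ∀ j z, 3 < ‖z.1‖ → B j z = 0 := fun j z hz => by
    simp [hB, hζ0 z hz, hdζ z hz]
  have hBn : ∀ j z, 0 ≤ B j z := fun j z => by simp only [hB]; positivity
  -- The measure of the support of p(u_j)ζ need not converge with j. It is replaced by this
  -- continuous majorant, which converges at every good time.
  set Q : ℕ → ℝ → ℝ := fun j τ => ∫ x, ψ (mollify j u (x, τ)) * ξ (x, τ) with hQ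
  have hQc : ∀ j, Continuous (Q j) := fun j =>
    continuous_integral_slice (H := fun z => ψ (mollify j u z) * ξ z) ((hcψ j).mul hξ)
      fun z hz => by simp [hξ0 z hz]
  have hQn : ∀ j τ, 0 ≤ Q j τ := fun j τ => integral_nonneg fun x =>
    mul_nonneg (hψ0 _ (hmem j _).1) (hξn _)
  have hQBc : ∀ j, Continuous fun z : SpaceTime n => C * Q j z.2 ^ (2 / n : ℝ) * B j z := fun j =>
    (continuous_const.mul (((hQc j).comp continuous_snd).rpow_const fun _ => Or.inr he)).mul
      (hcB j)
  have hlc : ∀ j, Continuous fun z => (p (mollify j u z) * ζ z) ^ 2 := fun j =>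
    ((hcp j).mul hζ.continuous).pow 2
  have hslice : ∀ᶠ j in atTop, ∫ z in slab n a b, (p (mollify j u z) * ζ z) ^ 2 ≤
      ∫ z in slab n a b, C * Q j z.2 ^ (2 / n : ℝ) * B j z := by
    filter_upwards [h.grad.fderiv_mollify_eq isOpen_unitBox isCompact_coreBox
      (coreBox_subset_unitBox ha hb) h.u_int h.g_int] with j hj
    have i1 : IntegrableOn (fun z => (p (mollify j u z) * ζ z) ^ 2) (slab n a b) :=
      integrableOn_slab (hlc j) fun z hz => by simp [hζ0 z hz]
    have i2 : IntegrableOn (fun z : SpaceTime n => C * Q j z.2 ^ (2 / n : ℝ) * B j z)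
      (slab n a b) := integrableOn_slab (hQBc j) fun z hz => by simp [hB0 j z hz]
    rw [setIntegral_slab i1, setIntegral_slab i2]
    refine setIntegral_mono_on (integrableOn_integral_slice i1)
        (integrableOn_integral_slice i2) measurableSet_Ioc fun τ hτ => ?_
    have hd : ∀ z, HasFDerivAt (fun z => p (mollify j u z) * ζ z)
        (p (mollify j u z) • fderiv ℝ ζ z +
          ζ z • (p' (mollify j u z) • fderiv ℝ (mollify j u) z)) z := fun z =>
      ((hp _ (hmem j z).1).comp_hasFDerivAt z
        ((mollify_contDiff h.u_int).differentiable (by simp) z).hasFDerivAt).mul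
        (hζ.differentiable (by simp) z).hasFDerivAt
    have hds : ∀ x, HasFDerivAt (fun x => p (mollify j u (x, τ)) * ζ (x, τ)) _ x := fun x =>
      hasFDerivAt_slice (hd (x, τ))
    have hfd : fderiv ℝ (fun x => p (mollify j u (x, τ)) * ζ (x, τ)) = fun x =>
        (p (mollify j u (x, τ)) • fderiv ℝ ζ (x, τ) + ζ (x, τ) • (p' (mollify j u (x, τ)) •
          fderiv ℝ (mollify j u) (x, τ))).comp (ContinuousLinearMap.inl ℝ (Space n) ℝ) :=
      funext fun x => (hds x).fderiv
    have hcx : Continuous fun x : Space n => (x, τ) := by fun_prop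
    have hC1 : ContDiff ℝ 1 (fun x => p (mollify j u (x, τ)) * ζ (x, τ)) := by
      rw [contDiff_one_iff_fderiv, hfd]
      refine ⟨fun x => (hds x).differentiableAt, ?_⟩
      refine Continuous.clm_comp ?_ continuous_const
      exact (((hcp j).smul hcζ).add (hζ.continuous.smul ((hcp' j).smul
        ((mollify_contDiff h.u_int).continuous_fderiv (by simp))))).comp hcx
    set S : Set (Space n) := {x | p (mollify j u (x, τ)) * ζ (x, τ) ≠ 0} with hS
    have hSo : IsOpen S := isOpen_ne_fun hC1.continuous continuous_const
    have hSb : S ⊆ Metric.closedBall 0 3 := fun x hx => by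
      by_contra hcon
      exact hx (by rw [hζ0 (x, τ) (by simpa using hcon), mul_zero])
    have hSf : volume S ≠ ⊤ :=
      ((measure_mono hSb).trans_lt (isCompact_closedBall _ _).measure_lt_top).ne
    have hcs : HasCompactSupport (fun x => p (mollify j u (x, τ)) * ζ (x, τ)) :=
      hasCompactSupport_slice (h := fun z => p (mollify j u z) * ζ z)
        (fun z hz => by simp [hζ0 z hz]) τ
    have hFK := hC _ S hC1 hcs (fun x => mul_nonneg (hp0 _ (hmem j _).1) (hζn _))
      hSo.measurableSet hSf (fun x hx => by_contra fun hcon => hx hcon)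
    -- Chebyshev: ψ(u_j) ξ ≥ 1 wherever p(u_j) ζ ≠ 0.
    have hSQ : volume.real S ≤ Q j τ := by
      have : volume.real S = ∫ x, S.indicator (1 : Space n → ℝ) x := by
        rw [integral_indicator_one hSo.measurableSet]
      rw [this]
      refine integral_mono ((integrable_indicator_iff hSo.measurableSet).2 (integrableOn_const hSf))
        (integrable_slice (h := fun z => ψ (mollify j u z) * ξ z) ((hcψ j).mul hξ)
          (fun z hz => by simp [hξ0 z hz]) τ) fun x => ?_
      by_cases hx : x ∈ S
      · rw [indicator_of_mem hx, Pi.one_apply]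
        have h1 := hψ1 _ (hmem j (x, τ)).1 (left_ne_zero_of_mul hx)
        have h2 := hζξ _ (right_ne_zero_of_mul hx)
        exact one_le_mul_of_one_le_of_one_le h1 h2
      · rw [indicator_of_notMem hx]
        exact mul_nonneg (hψ0 _ (hmem j _).1) (hξn _)
    have hgrad : ∫ x, ‖fderiv ℝ (fun x => p (mollify j u (x, τ)) * ζ (x, τ)) x‖ ^ 2 ≤
        ∫ x, B j (x, τ) := by
      refine integral_mono_of_nonneg (ae_of_all _ fun x => by positivity)
        (integrable_slice (hcB j) (hB0 j) τ) (ae_of_all _ fun x => ?_)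
      by_cases hx : 3 < ‖x‖
      · rw [hfd]; simp [hζ0 (x, τ) hx, hdζ (x, τ) hx, hBn]
      · have hn1 : ‖fderiv ℝ (fun x => p (mollify j u (x, τ)) * ζ (x, τ)) x‖ ≤
            |p (mollify j u (x, τ))| * ‖fderiv ℝ ζ (x, τ)‖
              + |p' (mollify j u (x, τ)) * ζ (x, τ)| * ‖mollify j g (x, τ)‖ := by
          rw [hfd]
          refine ContinuousLinearMap.opNorm_le_bound _ (by positivity) fun v => ?_
          have hjv := hj (x, τ) ⟨by simpa using hx, Ioc_subset_Icc_self hτ⟩ v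
          simp only [ContinuousLinearMap.comp_apply, ContinuousLinearMap.inl_apply,
            add_apply, smul_apply, smul_eq_mul, hjv]
          refine (norm_add_le _ _).trans ?_
          rw [add_mul]
          refine add_le_add ?_ ?_
          · rw [norm_mul, Real.norm_eq_abs, mul_assoc]
            refine mul_le_mul_of_nonneg_left ?_ (abs_nonneg _)
            refine ((fderiv ℝ ζ (x, τ)).le_opNorm _).trans ?_
            simp [Prod.norm_def]
          · rw [← mul_assoc, norm_mul, mul_comm (ζ (x, τ)), Real.norm_eq_abs, mul_assoc]
            exact mul_le_mul_of_nonneg_left (norm_inner_le_norm _ _) (abs_nonneg _)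
        calc _ ≤ (|p (mollify j u (x, τ))| * ‖fderiv ℝ ζ (x, τ)‖
              + |p' (mollify j u (x, τ)) * ζ (x, τ)| * ‖mollify j g (x, τ)‖) ^ 2 :=
              pow_le_pow_left₀ (norm_nonneg _) hn1 2
          _ ≤ 2 * (|p' (mollify j u (x, τ)) * ζ (x, τ)| * ‖mollify j g (x, τ)‖) ^ 2 +
              2 * (|p (mollify j u (x, τ))| * ‖fderiv ℝ ζ (x, τ)‖) ^ 2 := by
              nlinarith [sq_nonneg (|p (mollify j u (x, τ))| * ‖fderiv ℝ ζ (x, τ)‖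
                - |p' (mollify j u (x, τ)) * ζ (x, τ)| * ‖mollify j g (x, τ)‖)]
          _ = _ := by simp only [hB, mul_pow, sq_abs]; ring
    simp only [integral_const_mul]
    refine hFK.trans ?_
    have := Real.rpow_le_rpow measureReal_nonneg hSQ he
    have h0 : 0 ≤ ∫ x, ‖fderiv ℝ (fun x => p (mollify j u (x, τ)) * ζ (x, τ)) x‖ ^ 2 :=
      integral_nonneg fun _ => by positivity
    have := Real.rpow_nonneg (hQn j τ) (2 / n : ℝ)
    gcongr
  obtain ⟨C₀, hC₀, h00, h01⟩ := BoxSolution.exists_bound_slice (K := K) hpc hcζ.norm a b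
  obtain ⟨C₁, hC₁, h10, h11⟩ := BoxSolution.exists_bound_slice (K := K) hp' hζ.continuous a b
  obtain ⟨C₂, hC₂, h20, h21⟩ := BoxSolution.exists_bound_slice (K := K) hψ hξ a b
  have hdz : ∀ z ∈ coreBox n a b, ‖fderiv ℝ ζ z‖ ≤ C₀ :=
      fun z hz => (le_abs_self _).trans (h01 z hz)
  set vol := volume.real (Metric.closedBall (0 : Space n) 3) with hvol
  have hQb : ∀ j, ∀ τ ∈ Ioc a b, Q j τ ≤ C₂ * C₂ * vol := fun j τ hτ => by
    have e1 : Q j τ = ∫ x in Metric.closedBall 0 3, ψ (mollify j u (x, τ)) * ξ (x, τ) :=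
      (setIntegral_eq_integral_of_forall_compl_eq_zero fun x hx => by
        rw [hξ0 (x, τ) (by simpa using hx), mul_zero]).symm
    rw [e1]
    refine (Real.le_norm_self _).trans (norm_setIntegral_le_of_norm_le_const
      (isCompact_closedBall (0 : Space n) 3).measure_lt_top fun x hx => ?_)
    rw [norm_mul]
    exact mul_le_mul (h20 _ (hmem j _)) (h21 (x, τ) ⟨hx, Ioc_subset_Icc_self hτ⟩) (norm_nonneg _)
      hC₂
  have hae_time : ∀ᵐ z : SpaceTime n, z.2 ∈ Ioo (-1 : ℝ) 1 → z.2 ∈ goodTimes u :=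
    (Measure.quasiMeasurePreserving_snd (μ := (volume : Measure (Space n)))
      (ν := (volume : Measure ℝ))).ae h.ae_mem_goodTimes
  have hlimL : Tendsto (fun j => ∫ z in slab n a b, (p (mollify j u z) * ζ z) ^ 2) atTop
      (𝓝 (∫ z in slab n a b, (p (u z) * ζ z) ^ 2)) := by
    refine tendsto_setIntegral_of_le_mollify (C := (C₀ * C₁) ^ 2) (K₀ := coreBox n a b)
      h.g_sq (fun z => by positivity) measurableSet_slab isCompact_coreBox (by positivity)
      (fun j => (hlc j).aestronglyMeasurable) (Eventually.of_forall fun j z hz => ?_) ?_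
    · have hM : 0 ≤ mollify j (fun z => ‖g z‖ ^ 2) z :=
        le_trans (by positivity) (norm_mollify_sq_le h.g_sq z)
      by_cases hx : 3 < ‖z.1‖
      · rw [hζ0 z hx]; simp
        exact mul_nonneg (by positivity) (add_nonneg hM (indicator_nonneg (by simp) _))
      · have hz' : z ∈ coreBox n a b := ⟨by simpa using hx, Ioc_subset_Icc_self hz.2⟩
        rw [indicator_of_mem hz', Pi.one_apply, abs_pow, abs_mul]
        calc (|p (mollify j u z)| * |ζ z|) ^ 2 ≤ (C₀ * C₁) ^ 2 := by
              have h1 := h00 _ (hmem j z); have h2 := h11 z hz'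
              have := mul_le_mul h1 h2 (abs_nonneg _) hC₀; gcongr
          _ ≤ _ := le_mul_of_one_le_right (by positivity) (by linarith)
    · filter_upwards [mollify_tendsto h.u_int] with z hz _
      exact ((h.tendsto_comp hpc hz).mul_const _).pow 2
  have hlimR : Tendsto (fun j => ∫ z in slab n a b, C * Q j z.2 ^ (2 / n : ℝ) * B j z) atTop
      (𝓝 (∫ z in slab n a b, C * (∫ x, ψ (u (x, z.2)) * ξ (x, z.2)) ^ (2 / n : ℝ) *
        (2 * (p' (u z) * ζ z) ^ 2 * ‖g z‖ ^ 2 + 2 * p (u z) ^ 2 * ‖fderiv ℝ ζ z‖ ^ 2))) := by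
    refine tendsto_setIntegral_of_le_mollify
      (C := C * (C₂ * C₂ * vol) ^ (2 / n : ℝ) * (2 * (C₁ * C₁) ^ 2 + 2 * C₀ ^ 2 * C₀ ^ 2))
      (K₀ := coreBox n a b)
      h.g_sq (fun z => by positivity) measurableSet_slab isCompact_coreBox (by positivity)
      (fun j => (hQBc j).aestronglyMeasurable) (Eventually.of_forall fun j z hz => ?_) ?_
    · have hgz := norm_mollify_sq_le (j := j) h.g_sq z
      have hM : 0 ≤ mollify j (fun z => ‖g z‖ ^ 2) z := le_trans (by positivity) hgz
      by_cases hx : 3 < ‖z.1‖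
      · rw [hB0 j z hx, mul_zero, abs_zero]
        exact mul_nonneg (by positivity) (add_nonneg hM (indicator_nonneg (by simp) _))
      · have hz' : z ∈ coreBox n a b := ⟨by simpa using hx, Ioc_subset_Icc_self hz.2⟩
        rw [indicator_of_mem hz', Pi.one_apply, abs_mul, abs_of_nonneg (hBn j z), abs_of_nonneg
          (mul_nonneg hC0.le (Real.rpow_nonneg (hQn j _) _)), mul_assoc (C * _)]
        refine mul_le_mul ?_ ?_ (hBn j z) (by positivity)
        · have := hQb j z.2 hz.2; have := hQn j z.2; gcongr
        · have e1 : (p' (mollify j u z) * ζ z) ^ 2 ≤ (C₁ * C₁) ^ 2 := by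
            rw [← sq_abs, abs_mul]
            have := h10 _ (hmem j z); have := h11 z hz'; gcongr
          have e2 : p (mollify j u z) ^ 2 ≤ C₀ ^ 2 := by
            rw [← sq_abs]; have := h00 _ (hmem j z); gcongr
          have e3 : ‖fderiv ℝ ζ z‖ ^ 2 ≤ C₀ ^ 2 := by
            have := hdz z hz'; gcongr
          calc B j z ≤ 2 * (C₁ * C₁) ^ 2 * mollify j (fun z => ‖g z‖ ^ 2) z
                + 2 * C₀ ^ 2 * C₀ ^ 2 := by
                simp only [hB]; gcongr
            _ ≤ _ := by
                have : 0 ≤ 2 * C₀ ^ 2 * C₀ ^ 2 := by positivity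
                have : 0 ≤ 2 * (C₁ * C₁) ^ 2 := by positivity
                nlinarith
    · filter_upwards [mollify_tendsto h.u_int, mollify_tendsto h.g_int, hae_time] with z hu hg ht hz
      have hgt : z.2 ∈ goodTimes u := ht ⟨ha.trans hz.2.1, hz.2.2.trans_lt hb⟩
      refine (((h.tendsto_integral_slice hψ hξ hξ0 hgt).rpow_const (Or.inr he)).const_mul C).mul ?_
      exact (((((h.tendsto_comp hp' hu).mul_const _).pow 2).const_mul 2).mul (hg.norm.pow 2)).add
        ((((h.tendsto_comp hpc hu).pow 2).const_mul 2).mul_const _)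
  -- Only after the limit is the slice integral replaced by P, because the bound by P concerns u at
  -- good times and not its mollifications.
  refine (le_of_tendsto_of_tendsto hlimL hlimR hslice).trans ?_
  rw [← integral_const_mul]
  have hBi : IntegrableOn (fun z => 2 * (p' (u z) * ζ z) ^ 2 * ‖g z‖ ^ 2
      + 2 * p (u z) ^ 2 * ‖fderiv ℝ ζ z‖ ^ 2) (slab n a b) := by
    have hind : Integrable ((coreBox n a b).indicator (1 : SpaceTime n → ℝ)) :=
      (integrable_indicator_iff isCompact_coreBox.measurableSet).2
        (integrableOn_const isCompact_coreBox.measure_lt_top.ne)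
    refine ((h.g_sq.const_mul (2 * (C₁ * C₁) ^ 2)).add
      (hind.const_mul (2 * C₀ ^ 2 * C₀ ^ 2))).integrableOn.mono' ?_ ?_
    · have m1 := measurable_comp_of_continuousOn hp' h.u_meas fun z => (h.u_mem z).1
      have m2 := measurable_comp_of_continuousOn hpc h.u_meas fun z => (h.u_mem z).1
      exact (((((m1.mul hζ.continuous.measurable).pow_const 2).const_mul 2).mul
        (h.g_meas.norm.pow_const 2)).add (((m2.pow_const 2).const_mul 2).mul
        (hcζ.norm.measurable.pow_const 2))).aestronglyMeasurable
    · filter_upwards [ae_restrict_mem measurableSet_slab] with z hz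
      rw [Real.norm_of_nonneg (by positivity)]
      by_cases hx : 3 < ‖z.1‖
      · simp only [hζ0 z hx, hdζ z hx]; simp
        exact add_nonneg (by positivity) (mul_nonneg (by positivity)
          (indicator_nonneg (by simp) _))
      · have hz' : z ∈ coreBox n a b := ⟨by simpa using hx, Ioc_subset_Icc_self hz.2⟩
        simp only [Pi.add_apply, indicator_of_mem hz', Pi.one_apply, mul_one]
        have e1 : (p' (u z) * ζ z) ^ 2 ≤ (C₁ * C₁) ^ 2 := by
          rw [← sq_abs, abs_mul]
          have := h10 _ (h.u_mem z); have := h11 z hz'; gcongr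
        have e2 : p (u z) ^ 2 ≤ C₀ ^ 2 := by
          rw [← sq_abs]; have := h00 _ (h.u_mem z); gcongr
        have := hdz z hz'
        gcongr
  refine integral_mono_of_nonneg (ae_of_all _ fun z => ?_) (hBi.const_mul _) ?_
  · refine mul_nonneg (mul_nonneg hC0.le (Real.rpow_nonneg (integral_nonneg fun x =>
      mul_nonneg (hψ0 _ (h.u_mem _).1) (hξn _)) _)) (by positivity)
  · filter_upwards [ae_restrict_of_ae hae_time, ae_restrict_mem measurableSet_slab] with z ht hz
    have hgt : z.2 ∈ goodTimes u := ht ⟨ha.trans hz.2.1, hz.2.2.trans_lt hb⟩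
    have h1 := Real.rpow_le_rpow (integral_nonneg fun x =>
      mul_nonneg (hψ0 _ (h.u_mem _).1) (hξn _)) (hP _ hgt hz.2) he
    exact mul_le_mul_of_nonneg_right (mul_le_mul_of_nonneg_left h1 hC0.le) (by positivity)

end

/-! ### The decaying weights and pointwise flux bounds behind the L¹ estimate. -/

noncomputable section

/-- The nonnegative density `⟪F, ∇u⟫ + C R u^{2-q}`. -/
def energyDensity {n : ℕ} (q C R : ℝ) (u : SpaceTime n → ℝ) (F g : SpaceTime n → Space n)
    (z : SpaceTime n) : ℝ := ⟪F z, g z⟫ + C * R * u z ^ (2 - q)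

/-- Coercivity and growth of the flux of a singular equation with singularity `u^{-q}`. -/
structure FluxBounds {n : ℕ} (q C R ε : ℝ) (u : SpaceTime n → ℝ) (F g : SpaceTime n → Space n) :
    Prop where
  coercive : ∀ᵐ z, ε * ‖g z‖ ^ 2 ≤ C * energyDensity q C R u F g z
  growth : ∀ᵐ z, ‖F z‖ ≤
    C * (u z ^ (-q / 2) * √(energyDensity q C R u F g z) + √R * u z ^ (1 - q))

section weights
variable {a κ q v : ℝ}

/-- The bounded decreasing weight `1 / (1 + (v + κ)^a)`. -/
def decayWeight (a κ v : ℝ) : ℝ := (1 + (v + κ) ^ a)⁻¹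

/-- Minus the derivative of `decayWeight`. -/
def decayRate (a κ v : ℝ) : ℝ := a * (v + κ) ^ (a - 1) / (1 + (v + κ) ^ a) ^ 2

/-- The primitive of `decayWeight` vanishing at `0`. -/
def decayPrimitive (a κ v : ℝ) : ℝ := ∫ s in (0 : ℝ)..v, decayWeight a κ s

theorem decayWeight_pos (hκ : 0 < κ) (hv : 0 ≤ v) : 0 < decayWeight a κ v := by
  have : 0 < (v + κ) ^ a := by positivity
  unfold decayWeight; positivity

theorem decayWeight_le_one (hκ : 0 < κ) (hv : 0 ≤ v) : decayWeight a κ v ≤ 1 := by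
  have : 0 < (v + κ) ^ a := by positivity
  exact inv_le_one_of_one_le₀ (by linarith)

theorem decayRate_pos (ha : 0 < a) (hκ : 0 < κ) (hv : 0 ≤ v) : 0 < decayRate a κ v := by
  have : 0 < (v + κ) ^ a := by positivity
  have : 0 < (v + κ) ^ (a - 1) := by positivity
  unfold decayRate; positivity

theorem hasDerivAt_decayWeight (hκ : 0 < κ) (hv : 0 ≤ v) :
    HasDerivAt (decayWeight a κ) (-decayRate a κ v) v := by
  have hx : v + κ ≠ 0 := by positivity
  have h1 : HasDerivAt (fun s => 1 + (s + κ) ^ a) (a * (v + κ) ^ (a - 1)) v := by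
    have := (((hasDerivAt_id v).add_const κ).rpow_const (p := a) (Or.inl hx)).const_add 1
    simpa using this
  have := h1.inv (by positivity)
  unfold decayRate; rw [← neg_div]; exact this

theorem continuousOn_decayWeight (hκ : 0 < κ) : ContinuousOn (decayWeight a κ) (Ici 0) :=
  fun _ hx => (hasDerivAt_decayWeight hκ hx).continuousAt.continuousWithinAt

theorem continuousOn_decayRate (hκ : 0 < κ) : ContinuousOn (decayRate a κ) (Ici 0) := by
  intro x hx
  have h0 : (0 : ℝ) < x + κ := add_pos_of_nonneg_of_pos hx hκ
  refine ContinuousAt.continuousWithinAt ?_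
  have hr : ∀ s : ℝ, ContinuousAt (fun v : ℝ => (v + κ) ^ s) x := fun s =>
    ContinuousAt.rpow_const (by fun_prop) (Or.inl h0.ne')
  exact (continuousAt_const.mul (hr _)).div ((continuousAt_const.add (hr _)).pow 2) (by positivity)

/-- The shift κ > 0 keeps the second derivative continuous up to v = 0, where v^{a-1} would blow up
for a < 1. -/
theorem isNonlinearity_decayPrimitive (hκ : 0 < κ) :
    IsNonlinearity (decayPrimitive a κ) (decayWeight a κ) (fun v => -decayRate a κ v) where
  deriv₁ x hx := by
    refine intervalIntegral.integral_hasDerivAt_right ?_ ?_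
      (hasDerivAt_decayWeight hκ hx).continuousAt
    · refine ((continuousOn_decayWeight hκ).mono fun s hs => ?_).intervalIntegrable
      rw [uIcc_of_le hx] at hs; exact hs.1
    · have : Measurable (decayWeight a κ) := by unfold decayWeight; fun_prop
      exact this.stronglyMeasurable.stronglyMeasurableAtFilter
  deriv₂ x hx := hasDerivAt_decayWeight hκ hx
  cont := (continuousOn_decayRate hκ).neg

theorem decayPrimitive_mem (hκ : 0 < κ) (hv : 0 ≤ v) : decayPrimitive a κ v ∈ Icc 0 v := by
  constructor
  · exact intervalIntegral.integral_nonneg hv fun s hs => (decayWeight_pos hκ hs.1).le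
  · have : decayPrimitive a κ v ≤ ∫ s in (0 : ℝ)..v, (1 : ℝ) := by
      refine intervalIntegral.integral_mono_on hv ?_ (by simp) fun s hs =>
        decayWeight_le_one hκ hs.1
      refine ((continuousOn_decayWeight hκ).mono fun s hs => ?_).intervalIntegrable
      rw [uIcc_of_le hv] at hs; exact hs.1
    simpa using this

theorem rpow_le_one_add_rpow {s t : ℝ} (hv : 0 ≤ v) (hs : 0 ≤ s) (hst : s ≤ t) :
    v ^ s ≤ 1 + v ^ t := by
  rcases le_total v 1 with h | h
  · have := Real.rpow_le_one hv h hs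
    have := Real.rpow_nonneg hv t; linarith
  · have := Real.rpow_le_rpow_of_exponent_le h hst; linarith

/-- The weight gains a power v^{-a}; here the term 1 in its denominator is dropped. -/
theorem decayWeight_mul_rpow_le (ha : 0 < a) (hκ : 0 < κ) (hv : 0 < v) :
    decayWeight a κ v * v ^ (1 - q) ≤ v ^ (1 - q - a) := by
  have h1 : decayWeight a κ v ≤ v ^ (-a) := by
    rw [decayWeight, Real.rpow_neg hv.le]
    refine inv_anti₀ (by positivity) ?_
    have := Real.rpow_le_rpow hv.le (show v ≤ v + κ by linarith) ha.le
    linarith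
  calc _ ≤ v ^ (-a) * v ^ (1 - q) := by gcongr
    _ = _ := by rw [← Real.rpow_add hv]; congr 1; ring

/-- Dropping the 1 in the denominator bounds the rate by (v + κ)^{-1-a}. This treats the lower order
part C R v^{2-q} of the energy density. -/
theorem decayRate_mul_rpow_le (ha : 0 < a) (ha1 : a ≤ 1) (hκ : 0 < κ) (hv : 0 ≤ v)
    (hq : q < 2) : decayRate a κ v * v ^ (2 - q) ≤ v ^ (1 - q - a) := by
  rcases hv.eq_or_lt with rfl | hv
  · rw [Real.zero_rpow (by linarith), mul_zero]; positivity
  have hx : 0 < v + κ := by linarith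
  have h1 : decayRate a κ v ≤ (v + κ) ^ (-1 - a) := by
    have e : (v + κ) ^ (-1 - a) = (v + κ) ^ (a - 1) / ((v + κ) ^ a) ^ 2 := by
      rw [← Real.rpow_natCast, ← Real.rpow_mul hx.le, ← Real.rpow_sub hx]; congr 1; push_cast; ring
    rw [e, decayRate]
    have : 0 < (v + κ) ^ (a - 1) := by positivity
    gcongr
    · nlinarith
    · linarith
  have h2 : (v + κ) ^ (-1 - a) ≤ v ^ (-1 - a) :=
    Real.rpow_le_rpow_of_nonpos hv (by linarith) (by linarith)
  calc _ ≤ v ^ (-1 - a) * v ^ (2 - q) := by gcongr; exact h1.trans h2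
    _ = _ := by rw [← Real.rpow_add hv]; congr 1; ring

theorem inv_decayRate_eq (ha : 0 < a) (hκ : 0 < κ) (hv : 0 ≤ v) :
    (decayRate a κ v)⁻¹ = (v + κ) ^ (1 - a) * (1 + (v + κ) ^ a) ^ 2 / a := by
  have hx : 0 < v + κ := by linarith
  rw [decayRate, inv_div, show 1 - a = -(a - 1) by ring, Real.rpow_neg hx.le]
  field_simp

theorem add_rpow_le_two_mul {s : ℝ} (hs : 0 ≤ s) (hs1 : s ≤ 1) (hκ : 0 < κ) (hv : κ ≤ v) :
    (v + κ) ^ s ≤ 2 * v ^ s := by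
  have hv0 : 0 < v := by linarith
  calc (v + κ) ^ s ≤ (2 * v) ^ s := Real.rpow_le_rpow (by linarith) (by linarith) hs
    _ = 2 ^ s * v ^ s := Real.mul_rpow (by norm_num) hv0.le
    _ ≤ 2 ^ (1 : ℝ) * v ^ s := by gcongr; norm_num
    _ = _ := by simp

/-- In weight²/rate the factors 1 + (v + κ)^a cancel and leave (v + κ)^{1-a}/a. Above the level κ
the shift costs at most a factor 2. This is the remainder when the flux is absorbed into the
weighted energy. -/
theorem decayWeight_sq_div_decayRate_le (ha : 0 < a) (ha1 : a ≤ 1) (hκ : 0 < κ) (hv : κ ≤ v) :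
    decayWeight a κ v ^ 2 * v ^ (-q) * (decayRate a κ v)⁻¹ ≤ 2 / a * v ^ (1 - q - a) := by
  have hv0 : 0 < v := by linarith
  rw [inv_decayRate_eq ha hκ hv0.le, decayWeight]
  calc _ = (v + κ) ^ (1 - a) * v ^ (-q) / a := by field_simp
    _ ≤ 2 * v ^ (1 - a) * v ^ (-q) / a := by
      have := add_rpow_le_two_mul (s := 1 - a) (by linarith) (by linarith) hκ hv
      gcongr
    _ = 2 / a * (v ^ (1 - a) * v ^ (-q)) := by ring
    _ = _ := by rw [← Real.rpow_add hv0]; congr 2; ring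

/-- Without the squared weight in the numerator, the factor (1 + (v + κ)^a)² survives and raises the
power from 1 - q - a to 1 - q + a. This is the cost of passing from the weighted energy to the plain
flux; for a < q it is still sublinear. -/
theorem rpow_div_decayRate_le (ha : 0 < a) (haq : a + q ≤ 1) (hκ : 0 < κ) (hq : 0 ≤ q)
    (hv : κ ≤ v) :
    v ^ (-q) * (decayRate a κ v)⁻¹ ≤ 32 / a * (1 + v ^ (1 - q + a)) := by
  have hv0 : 0 < v := by linarith
  have hva : 0 < v ^ a := by positivity
  rw [inv_decayRate_eq ha hκ hv0.le]
  have h1 := add_rpow_le_two_mul (s := 1 - a) (by linarith) (by linarith) hκ hv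
  have h2 := add_rpow_le_two_mul (s := a) ha.le (by linarith) hκ hv
  have h3 : (1 + (v + κ) ^ a) ^ 2 ≤ 8 * (1 + v ^ (2 * a)) := by
    have e : v ^ (2 * a) = (v ^ a) ^ 2 := by
      rw [mul_comm, Real.rpow_mul hv0.le]; norm_cast
    rw [e]
    calc (1 + (v + κ) ^ a) ^ 2 ≤ (1 + 2 * v ^ a) ^ 2 := by gcongr
      _ ≤ _ := by nlinarith [sq_nonneg (v ^ a - 1)]
  have h4 : v ^ (1 - q - a) ≤ 1 + v ^ (1 - q + a) :=
    rpow_le_one_add_rpow hv0.le (by linarith) (by linarith)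
  calc _ ≤ v ^ (-q) * (2 * v ^ (1 - a) * (8 * (1 + v ^ (2 * a))) / a) := by gcongr
    _ = 16 / a * (v ^ (-q) * v ^ (1 - a) + v ^ (-q) * v ^ (1 - a) * v ^ (2 * a)) := by ring
    _ = 16 / a * (v ^ (1 - q - a) + v ^ (1 - q + a)) := by
      rw [← Real.rpow_add hv0, ← Real.rpow_add hv0]; ring_nf
    _ ≤ 16 / a * (2 * (1 + v ^ (1 - q + a))) := by
      gcongr
      have := Real.rpow_nonneg hv0.le (1 - q + a); linarith
    _ = _ := by ring

end weights

/-- Weighted arithmetic–geometric inequality. -/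
theorem mul_le_weighted {x y w : ℝ} (hw : 0 < w) :
    x * y ≤ w * x ^ 2 / 2 + y ^ 2 * w⁻¹ / 2 := by
  have h : 0 ≤ (w * x - y) ^ 2 * w⁻¹ / 2 := by positivity
  have e : (w * x - y) ^ 2 * w⁻¹ / 2 = w * x ^ 2 / 2 + y ^ 2 * w⁻¹ / 2 - x * y := by
    field_simp; ring
  linarith

section pointwise
variable {a κ q C R u E N η : ℝ}

/-- Pointwise bound of the flux against the weight of the test function. -/
theorem weight_mul_flux_le (ha : 0 < a) (ha1 : a ≤ 1) (hκ : 0 < κ) (hC : 0 ≤ C) (hR : 1 ≤ R)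
    (hu : κ ≤ u) (hE : 0 ≤ E) (hη : η ∈ Icc (0 : ℝ) 1)
    (hN : N ≤ C * (u ^ (-q / 2) * √E + √R * u ^ (1 - q))) {t : ℝ} (ht : 1 ≤ t) :
    t * (decayWeight a κ u * (η * N)) ≤ decayRate a κ u * (η ^ 2 * E) / 2
      + (C ^ 2 / a + C) * (t ^ 2 * R * u ^ (1 - q - a)) := by
  have hu0 : 0 < u := by linarith
  have hp := decayWeight_pos (a := a) hκ hu0.le
  have hω := decayRate_pos ha hκ hu0.le
  have huq : (u ^ (-q / 2)) ^ 2 = u ^ (-q) := by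
    rw [← Real.rpow_natCast, ← Real.rpow_mul hu0.le]; congr 1; push_cast; ring
  -- Young's inequality weighted by the rate itself, so that exactly half of the weighted energy
  -- appears and can be absorbed.
  have h1 := mul_le_weighted (x := η * √E) (y := t * C * decayWeight a κ u * u ^ (-q / 2)) hω
  have h2 : (t * C * decayWeight a κ u * u ^ (-q / 2)) ^ 2 * (decayRate a κ u)⁻¹ / 2 ≤
      C ^ 2 / a * (t ^ 2 * R * u ^ (1 - q - a)) := by
    have := decayWeight_sq_div_decayRate_le (q := q) ha ha1 hκ hu
    calc _ = t ^ 2 * C ^ 2 / 2 * (decayWeight a κ u ^ 2 * u ^ (-q) * (decayRate a κ u)⁻¹) := by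
          rw [mul_pow, mul_pow, mul_pow, huq]; ring
      _ ≤ t ^ 2 * C ^ 2 / 2 * (2 / a * u ^ (1 - q - a)) := by gcongr
      _ = C ^ 2 / a * (t ^ 2 * 1 * u ^ (1 - q - a)) := by ring
      _ ≤ _ := by gcongr
  have h3 : t * C * (decayWeight a κ u * (η * (√R * u ^ (1 - q)))) ≤
      C * (t ^ 2 * R * u ^ (1 - q - a)) := by
    have e1 := decayWeight_mul_rpow_le (q := q) ha hκ hu0
    have e2 : √R ≤ R := by
      rw [Real.sqrt_le_left (by linarith)]; nlinarith
    have e3 : t ≤ t ^ 2 := by nlinarith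
    calc _ = t * C * √R * η * (decayWeight a κ u * u ^ (1 - q)) := by ring
      _ ≤ t ^ 2 * C * R * 1 * u ^ (1 - q - a) := by
        have := hη.2; have := hη.1
        gcongr
      _ = _ := by ring
  have h4 : t * (decayWeight a κ u * (η * N)) ≤
      t * (decayWeight a κ u * (η * (C * (u ^ (-q / 2) * √E + √R * u ^ (1 - q))))) := by
    have := hη.1; gcongr
  calc _ ≤ _ := h4
    _ = η * √E * (t * C * decayWeight a κ u * u ^ (-q / 2))
        + t * C * (decayWeight a κ u * (η * (√R * u ^ (1 - q)))) := by ring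
    _ ≤ (decayRate a κ u * (η * √E) ^ 2 / 2 + C ^ 2 / a * (t ^ 2 * R * u ^ (1 - q - a)))
        + C * (t ^ 2 * R * u ^ (1 - q - a)) := by linarith
    _ = _ := by rw [mul_pow, Real.sq_sqrt hE]; ring

/-- Pointwise bound of the flux by the weighted energy density. -/
theorem flux_le_weighted (ha : 0 < a) (haq : a + q ≤ 1) (hκ : 0 < κ) (hq : 0 ≤ q) (hC : 0 ≤ C)
    (hu : κ ≤ u) (hE : 0 ≤ E) (hη : η ∈ Icc (0 : ℝ) 1)
    (hN : N ≤ C * (u ^ (-q / 2) * √E + √R * u ^ (1 - q))) {σ : ℝ} (hσ : 0 < σ) :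
    η * N ≤ σ * (decayRate a κ u * (η ^ 2 * E)) + C ^ 2 * (32 / a) * (σ⁻¹ * (1 + u ^ (1 - q + a)))
      + C * (√R * u ^ (1 - q)) := by
  have hu0 : 0 < u := by linarith
  have hω := decayRate_pos ha hκ hu0.le
  have huq : (u ^ (-q / 2)) ^ 2 = u ^ (-q) := by
    rw [← Real.rpow_natCast, ← Real.rpow_mul hu0.le]; congr 1; push_cast; ring
  -- The parameter σ stays free; it is optimized later in terms of the mass and R.
  have h1 := mul_le_weighted (x := η * √E) (y := C * u ^ (-q / 2)) (mul_pos hσ hω)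
  have h2 := rpow_div_decayRate_le ha haq hκ hq hu
  have h5 : (C * u ^ (-q / 2)) ^ 2 * (σ * decayRate a κ u)⁻¹ / 2 ≤
      C ^ 2 * (32 / a) * (σ⁻¹ * (1 + u ^ (1 - q + a))) := by
    calc _ = C ^ 2 * σ⁻¹ / 2 * (u ^ (-q) * (decayRate a κ u)⁻¹) := by
          rw [mul_pow, huq, mul_inv]; ring
      _ ≤ C ^ 2 * σ⁻¹ / 2 * (32 / a * (1 + u ^ (1 - q + a))) := by gcongr
      _ ≤ C ^ 2 * σ⁻¹ * (32 / a * (1 + u ^ (1 - q + a))) := by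
          have := Real.rpow_nonneg hu0.le (1 - q + a)
          gcongr
          exact half_le_self (by positivity)
      _ = _ := by ring
  have h6 : η * N ≤ η * (C * (u ^ (-q / 2) * √E + √R * u ^ (1 - q))) := by
    have := hη.1; gcongr
  have h7 : η * (C * (√R * u ^ (1 - q))) ≤ C * (√R * u ^ (1 - q)) :=
    mul_le_of_le_one_left (by positivity) hη.2
  have h8 : σ * decayRate a κ u * (η * √E) ^ 2 / 2 ≤ σ * (decayRate a κ u * (η ^ 2 * E)) := by
    rw [mul_pow, Real.sq_sqrt hE]
    have : 0 ≤ σ * (decayRate a κ u * (η ^ 2 * E)) := by positivity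
    linarith
  linarith

end pointwise

end

/-! ### The change of mass between two times. -/

noncomputable section

namespace BoxSolution
variable {n : ℕ} {K : ℝ} {u : SpaceTime n → ℝ} {F g : SpaceTime n → Space n}

theorem integrableOn_comp (h : BoxSolution K u F g) {f : ℝ → ℝ} (hf : ContinuousOn f (Ici 0))
    {Z : Set (SpaceTime n)} (hZ : volume Z < ⊤) : IntegrableOn (fun z => f (u z)) Z := by
  obtain ⟨C, hC⟩ := (isCompact_Icc (a := (0 : ℝ)) (b := K)).exists_bound_of_continuousOn
    (hf.mono fun _ hx => hx.1)
  exact Measure.integrableOn_of_bounded hZ.ne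
    (measurable_comp_of_continuousOn hf h.u_meas fun z => (h.u_mem z).1).aestronglyMeasurable
    (ae_of_all _ fun z => hC _ (h.u_mem z))

theorem integrable_comp_mul (h : BoxSolution K u F g) {f : ℝ → ℝ} (hf : ContinuousOn f (Ici 0))
    {H : SpaceTime n → ℝ} {μ : Measure (SpaceTime n)} (hH : Integrable H μ) :
    Integrable (fun z => f (u z) * H z) μ := by
  obtain ⟨C, hC⟩ := (isCompact_Icc (a := (0 : ℝ)) (b := K)).exists_bound_of_continuousOn
    (hf.mono fun _ hx => hx.1)
  exact hH.bdd_mul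
    (measurable_comp_of_continuousOn hf h.u_meas fun z => (h.u_mem z).1).aestronglyMeasurable
    (ae_of_all _ fun z => hC _ (h.u_mem z))

theorem integrable_inner (h : BoxSolution K u F g) : Integrable fun z => ⟪F z, g z⟫ := by
  refine (h.F_sq.add h.g_sq).mono' (h.F_meas.inner h.g_meas).aestronglyMeasurable
    (ae_of_all _ fun z => (norm_inner_le_norm _ _).trans ?_)
  simp only [Pi.add_apply]
  nlinarith [sq_nonneg (‖F z‖ - ‖g z‖), sq_nonneg ‖F z‖, sq_nonneg ‖g z‖]

theorem integrableOn_energyDensity (h : BoxSolution K u F g) {q C R : ℝ} (hq : q ≤ 2)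
    {Z : Set (SpaceTime n)} (hZ : volume Z < ⊤) :
    IntegrableOn (energyDensity q C R u F g) Z :=
  h.integrable_inner.integrableOn.add ((h.integrableOn_comp
    (Real.continuous_rpow_const (by linarith)).continuousOn hZ).const_mul _)

theorem integrable_slice_u (h : BoxSolution K u F g) (τ : ℝ) : Integrable fun x => u (x, τ) := by
  have hind : Integrable ((Metric.ball (0 : Space n) 4).indicator (fun _ => K)) :=
    (integrable_indicator_iff measurableSet_ball).2
      (integrableOn_const Metric.isBounded_ball.measure_lt_top.ne)
  refine hind.mono' (h.u_meas.comp (by fun_prop)).aestronglyMeasurable (ae_of_all _ fun x => ?_)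
  by_cases hx : x ∈ Metric.ball (0 : Space n) 4
  · rw [indicator_of_mem hx, Real.norm_of_nonneg (h.u_mem _).1]; exact (h.u_mem _).2
  · rw [h.u_zero (x, τ) fun hz => hx hz.1]; simp [hx]

theorem setIntegral_slice_mono (h : BoxSolution K u F g) {s t : ℝ} (hst : s ≤ t) (τ : ℝ) :
    ∫ x in Metric.ball 0 s, u (x, τ) ≤ ∫ x in Metric.ball 0 t, u (x, τ) :=
  setIntegral_mono_set (h.integrable_slice_u τ).integrableOn
    (ae_of_all _ fun _ => (h.u_mem _).1) (Metric.ball_subset_ball hst).eventuallyLE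

/-- The flux is small where the solution is small. -/
theorem exists_small_level (h : BoxSolution K u F g) {q C R ε : ℝ}
    (hF : FluxBounds q C R ε u F g) (hq : 0 < q) (hq1 : q < 1) {δ : ℝ} (hδ : 0 < δ) :
    ∃ κ : ℝ, 0 < κ ∧ ∫ z, {z | u z < κ}.indicator (fun z => ‖F z‖) z ≤ δ := by
  have hlim : Tendsto (fun j : ℕ => ∫ z, {z | u z < 1 / ((j : ℝ) + 1)}.indicator
      (fun z => ‖F z‖) z) atTop (𝓝 (∫ _ : SpaceTime n, (0 : ℝ))) := by
    refine tendsto_integral_of_dominated_convergence (fun z => ‖F z‖) (fun j => ?_)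
      h.F_int.norm (fun j => ae_of_all _ fun z => ?_) ?_
    · exact (h.F_meas.norm.indicator (measurableSet_lt h.u_meas
        measurable_const)).aestronglyMeasurable
    · exact (norm_indicator_le_norm_self _ _).trans (norm_norm _).le
    · filter_upwards [hF.growth] with z hz
      rcases (h.u_mem z).1.eq_or_lt with h0 | h0
      -- A default value matters here: 0 raised to the negative power -q/2 is 0, so the growth bound
      -- states that the flux vanishes where u = 0.
      · rw [← h0, Real.zero_rpow (by linarith), Real.zero_rpow (by linarith)] at hz
        have : ‖F z‖ = 0 := le_antisymm (by simpa using hz) (norm_nonneg _)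
        simp only [indicator_apply, this, ite_self]; exact tendsto_const_nhds
      · refine tendsto_const_nhds.congr' ?_
        filter_upwards [tendsto_one_div_add_atTop_nhds_zero_nat.eventually_lt_const h0] with j hj
        rw [indicator_of_notMem]; simpa using hj.le
  rw [integral_zero] at hlim
  obtain ⟨j, hj⟩ := (hlim.eventually_le_const hδ).exists
  exact ⟨_, by positivity, hj⟩

/-- Sublinear powers are controlled by the mass: u^s ≤ S^s (1 + u/S), and the integral of u is at
most 2S because the time interval has length at most 2. -/
theorem setIntegral_rpow_le (h : BoxSolution K u F g) {r t₁ t₂ S c : ℝ} (hS : 1 ≤ S)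
    (ht₁ : t₁ ∈ goodTimes u) (ht₂ : t₂ ∈ goodTimes u) (ht : t₁ ≤ t₂)
    (hc : 2 * volume.real (Metric.ball (0 : Space n) r) ≤ c)
    (hm : ∀ τ ∈ goodTimes u, ∫ x in Metric.ball 0 r, u (x, τ) ≤ S) {s : ℝ} (hs : 0 ≤ s)
    (hs1 : s ≤ 1) :
    ∫ z in Metric.ball 0 r ×ˢ Ioc t₁ t₂, u z ^ s ≤ (c + 2) * S ^ s := by
  set Z : Set (SpaceTime n) := Metric.ball 0 r ×ˢ Ioc t₁ t₂ with hZ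
  have hZv : volume Z = volume (Metric.ball (0 : Space n) r) * volume (Ioc t₁ t₂) :=
    Measure.prod_prod _ _
  have hZf : volume Z < ⊤ := by
    rw [hZv]; exact ENNReal.mul_lt_top Metric.isBounded_ball.measure_lt_top (by simp)
  have hlen : t₂ - t₁ ≤ 2 := by linarith [ht₁.1.1, ht₂.1.2]
  have hZc : volume.real Z ≤ c := by
    refine le_trans ?_ hc
    rw [measureReal_def, hZv, ENNReal.toReal_mul, Real.volume_Ioc, ENNReal.toReal_ofReal
      (by linarith), mul_comm, measureReal_def]
    gcongr
  have hu1 : ∫ z in Z, u z ≤ 2 * S := by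
    have hi : IntegrableOn u Z := h.u_int.integrableOn
    rw [IntegrableOn, hZ, Measure.volume_eq_prod, ← Measure.prod_restrict] at hi
    rw [hZ, Measure.volume_eq_prod, ← Measure.prod_restrict, integral_prod_symm _ hi]
    calc ∫ τ in Ioc t₁ t₂, ∫ x in Metric.ball 0 r, u (x, τ)
        ≤ ∫ τ in Ioc t₁ t₂, S := by
          refine integral_mono_of_nonneg (ae_of_all _ fun τ => integral_nonneg fun x =>
            (h.u_mem _).1) (integrableOn_const (by simp)) ?_
          filter_upwards [ae_restrict_of_ae h.ae_mem_goodTimes, ae_restrict_mem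
            measurableSet_Ioc] with τ h1 h2
          exact hm _ (h1 ⟨ht₁.1.1.trans h2.1, h2.2.trans_lt ht₂.1.2⟩)
      _ ≤ 2 * S := by
          rw [setIntegral_const, measureReal_def, Real.volume_Ioc, ENNReal.toReal_ofReal
            (by linarith), smul_eq_mul]
          gcongr
  have hS0 : 0 < S := by linarith
  have i1 : IntegrableOn u Z := h.u_int.integrableOn
  have i0 : IntegrableOn (fun _ : SpaceTime n => (1 : ℝ)) Z := integrableOn_const hZf.ne
  calc ∫ z in Z, u z ^ s ≤ ∫ z in Z, S ^ s * (1 + S⁻¹ * u z) := by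
        refine integral_mono_of_nonneg (ae_of_all _ fun z => Real.rpow_nonneg (h.u_mem z).1 _)
          ((i0.add (i1.const_mul _)).const_mul _) (ae_of_all _ fun z => ?_)
        have h0 := (h.u_mem z).1
        have e : u z ^ s = S ^ s * (S⁻¹ * u z) ^ s := by
          rw [← Real.mul_rpow hS0.le (by positivity)]; congr 1; field_simp
        simp only []
        rw [e]
        refine mul_le_mul_of_nonneg_left ?_ (by positivity)
        have := rpow_le_one_add_rpow (v := S⁻¹ * u z) (by positivity) hs hs1
        rwa [Real.rpow_one] at this
    _ = S ^ s * (volume.real Z + S⁻¹ * ∫ z in Z, u z) := by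
        rw [integral_const_mul, integral_add i0 (i1.const_mul _), integral_const_mul]
        simp
    _ ≤ S ^ s * (c + S⁻¹ * (2 * S)) := by gcongr
    _ = _ := by field_simp

end BoxSolution

set_option maxHeartbeats 2000000 in
/-- The change of the mass in a ball over an arbitrary time interval. -/
theorem exists_mass_le_add (n : ℕ) {q C a : ℝ} (hq : 0 < q) (hC : 0 < C) (ha : 0 < a)
    (haq : a < q) (haq1 : a + q < 1) : ∃ A : ℝ, 0 < A ∧
    ∀ {K R ε r r' S : ℝ} {u : SpaceTime n → ℝ} {F g : SpaceTime n → Space n},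
      BoxSolution K u F g → FluxBounds q C R ε u F g → 0 < ε → 1 ≤ R → 2 ≤ r → r < r' → r' ≤ 3 →
      1 ≤ S → (∀ τ ∈ goodTimes u, ∫ x in Metric.ball 0 r', u (x, τ) ≤ S) →
      ∀ t₁ ∈ goodTimes u, ∀ t₂ ∈ goodTimes u, ∫ x in Metric.ball 0 r, u (x, t₂) ≤
        (∫ x in Metric.ball 0 4, u (x, t₁)) +
          A * (r' - r) ^ (-3 : ℝ) * (S ^ (1 - (q - a) / 2) + √R * S ^ (1 - q)) := by
  obtain ⟨C₁, hC₁, hcut⟩ := exists_space_cutoff n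
  set c := 2 * volume.real (Metric.ball (0 : Space n) 3) with hc
  have hc0 : 0 ≤ c := by positivity
  set T₀ := 2 * C₁ + 1 with hT₀
  set M₁ := 2 * (2 + (C ^ 2 / a + C + C) * T₀ ^ 2 * (c + 2)) with hM₁
  set M₂ := C ^ 2 * (32 / a) * (2 * (c + 2)) with hM₂
  refine ⟨T₀ * (M₁ + M₂ + C * (c + 2) + 1), by positivity, ?_⟩
  intro K R ε r r' S u F g h hF hε hR hr hrr' hr' hS hm
  set d := r' - r with hd
  have hd0 : 0 < d := by linarith
  have hd1 : d ≤ 1 := by linarith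
  obtain ⟨η, hη, hη01, hη1, hη0, hηd⟩ := hcut r r' (by linarith) hrr'
  -- Squaring leaves a factor η in the derivative, which is needed to absorb the flux into ζE = η²E.
  -- There is no cutoff in time, so no time derivative appears and the times may be arbitrary.
  set ζ : SpaceTime n → ℝ := fun z => η z.1 ^ 2 with hζdef
  have hζ : ContDiff ℝ ∞ ζ := (hη.comp contDiff_fst).pow 2
  have hζ0 : ∀ z, 3 < ‖z.1‖ → ζ z = 0 := fun z hz => by
    simp [hζdef, hη0 z.1 (by linarith)]
  have hfζ : ∀ z w, fderiv ℝ ζ z w = 2 * η z.1 * fderiv ℝ η z.1 w.1 := fun z w => by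
    have h1 : HasFDerivAt (fun z : SpaceTime n => η z.1)
        ((fderiv ℝ η z.1).comp (ContinuousLinearMap.fst ℝ (Space n) ℝ)) z :=
      ((hη.differentiable (by simp) z.1).hasFDerivAt).comp z hasFDerivAt_fst
    rw [(h1.pow 2).fderiv]; simp
  set T := T₀ / d with hT
  have hT1 : 1 ≤ T := by
    rw [hT, le_div_iff₀ hd0]; linarith
  have hfT : ∀ z, |fderiv ℝ ζ z (F z, 0)| ≤ T * (η z.1 * ‖F z‖) := fun z => by
    rw [hfζ, abs_mul, abs_mul, abs_of_nonneg (hη01 z.1).1, abs_two]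
    have h1 : |fderiv ℝ η z.1 (F z)| ≤ C₁ / d * ‖F z‖ :=
      ((fderiv ℝ η z.1).le_opNorm _).trans (by gcongr; exact hηd _)
    have h2 := (hη01 z.1).1
    calc _ ≤ 2 * η z.1 * (C₁ / d * ‖F z‖) := by gcongr
      _ = 2 * C₁ / d * (η z.1 * ‖F z‖) := by ring
      _ ≤ _ := by
        rw [hT]; gcongr; linarith
  -- The pointwise bounds need u ≥ κ. The level κ depends on the solution, but no constant below
  -- depends on it, and the set {u < κ} contributes at most T · (1/T) = 1.
  obtain ⟨κ, hκ, hκF⟩ := h.exists_small_level hF hq (by linarith) (δ := 1 / T) (by positivity)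
  set N₀ : SpaceTime n → ℝ := fun z => {z | u z < κ}.indicator (fun z => ‖F z‖) z with hN₀
  have hN₀i : Integrable N₀ := h.F_int.norm.indicator (measurableSet_lt h.u_meas measurable_const)
  have hN₀n : ∀ z, 0 ≤ N₀ z := fun z => indicator_nonneg (fun _ _ => norm_nonneg _) _
  set E := energyDensity q C R u F g with hE
  have hE0 : ∀ᵐ z, 0 ≤ E z := by
    filter_upwards [hF.coercive] with z hz
    have : 0 ≤ C * E z := le_trans (by positivity) hz
    exact nonneg_of_mul_nonneg_right this hC
  -- mass comparison with the cutoff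
  have hcx : ∀ τ : ℝ, Integrable fun x => u (x, τ) * ζ (x, τ) := fun τ => by
    refine (h.integrable_slice_u τ).mul_bdd (c := 1)
      (hη.continuous.pow 2).aestronglyMeasurable (ae_of_all _ fun x => ?_)
    rw [Real.norm_of_nonneg (sq_nonneg _)]
    have := hη01 x; exact pow_le_one₀ this.1 this.2
  have hζ01 : ∀ z, ζ z ∈ Icc (0 : ℝ) 1 := fun z =>
    ⟨sq_nonneg _, pow_le_one₀ (hη01 z.1).1 (hη01 z.1).2⟩
  have hlow : ∀ τ, ∫ x in Metric.ball 0 r, u (x, τ) ≤ ∫ x, u (x, τ) * ζ (x, τ) := fun τ => by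
    rw [← integral_indicator measurableSet_ball]
    refine integral_mono ((h.integrable_slice_u τ).indicator measurableSet_ball) (hcx τ) fun x => ?_
    by_cases hx : x ∈ Metric.ball (0 : Space n) r
    · simp [indicator_of_mem hx, hζdef, hη1 x (mem_ball_zero_iff.1 hx).le]
    · rw [indicator_of_notMem hx]; exact mul_nonneg (h.u_mem _).1 (hζ01 _).1
  have hupp : ∀ τ, ∫ x, u (x, τ) * ζ (x, τ) ≤ ∫ x in Metric.ball 0 r', u (x, τ) := fun τ => by
    rw [← integral_indicator measurableSet_ball]
    refine integral_mono (hcx τ) ((h.integrable_slice_u τ).indicator measurableSet_ball) fun x => ?_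
    by_cases hx : x ∈ Metric.ball (0 : Space n) r'
    · rw [indicator_of_mem hx]; exact mul_le_of_le_one_right (h.u_mem _).1 (hζ01 _).2
    · simp [indicator_of_notMem hx, hζdef, hη0 x (by simpa using hx)]
  -- the bound for ordered times
  have main : ∀ t₁ ∈ goodTimes u, ∀ t₂ ∈ goodTimes u, t₁ ≤ t₂ →
      |(∫ x, u (x, t₂) * ζ (x, t₂)) - ∫ x, u (x, t₁) * ζ (x, t₁)| ≤
        T₀ * (M₁ + M₂ + C * (c + 2) + 1) * d ^ (-3 : ℝ) *
          (S ^ (1 - (q - a) / 2) + √R * S ^ (1 - q)) := by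
    intro t₁ ht₁ t₂ ht₂ ht
    set Z : Set (SpaceTime n) := Metric.ball 0 r' ×ˢ Ioc t₁ t₂ with hZ
    have hZf : volume Z < ⊤ := by
      rw [hZ, Measure.volume_eq_prod, Measure.prod_prod]
      exact ENNReal.mul_lt_top Metric.isBounded_ball.measure_lt_top (by simp)
    have hsub : Z ⊆ slab n t₁ t₂ := prod_mono_left (subset_univ _)
    have hsl : ∀ H : SpaceTime n → ℝ, (∀ z, η z.1 = 0 → H z = 0) →
        ∫ z in slab n t₁ t₂, H z = ∫ z in Z, H z := fun H hH =>
      (setIntegral_eq_of_subset_of_forall_sdiff_eq_zero measurableSet_slab hsub fun z hz =>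
        hH z (hη0 _ (by
          by_contra hcon
          exact hz.2 ⟨by simpa using hcon, hz.1.2⟩)))
    have hpow : ∀ s : ℝ, 0 ≤ s → s ≤ 1 → ∫ z in Z, u z ^ s ≤ (c + 2) * S ^ s := fun s hs hs1 =>
      h.setIntegral_rpow_le (c := c) hS ht₁ ht₂ ht (by
        rw [hc]
        have := measureReal_mono (μ := (volume : Measure (Space n)))
          (Metric.ball_subset_ball (x := (0 : Space n)) hr') Metric.isBounded_ball.measure_lt_top.ne
        linarith) hm hs hs1
    have hpowi : ∀ s : ℝ, 0 ≤ s → IntegrableOn (fun z => u z ^ s) Z := fun s hs =>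
      h.integrableOn_comp (Real.continuous_rpow_const hs).continuousOn hZf
    have hN₀Z : ∫ z in Z, N₀ z ≤ 1 / T :=
      (setIntegral_le_integral hN₀i (ae_of_all _ hN₀n)).trans hκF
    have hηm : AEStronglyMeasurable (fun z : SpaceTime n => η z.1) (volume.restrict Z) :=
      (hη.continuous.comp continuous_fst).aestronglyMeasurable
    have hηF : IntegrableOn (fun z => η z.1 * ‖F z‖) Z :=
      h.F_int.norm.integrableOn.bdd_mul (c := 1) hηm (ae_of_all _ fun z => by
        rw [Real.norm_of_nonneg (hη01 _).1]; exact (hη01 _).2)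
    have hζm : AEStronglyMeasurable ζ (volume.restrict Z) := hζ.continuous.aestronglyMeasurable
    have hζb : ∀ᵐ z ∂volume.restrict Z, ‖ζ z‖ ≤ 1 := ae_of_all _ fun z => by
      rw [Real.norm_of_nonneg (hζ01 z).1]; exact (hζ01 z).2
    have hEi : IntegrableOn E Z := h.integrableOn_energyDensity (by linarith) hZf
    have hωE : IntegrableOn (fun z => decayRate a κ (u z) * (ζ z * E z)) Z :=
      h.integrable_comp_mul (continuousOn_decayRate hκ) (hEi.bdd_mul hζm hζb)
    have hωI : IntegrableOn (fun z => decayRate a κ (u z) * (ζ z * ⟪F z, g z⟫)) Z :=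
      h.integrable_comp_mul (continuousOn_decayRate hκ)
        (h.integrable_inner.integrableOn.bdd_mul hζm hζb)
    have hdF : IntegrableOn (fun z => fderiv ℝ ζ z (F z, 0)) Z := by
      refine (hηF.const_mul T).mono' ?_ (ae_of_all _ hfT)
      exact ((hζ.continuous_fderiv_apply (by simp)).measurable.comp
        (measurable_id.prodMk (h.F_meas.prodMk measurable_const))).aestronglyMeasurable
    have hpF : IntegrableOn (fun z => decayWeight a κ (u z) * fderiv ℝ ζ z (F z, 0)) Z :=
      h.integrable_comp_mul (continuousOn_decayWeight hκ) hdF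
    -- the weighted energy
    set P := ∫ z in Z, decayRate a κ (u z) * (ζ z * E z) with hP
    -- The primitive lies between 0 and u, so the final slice is at most the mass and the initial
    -- slice can be dropped.
    have hPid : ∫ z in Z, (decayRate a κ (u z) * (ζ z * ⟪F z, g z⟫)
        - decayWeight a κ (u z) * fderiv ℝ ζ z (F z, 0)) ≤ S := by
      have hid := h.energy_identity (isNonlinearity_decayPrimitive (a := a) hκ) hζ hζ0 ht₁ ht₂ ht
      have e1 : ∫ z in slab n t₁ t₂, (decayPrimitive a κ (u z) * fderiv ℝ ζ z (0, 1)
          - (-decayRate a κ (u z) * ζ z * ⟪F z, g z⟫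
            + decayWeight a κ (u z) * fderiv ℝ ζ z (F z, 0))) =
          ∫ z in Z, (decayRate a κ (u z) * (ζ z * ⟪F z, g z⟫)
            - decayWeight a κ (u z) * fderiv ℝ ζ z (F z, 0)) := by
        rw [← hsl _ fun z hz => by
          have hz' : ζ z = 0 := by simp [hζdef, hz]
          simp [hfζ, hz, hz']]
        refine integral_congr_ae (ae_of_all _ fun z => ?_)
        simp only [hfζ, map_zero]; ring
      rw [e1] at hid
      rw [← hid]
      have hJ : ∀ τ, ∫ x, decayPrimitive a κ (u (x, τ)) * ζ (x, τ) ≤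
          ∫ x, u (x, τ) * ζ (x, τ) := fun τ =>
        integral_mono_of_nonneg (ae_of_all _ fun x => mul_nonneg
          (decayPrimitive_mem hκ (h.u_mem _).1).1 (hζ01 _).1) (hcx τ) (ae_of_all _ fun x =>
          mul_le_mul_of_nonneg_right (decayPrimitive_mem hκ (h.u_mem _).1).2 (hζ01 _).1)
      have hJ0 : 0 ≤ ∫ x, decayPrimitive a κ (u (x, t₁)) * ζ (x, t₁) :=
        integral_nonneg fun x => mul_nonneg (decayPrimitive_mem hκ (h.u_mem _).1).1 (hζ01 _).1
      have := hJ t₂; have := hupp t₂; have := hm t₂ ht₂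
      linarith
    have hPb : P ≤ M₁ * (S + d ^ (-2 : ℝ) * R * S ^ (1 - q - a)) := by
      have hpw : ∀ᵐ z ∂volume.restrict Z, decayRate a κ (u z) * (ζ z * E z) ≤
          (decayRate a κ (u z) * (ζ z * ⟪F z, g z⟫)
            - decayWeight a κ (u z) * fderiv ℝ ζ z (F z, 0)) +
          (1 / 2 * (decayRate a κ (u z) * (ζ z * E z)) + T * N₀ z
            + (C ^ 2 / a + C + C) * T ^ 2 * R * u z ^ (1 - q - a)) := by
        filter_upwards [ae_restrict_of_ae hE0, ae_restrict_of_ae hF.growth] with z h1 h2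
        have hu0 := (h.u_mem z).1
        have hrate := decayRate_mul_rpow_le (q := q) ha (by linarith) hκ hu0 (by linarith)
        have hw := decayRate_pos ha hκ hu0
        have hp := decayWeight_pos (a := a) hκ hu0
        have k1 : decayRate a κ (u z) * (ζ z * (C * R * u z ^ (2 - q))) ≤
            C * T ^ 2 * R * u z ^ (1 - q - a) := by
          calc _ = C * R * ζ z * (decayRate a κ (u z) * u z ^ (2 - q)) := by ring
            _ ≤ C * R * 1 * u z ^ (1 - q - a) := by
              have := (hζ01 z).2; have := (hζ01 z).1
              gcongr
            _ ≤ _ := by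
              have : 1 ≤ T ^ 2 := one_le_pow₀ hT1
              rw [mul_one]
              have := mul_le_mul_of_nonneg_left this (show 0 ≤ C * R * u z ^ (1 - q - a) by
                positivity)
              linarith
        have k2 : decayWeight a κ (u z) * fderiv ℝ ζ z (F z, 0) ≤
            1 / 2 * (decayRate a κ (u z) * (ζ z * E z)) + T * N₀ z
              + (C ^ 2 / a + C) * T ^ 2 * R * u z ^ (1 - q - a) := by
          have k3 : decayWeight a κ (u z) * fderiv ℝ ζ z (F z, 0) ≤
              T * (decayWeight a κ (u z) * (η z.1 * ‖F z‖)) := by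
            have := mul_le_mul_of_nonneg_left ((le_abs_self _).trans (hfT z)) hp.le
            linarith
          refine k3.trans ?_
          have hζE : 0 ≤ decayRate a κ (u z) * (ζ z * E z) :=
            mul_nonneg hw.le (mul_nonneg (hζ01 z).1 h1)
          rcases le_or_gt κ (u z) with hκu | hκu
          · have := weight_mul_flux_le ha (by linarith) hκ hC.le hR hκu h1 (hη01 z.1) h2 hT1
            have hTN : 0 ≤ T * N₀ z := mul_nonneg (by linarith) (hN₀n z)
            calc _ ≤ _ := this
              _ = 1 / 2 * (decayRate a κ (u z) * (ζ z * E z))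
                  + (C ^ 2 / a + C) * T ^ 2 * R * u z ^ (1 - q - a) := by
                  simp only [hζdef]; ring
              _ ≤ _ := by linarith
          · have hN : N₀ z = ‖F z‖ := indicator_of_mem (by exact hκu) _
            rw [hN]
            have : T * (decayWeight a κ (u z) * (η z.1 * ‖F z‖)) ≤ T * ‖F z‖ := by
              have k5 := decayWeight_le_one (a := a) hκ hu0
              have k6 := hη01 z.1
              refine mul_le_mul_of_nonneg_left ?_ (by linarith)
              exact (mul_le_of_le_one_left (mul_nonneg k6.1 (norm_nonneg _)) k5).trans
                (mul_le_of_le_one_left (norm_nonneg _) k6.2)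
            have : 0 ≤ (C ^ 2 / a + C) * T ^ 2 * R * u z ^ (1 - q - a) := by positivity
            linarith
        have e : decayRate a κ (u z) * (ζ z * E z) = decayRate a κ (u z) * (ζ z * ⟪F z, g z⟫)
            + decayRate a κ (u z) * (ζ z * (C * R * u z ^ (2 - q))) := by
          simp only [hE, energyDensity]; ring
        rw [add_mul, add_mul, add_mul]
        linarith
      have hi1 : IntegrableOn (fun z => decayRate a κ (u z) * (ζ z * ⟪F z, g z⟫)
            - decayWeight a κ (u z) * fderiv ℝ ζ z (F z, 0)) Z := hωI.sub hpF
      have hi2 : IntegrableOn (fun z => 1 / 2 * (decayRate a κ (u z) * (ζ z * E z)) + T * N₀ z) Z :=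
        (hωE.const_mul _).add (hN₀i.integrableOn.const_mul _)
      have hi3 : IntegrableOn (fun z => (C ^ 2 / a + C + C) * T ^ 2 * R * u z ^ (1 - q - a)) Z :=
        (hpowi _ (by linarith)).const_mul _
      have hint := integral_mono_ae hωE (hi1.add (hi2.add hi3)) hpw
      rw [integral_add' hi1 (hi2.add hi3), integral_add' hi2 hi3, integral_add
        (hωE.const_mul _) (hN₀i.integrableOn.const_mul _), integral_const_mul, integral_const_mul,
        integral_const_mul] at hint
      have hs1 := hpow (1 - q - a) (by linarith) (by linarith)
      have hTN : T * ∫ z in Z, N₀ z ≤ 1 := by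
        have := mul_le_mul_of_nonneg_left hN₀Z (show 0 ≤ T by linarith)
        rwa [mul_one_div_cancel (by linarith)] at this
      have hmul := mul_le_mul_of_nonneg_left hs1
        (show 0 ≤ (C ^ 2 / a + C + C) * T ^ 2 * R by positivity)
      have hd2 : T ^ 2 = T₀ ^ 2 * d ^ (-2 : ℝ) := by
        rw [hT, div_pow, Real.rpow_neg hd0.le]; norm_cast
      have hpos : 0 ≤ d ^ (-2 : ℝ) * R * S ^ (1 - q - a) := by positivity
      have e2 : (C ^ 2 / a + C + C) * T ^ 2 * R * ((c + 2) * S ^ (1 - q - a)) =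
          (C ^ 2 / a + C + C) * T₀ ^ 2 * (c + 2) * (d ^ (-2 : ℝ) * R * S ^ (1 - q - a)) := by
        rw [hd2]; ring
      rw [e2] at hmul
      have hX : 0 ≤ (C ^ 2 / a + C + C) * T₀ ^ 2 * (c + 2) := by positivity
      have hXS := mul_nonneg hX (show 0 ≤ S by linarith)
      rw [← hP] at hint
      -- Half of P returns on the right and is absorbed; the stray 1 is at most S.
      have hP2 : P ≤ S + (1 / 2 * P + 1 + (C ^ 2 / a + C + C) * T₀ ^ 2 * (c + 2) *
          (d ^ (-2 : ℝ) * R * S ^ (1 - q - a))) :=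
        hint.trans (add_le_add hPid (add_le_add (add_le_add le_rfl hTN) hmul))
      rw [hM₁]
      generalize (C ^ 2 / a + C + C) * T₀ ^ 2 * (c + 2) = X at hP2 hXS ⊢
      generalize d ^ (-2 : ℝ) * R * S ^ (1 - q - a) = Y at hP2 hpos ⊢
      linarith
    -- the flux
    set σ := (√R * S ^ (-a) + S ^ ((q - a) / 2))⁻¹ with hσ
    have hS0 : 0 < S := by linarith
    have hσ0 : 0 < σ := by positivity
    have hY : ∫ z in Z, η z.1 * ‖F z‖ ≤ σ * P + M₂ * (σ⁻¹ * S ^ (1 - q + a))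
        + C * (c + 2) * (√R * S ^ (1 - q)) + 1 := by
      have hpw : ∀ᵐ z ∂volume.restrict Z, η z.1 * ‖F z‖ ≤
          (σ * (decayRate a κ (u z) * (ζ z * E z)) + N₀ z) +
            (C ^ 2 * (32 / a) * σ⁻¹ * (u z ^ (0 : ℝ) + u z ^ (1 - q + a))
              + C * √R * u z ^ (1 - q)) := by
        filter_upwards [ae_restrict_of_ae hE0, ae_restrict_of_ae hF.growth] with z h1 h2
        have hu0 := (h.u_mem z).1
        have hζE : 0 ≤ decayRate a κ (u z) * (ζ z * E z) :=
          mul_nonneg (decayRate_pos ha hκ hu0).le (mul_nonneg (hζ01 z).1 h1)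
        rw [Real.rpow_zero]
        rcases le_or_gt κ (u z) with hκu | hκu
        · have := flux_le_weighted ha haq1.le hκ hq.le hC.le hκu h1 (hη01 z.1) h2 hσ0
          have := hN₀n z
          simp only [hζdef] at *
          linarith
        · have hN : N₀ z = ‖F z‖ := indicator_of_mem (by exact hκu) _
          rw [hN]
          have : η z.1 * ‖F z‖ ≤ ‖F z‖ := mul_le_of_le_one_left (norm_nonneg _) (hη01 z.1).2
          have : 0 ≤ C ^ 2 * (32 / a) * σ⁻¹ * (1 + u z ^ (1 - q + a)) + C * √R * u z ^ (1 - q) := by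
            positivity
          have := mul_nonneg hσ0.le hζE
          linarith
      have i1 : IntegrableOn (fun z => σ * (decayRate a κ (u z) * (ζ z * E z)) + N₀ z) Z :=
        (hωE.const_mul _).add hN₀i.integrableOn
      have i2 : IntegrableOn (fun z => u z ^ (0 : ℝ) + u z ^ (1 - q + a)) Z :=
        (hpowi 0 le_rfl).add (hpowi _ (by linarith))
      have i3 : IntegrableOn (fun z => C * √R * u z ^ (1 - q)) Z :=
        (hpowi _ (by linarith)).const_mul _
      have hint :=
          integral_mono_ae hηF (i1.add ((i2.const_mul (C ^ 2 * (32 / a) * σ⁻¹)).add i3)) hpw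
      rw [integral_add' i1 ((i2.const_mul _).add i3), integral_add' (i2.const_mul _) i3,
        integral_add (hωE.const_mul _) hN₀i.integrableOn, integral_const_mul, integral_const_mul,
        integral_const_mul, integral_add (hpowi 0 le_rfl) (hpowi _ (by linarith))] at hint
      have p0 := hpow 0 le_rfl zero_le_one
      have p1 := hpow (1 - q + a) (by linarith) (by linarith)
      have p2 := hpow (1 - q) (by linarith) (by linarith)
      have p3 : S ^ (0 : ℝ) ≤ S ^ (1 - q + a) :=
        Real.rpow_le_rpow_of_exponent_le hS (by linarith)
      have p01 : (∫ z in Z, u z ^ (0 : ℝ)) + ∫ z in Z, u z ^ (1 - q + a) ≤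
          2 * (c + 2) * S ^ (1 - q + a) := by
        have := mul_le_mul_of_nonneg_left p3 (show 0 ≤ c + 2 by linarith)
        linarith
      have m1 := mul_le_mul_of_nonneg_left p01 (show 0 ≤ C ^ 2 * (32 / a) * σ⁻¹ by positivity)
      have m2 := mul_le_mul_of_nonneg_left p2 (show 0 ≤ C * √R by positivity)
      have hT1' : 1 / T ≤ 1 := by rw [div_le_one (by linarith)]; exact hT1
      rw [← hP] at hint
      simp only [hM₂]
      linarith
    -- The choice of σ balances the two sides: the summand S^{(q-a)/2} handles the S in P, the
    -- summand √R S^{-a} handles R S^{1-q-a}, and σ⁻¹ S^{1-q+a} is then precisely the sum of the two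
    -- target powers.
    have hσP : σ * P ≤ M₁ * d ^ (-2 : ℝ) * (S ^ (1 - (q - a) / 2) + √R * S ^ (1 - q)) := by
      have s1 : σ ≤ (S ^ ((q - a) / 2))⁻¹ := inv_anti₀ (by positivity) (by
        have : 0 < √R * S ^ (-a) := by positivity
        linarith)
      have s2 : σ ≤ (√R * S ^ (-a))⁻¹ := inv_anti₀ (by positivity) (by
        have : 0 < S ^ ((q - a) / 2) := by positivity
        linarith)
      have s3 : σ * S ≤ S ^ (1 - (q - a) / 2) := by
        calc _ ≤ (S ^ ((q - a) / 2))⁻¹ * S := by gcongr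
          _ = _ := by
            rw [Real.rpow_sub hS0, Real.rpow_one]; field_simp
      have s4 : σ * (R * S ^ (1 - q - a)) ≤ √R * S ^ (1 - q) := by
        calc _ ≤ (√R * S ^ (-a))⁻¹ * (R * S ^ (1 - q - a)) := by gcongr
          _ = _ := by
            have e : S ^ (1 - q - a) = S ^ (1 - q) * S ^ (-a) := by
              rw [← Real.rpow_add hS0]; congr 1
            have e' : R = √R * √R := (Real.mul_self_sqrt (by linarith)).symm
            rw [e]
            conv_lhs => rw [e']
            have : √R ≠ 0 := by positivity
            have : S ^ (-a) ≠ 0 := by positivity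
            rw [Real.mul_self_sqrt (by positivity)]
            rw [mul_inv]
            field_simp
            rw [Real.sq_sqrt (by linarith)]
      have hd2 : 1 ≤ d ^ (-2 : ℝ) :=
          Real.one_le_rpow_of_pos_of_le_one_of_nonpos hd0 hd1 (by norm_num)
      calc σ * P ≤ σ * (M₁ * (S + d ^ (-2 : ℝ) * R * S ^ (1 - q - a))) := by gcongr
        _ = M₁ * (1 * (σ * S) + d ^ (-2 : ℝ) * (σ * (R * S ^ (1 - q - a)))) := by ring
        _ ≤ M₁ * (d ^ (-2 : ℝ) * S ^ (1 - (q - a) / 2) + d ^ (-2 : ℝ) * (√R * S ^ (1 - q))) := by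
          gcongr
        _ = _ := by ring
    have hσi : σ⁻¹ * S ^ (1 - q + a) = S ^ (1 - (q - a) / 2) + √R * S ^ (1 - q) := by
      rw [hσ, inv_inv, add_mul, mul_assoc, ← Real.rpow_add hS0, ← Real.rpow_add hS0]
      rw [add_comm]; congr 2 <;> ring_nf
    set Θ := S ^ (1 - (q - a) / 2) + √R * S ^ (1 - q) with hΘ
    have hΘ1 : 1 ≤ Θ := by
      have : 1 ≤ S ^ (1 - (q - a) / 2) := Real.one_le_rpow hS (by linarith)
      have : 0 ≤ √R * S ^ (1 - q) := by positivity
      linarith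
    have hΘ2 : √R * S ^ (1 - q) ≤ Θ := by
      have : 0 ≤ S ^ (1 - (q - a) / 2) := by positivity
      linarith
    have hYb : ∫ z in Z, η z.1 * ‖F z‖ ≤ (M₁ + M₂ + C * (c + 2) + 1) * d ^ (-2 : ℝ) * Θ := by
      have hd2 : 1 ≤ d ^ (-2 : ℝ) :=
          Real.one_le_rpow_of_pos_of_le_one_of_nonpos hd0 hd1 (by norm_num)
      rw [hσi] at hY
      have b1 : C * (c + 2) * (√R * S ^ (1 - q)) ≤ C * (c + 2) * Θ := by gcongr
      have b2 : (M₂ + C * (c + 2) + 1) * Θ ≤ (M₂ + C * (c + 2) + 1) * Θ * d ^ (-2 : ℝ) :=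
        le_mul_of_one_le_right (by positivity) hd2
      have b3 : M₁ * d ^ (-2 : ℝ) * Θ + (M₂ + C * (c + 2) + 1) * Θ * d ^ (-2 : ℝ) =
          (M₁ + M₂ + C * (c + 2) + 1) * d ^ (-2 : ℝ) * Θ := by ring
      linarith
    -- conclusion
    have hidf : IsNonlinearity (fun x => x) (fun _ => 1) (fun _ => 0) :=
      ⟨fun x _ => hasDerivAt_id x, fun x _ => hasDerivAt_const x 1, continuousOn_const⟩
    have hid := h.energy_identity hidf hζ hζ0 ht₁ ht₂ ht
    rw [hid, hsl _ fun z hz => by simp [hfζ, hz]]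
    have hnorm : |∫ z in Z, (u z * fderiv ℝ ζ z (0, 1) - (0 * ζ z * ⟪F z, g z⟫
        + 1 * fderiv ℝ ζ z (F z, 0)))| ≤ ∫ z in Z, T * (η z.1 * ‖F z‖) := by
      rw [← Real.norm_eq_abs]
      refine norm_integral_le_of_norm_le (hηF.const_mul T) (ae_of_all _ fun z => ?_)
      have : u z * fderiv ℝ ζ z (0, 1) - (0 * ζ z * ⟪F z, g z⟫ + 1 * fderiv ℝ ζ z (F z, 0)) =
          -fderiv ℝ ζ z (F z, 0) := by rw [hfζ z (0, 1)]; simp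
      rw [this, norm_neg]; exact hfT z
    refine hnorm.trans ?_
    rw [integral_const_mul]
    have hd3 : d ^ (-3 : ℝ) = d ^ (-2 : ℝ) * d⁻¹ := by
      rw [← Real.rpow_neg_one, ← Real.rpow_add hd0]; norm_num
    calc T * ∫ z in Z, η z.1 * ‖F z‖ ≤ T * ((M₁ + M₂ + C * (c + 2) + 1) * d ^ (-2 : ℝ) * Θ) := by
          gcongr
      _ = _ := by rw [hd3, hT]; ring
  intro t₁ ht₁ t₂ ht₂
  -- The bound is on an absolute value, so the order of the times is immaterial. This is what allows
  -- comparison with the smallest mass over the whole interval.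
  have hb : |(∫ x, u (x, t₂) * ζ (x, t₂)) - ∫ x, u (x, t₁) * ζ (x, t₁)| ≤
        T₀ * (M₁ + M₂ + C * (c + 2) + 1) * d ^ (-3 : ℝ) *
          (S ^ (1 - (q - a) / 2) + √R * S ^ (1 - q)) := by
    rcases le_total t₁ t₂ with ht | ht
    · exact main t₁ ht₁ t₂ ht₂ ht
    · rw [abs_sub_comm]; exact main t₂ ht₂ t₁ ht₁ ht
  have h1 := hlow t₂
  have h2 := (hupp t₁).trans (h.setIntegral_slice_mono (show r' ≤ 4 by linarith) t₁)
  have h3 := (le_abs_self _).trans hb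
  linarith

end

/-! ### The Harnack inequality in L¹. -/

noncomputable section

theorem BoxSolution.setIntegral_slice_le {n : ℕ} {K : ℝ} {u : SpaceTime n → ℝ}
    {F g : SpaceTime n → Space n} (h : BoxSolution K u F g) (r τ : ℝ) :
    ∫ x in Metric.ball 0 r, u (x, τ) ≤ K * volume.real (Metric.ball (0 : Space n) r) := by
  calc _ ≤ ∫ x in Metric.ball (0 : Space n) r, K :=
        integral_mono (h.integrable_slice_u τ).integrableOn
          (integrableOn_const Metric.isBounded_ball.measure_lt_top.ne) fun x => (h.u_mem _).2
    _ = _ := by rw [setIntegral_const, smul_eq_mul, mul_comm]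

/-- Harnack inequality in the topology of `L¹`. -/
theorem exists_mass_le_mass (n : ℕ) {q C : ℝ} (hq : 0 < q) (hq1 : q < 1) (hC : 0 < C) :
    ∃ γ : ℝ, 0 < γ ∧ ∀ {K R ε : ℝ} {u : SpaceTime n → ℝ} {F g : SpaceTime n → Space n},
      BoxSolution K u F g → FluxBounds q C R ε u F g → 0 < ε → 1 ≤ R →
      ∀ τ₁ ∈ goodTimes u, ∀ τ₂ ∈ goodTimes u, ∫ x in Metric.ball 0 2, u (x, τ₂) ≤
        γ * ((∫ x in Metric.ball 0 4, u (x, τ₁)) + R ^ (1 / (2 * q))) := by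
  -- Both a < q and a + q < 1 are needed, so that the exponents 1 - q - a, 1 - q and 1 - q + a all
  -- lie between 0 and 1.
  set a := min q (1 - q) / 2 with ha
  have ha0 : 0 < a := by
    have : 0 < min q (1 - q) := lt_min hq (by linarith)
    linarith
  have haq : a < q := by have := min_le_left q (1 - q); linarith
  have haq1 : a + q < 1 := by have := min_le_right q (1 - q); linarith
  obtain ⟨A, hA, hmass⟩ := exists_mass_le_add n hq hC ha0 haq haq1
  set s := (q - a) / 2 with hs
  have hs0 : 0 < s := by linarith
  have hs1 : s < 1 := by linarith
  have hsq : s ≤ q := by linarith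
  -- Young's inequality turns d^{-3} against a power 1 - s into d^{-3/s}; as s ≤ q and d ≤ 1, this
  -- also covers d^{-3/q}. The two sublinear terms each give back δ f, hence the requirement on 2δ.
  set b := 3 / s with hb
  set δ := (2 : ℝ) ^ (-b) / 4 with hδ
  have hδ0 : 0 < δ := by positivity
  have hb0 : 0 < b := by positivity
  have hδb : 2 * δ * 2 ^ b = 1 / 2 := by
    rw [hδ, Real.rpow_neg (by norm_num)]
    have : (2 : ℝ) ^ b ≠ 0 := by positivity
    field_simp; norm_num
  have hδ1 : 2 * δ < 1 := by
    have : (2 : ℝ) ^ (-b) ≤ 1 := Real.rpow_le_one_of_one_le_of_nonpos (by norm_num) (by linarith)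
    linarith
  set D₁ := δ ^ (-(1 - s) / s) * A ^ (1 / s) with hD₁
  set D₂ := δ ^ (-(1 - q) / q) * A ^ (1 / q) with hD₂
  refine ⟨2 * 2 ^ b * (1 + D₁ + D₂), by positivity, ?_⟩
  intro K R ε u F g h hF hε hR τ₁ hτ₁ τ₂ hτ₂
  set I := ∫ x in Metric.ball 0 4, u (x, τ₁) with hI
  have hI0 : 0 ≤ I := integral_nonneg fun x => (h.u_mem _).1
  -- The supremum is over all good times at once, which the two-sided bound permits; adding 1
  -- secures S ≥ 1. The bound K on u enters only to make it finite.
  set f : ℝ → ℝ := fun r => 1 + sSup ((fun τ => ∫ x in Metric.ball 0 r, u (x, τ)) '' goodTimes u)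
    with hf
  have hne : ∀ r : ℝ, ((fun τ => ∫ x in Metric.ball 0 r, u (x, τ)) '' goodTimes u).Nonempty :=
    fun r => ⟨_, mem_image_of_mem _ hτ₁⟩
  have hbdd : ∀ r : ℝ, BddAbove ((fun τ => ∫ x in Metric.ball 0 r, u (x, τ)) '' goodTimes u) :=
    fun r => ⟨_, forall_mem_image.2 fun τ _ => h.setIntegral_slice_le r τ⟩
  have hle : ∀ r, ∀ τ ∈ goodTimes u, 1 + ∫ x in Metric.ball 0 r, u (x, τ) ≤ f r := fun r τ hτ =>
    add_le_add le_rfl (le_csSup (hbdd r) (mem_image_of_mem _ hτ))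
  have hf1 : ∀ r, 1 ≤ f r := fun r => by
    have h1 := hle r τ₁ hτ₁
    have : 0 ≤ ∫ x in Metric.ball 0 r, u (x, τ₁) := integral_nonneg fun x => (h.u_mem _).1
    linarith
  have hRq : 1 ≤ R ^ (1 / (2 * q)) := Real.one_le_rpow hR (by positivity)
  set A' := 1 + I + D₁ + D₂ * R ^ (1 / (2 * q)) with hA'
  have key := absorb_of_forall_lt (f := f) (r₀ := 2) (r₁ := 3)
    (S := 1 + K * volume.real (Metric.ball (0 : Space n) 3)) (A := A') (b := b) (δ := 2 * δ)
    (by norm_num) (by positivity) (by positivity) hδb.le hδ1 (fun r hr => ?_) ?_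
  · have h1 := hle 2 τ₂ hτ₂
    have e : (3 - 2 : ℝ) ^ (-b) = 1 := by norm_num
    rw [e, mul_one] at key
    calc _ ≤ 2 * 2 ^ b * A' := by linarith
      _ ≤ 2 * 2 ^ b * ((1 + D₁ + D₂) * (I + R ^ (1 / (2 * q)))) := by
        gcongr
        have k1 := mul_nonneg (show 0 ≤ D₁ + D₂ by positivity) hI0
        have k2 := mul_le_mul_of_nonneg_left hRq (show 0 ≤ 1 + D₁ by positivity)
        linarith
      _ = _ := by ring
  · refine add_le_add le_rfl (csSup_le (hne r) (forall_mem_image.2 fun τ hτ => ?_))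
    have hK : 0 ≤ K := (h.u_mem 0).1.trans (h.u_mem 0).2
    refine (h.setIntegral_slice_le r τ).trans (mul_le_mul_of_nonneg_left ?_ hK)
    exact measureReal_mono (Metric.ball_subset_ball hr.2) Metric.isBounded_ball.measure_lt_top.ne
  · intro r r' hr hrr' hr'
    set d := r' - r with hd
    have hd0 : 0 < d := by linarith
    have hd1 : d ≤ 1 := by linarith
    have hS := hf1 r'
    have hstep := hmass h hF hε hR hr hrr' hr' hS
      (fun τ hτ => by have := hle r' τ hτ; linarith) τ₁ hτ₁
    have y1 := mul_rpow_le_add (x := f r') (y := A * d ^ (-3 : ℝ)) (by linarith) (by positivity)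
      hs0 hs1 hδ0
    have y2 := mul_rpow_le_add (x := f r') (y := A * d ^ (-3 : ℝ) * √R) (by linarith)
      (by positivity) hq hq1 hδ0
    have e1 : δ ^ (-(1 - s) / s) * (A * d ^ (-3 : ℝ)) ^ (1 / s) = D₁ * d ^ (-b) := by
      rw [Real.mul_rpow hA.le (by positivity), ← Real.rpow_mul hd0.le, hD₁, hb]; ring_nf
    have e2 : δ ^ (-(1 - q) / q) * (A * d ^ (-3 : ℝ) * √R) ^ (1 / q) ≤
        D₂ * R ^ (1 / (2 * q)) * d ^ (-b) := by
      -- Origin of the inhomogeneous term R^{1/(2q)}: Young's inequality applied to √R S^{1-q}.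
      have e3 : (√R) ^ (1 / q) = R ^ (1 / (2 * q)) := by
        rw [Real.sqrt_eq_rpow, ← Real.rpow_mul (by linarith)]; congr 1; field_simp
      have e4 : d ^ (-3 * (1 / q)) ≤ d ^ (-b) := by
        refine Real.rpow_le_rpow_of_exponent_ge hd0 hd1 ?_
        have : 3 / q ≤ 3 / s := by gcongr
        rw [hb]; linarith [show -3 * (1 / q) = -(3 / q) by ring]
      rw [Real.mul_rpow (by positivity) (by positivity), Real.mul_rpow hA.le (by positivity),
        ← Real.rpow_mul hd0.le, e3]
      calc _ = D₂ * R ^ (1 / (2 * q)) * d ^ (-3 * (1 / q)) := by rw [hD₂]; ring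
        _ ≤ _ := by gcongr
    have hdb : 1 ≤ d ^ (-b) :=
      Real.one_le_rpow_of_pos_of_le_one_of_nonpos hd0 hd1 (by linarith)
    have hIb : 1 + I ≤ (1 + I) * d ^ (-b) := le_mul_of_one_le_right (by linarith) hdb
    have hsup : f r ≤ 1 + (I + A * d ^ (-3 : ℝ) *
        (f r' ^ (1 - (q - a) / 2) + √R * f r' ^ (1 - q))) :=
      add_le_add le_rfl (csSup_le (hne r) (forall_mem_image.2 fun τ hτ => hstep τ hτ))
    rw [← hs] at hsup
    rw [e1] at y1
    calc f r ≤ _ := hsup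
      _ = 1 + I + A * d ^ (-3 : ℝ) * f r' ^ (1 - s) + A * d ^ (-3 : ℝ) * √R * f r' ^ (1 - q) := by
        ring
      _ ≤ (1 + I) * d ^ (-b) + (δ * f r' + D₁ * d ^ (-b))
          + (δ * f r' + D₂ * R ^ (1 / (2 * q)) * d ^ (-b)) := by linarith
      _ = _ := by rw [hA']; ring

end

/-! ### Parabolic cutoffs, truncations and the Caccioppoli inequality. -/

noncomputable section

theorem BoxSolution.exists_goodTime {n : ℕ} {K : ℝ} {u : SpaceTime n → ℝ}
    {F g : SpaceTime n → Space n} (h : BoxSolution K u F g) {a b : ℝ} (ha : -1 ≤ a) (hab : a < b)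
    (hb : b ≤ 1) : ∃ τ ∈ goodTimes u, τ ∈ Ioo a b := by
  by_contra! hcon
  have h1 : ∀ᵐ τ : ℝ, τ ∉ Ioo a b := by
    filter_upwards [h.ae_mem_goodTimes] with τ hτ hmem
    exact hcon τ (hτ ⟨by linarith [hmem.1], by linarith [hmem.2]⟩) hmem
  have h2 : volume (Ioo a b) = 0 := measure_eq_zero_iff_ae_notMem.2 h1
  rw [Real.volume_Ioo, ENNReal.ofReal_eq_zero] at h2
  linarith

/-- A single parameter r governs both radius and initial time -(r - 1)/2, which is 0 for r = 1 and
-1/2 for r = 2. The time gap is half the radius gap, hence the factor 2 on the constant for time. -/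
theorem exists_parabolic_cutoff (n : ℕ) : ∃ C : ℝ, 0 < C ∧ ∀ r r' : ℝ, 0 < r → r < r' →
    ∃ ζ : SpaceTime n → ℝ, ContDiff ℝ ∞ ζ ∧ (∀ z, ζ z ∈ Icc (0 : ℝ) 1) ∧
      (∀ z, ‖z.1‖ ≤ r → -(r - 1) / 2 ≤ z.2 → ζ z = 1) ∧
      (∀ z, ζ z ≠ 0 → ‖z.1‖ < r' ∧ -(r' - 1) / 2 < z.2) ∧
      ∀ z, ‖fderiv ℝ ζ z‖ ≤ C / (r' - r) := by
  obtain ⟨C₁, hC₁, h₁⟩ := exists_space_cutoff n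
  obtain ⟨C₂, hC₂, h₂⟩ := exists_time_cutoff
  refine ⟨C₁ + 2 * C₂, by positivity, fun r r' hr hrr' => ?_⟩
  obtain ⟨η, hη, hη01, hη1, hη0, hηd⟩ := h₁ r r' hr hrr'
  obtain ⟨χ, hχ, hχ01, hχ0, hχ1, hχd⟩ := h₂ (-(r' - 1) / 2) (-(r - 1) / 2) (by linarith)
  refine ⟨fun z => η z.1 * χ z.2, (hη.comp contDiff_fst).mul (hχ.comp contDiff_snd),
    fun z => ⟨mul_nonneg (hη01 _).1 (hχ01 _).1, mul_le_one₀ (hη01 _).2 (hχ01 _).1 (hχ01 _).2⟩,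
    fun z h1 h2 => by simp only [hη1 _ h1, hχ1 _ h2, one_mul], fun z hz => ⟨?_, ?_⟩, fun z => ?_⟩
  · by_contra! hcon; exact hz (by simp only [hη0 _ hcon, zero_mul])
  · by_contra! hcon; exact hz (by simp only [hχ0 _ hcon, mul_zero])
  · have d1 : HasFDerivAt (fun z : SpaceTime n => η z.1)
        ((fderiv ℝ η z.1).comp (ContinuousLinearMap.fst ℝ (Space n) ℝ)) z :=
      ((hη.differentiable (by simp) z.1).hasFDerivAt).comp z hasFDerivAt_fst
    have d2 : HasFDerivAt (fun z : SpaceTime n => χ z.2)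
        ((fderiv ℝ χ z.2).comp (ContinuousLinearMap.snd ℝ (Space n) ℝ)) z :=
      ((hχ.differentiable (by simp) z.2).hasFDerivAt).comp z hasFDerivAt_snd
    have hd : 0 < r' - r := by linarith
    have n1 : ‖(fderiv ℝ η z.1).comp (ContinuousLinearMap.fst ℝ (Space n) ℝ)‖ ≤ C₁ / (r' - r) := by
      refine (ContinuousLinearMap.opNorm_comp_le _ _).trans ?_
      exact (mul_le_of_le_one_right (norm_nonneg _) (ContinuousLinearMap.norm_fst_le _ _ _)).trans
        (hηd _)
    have n2 : ‖(fderiv ℝ χ z.2).comp (ContinuousLinearMap.snd ℝ (Space n) ℝ)‖ ≤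
        2 * C₂ / (r' - r) := by
      refine (ContinuousLinearMap.opNorm_comp_le _ _).trans ?_
      refine (mul_le_of_le_one_right (norm_nonneg _)
        (ContinuousLinearMap.norm_snd_le _ _ _)).trans ?_
      rw [← norm_deriv_eq_norm_fderiv]
      refine (hχd _).trans (le_of_eq ?_)
      rw [div_eq_div_iff (by linarith) hd.ne']; ring
    have e := (d1.mul d2).fderiv
    change fderiv ℝ (fun z : SpaceTime n => η z.1 * χ z.2) z = _ at e
    rw [e]
    refine (norm_add_le _ _).trans ?_
    rw [norm_smul, norm_smul, Real.norm_of_nonneg (hη01 _).1, Real.norm_of_nonneg (hχ01 _).1,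
      add_div, add_comm]
    exact add_le_add ((mul_le_of_le_one_left (norm_nonneg _) (hχ01 _).2).trans n1)
      ((mul_le_of_le_one_left (norm_nonneg _) (hη01 _).2).trans n2)

/-- The truncation `(x - k)₊`. -/
def trunc (k x : ℝ) : ℝ := max (x - k) 0

section trunc
variable {k k' x s : ℝ}

theorem trunc_nonneg : 0 ≤ trunc k x := le_max_right _ _

theorem continuous_trunc (k : ℝ) : Continuous (trunc k) := by unfold trunc; fun_prop

theorem trunc_of_le (h : k ≤ x) : trunc k x = x - k := max_eq_left (by linarith)

theorem trunc_of_ge (h : x ≤ k) : trunc k x = 0 := max_eq_right (by linarith)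

theorem trunc_anti (h : k ≤ k') : trunc k' x ≤ trunc k x := max_le_max (by linarith) le_rfl

theorem trunc_le (hk : 0 ≤ k) (hx : 0 ≤ x) : trunc k x ≤ x := max_le (by linarith) hx

theorem lt_of_trunc_ne_zero (h : trunc k x ≠ 0) : k < x := by
  by_contra! hc; exact h (trunc_of_ge hc)

/-- For s > 1 the one-sided derivatives at the corner x = k are both 0 and glue together. -/
theorem hasDerivAt_trunc_rpow (hs : 1 < s) (k x : ℝ) :
    HasDerivAt (fun x => trunc k x ^ s) (s * trunc k x ^ (s - 1)) x := by
  have hc : ∀ x, HasDerivAt (fun x => (x - k) ^ s) (s * (x - k) ^ (s - 1)) x := fun x => by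
    have := ((hasDerivAt_id x).sub_const k).rpow_const (p := s) (Or.inr hs.le)
    simpa using this
  have hz : ∀ x, x ≤ k → trunc k x ^ s = 0 := fun x hx => by
    rw [trunc_of_ge hx, Real.zero_rpow (by linarith)]
  have hz' : ∀ x, x ≤ k → s * trunc k x ^ (s - 1) = 0 := fun x hx => by
    rw [trunc_of_ge hx, Real.zero_rpow (by linarith), mul_zero]
  rcases lt_trichotomy x k with hx | rfl | hx
  · rw [hz' x hx.le]
    refine (hasDerivAt_const x (0 : ℝ)).congr_of_eventuallyEq ?_
    filter_upwards [Iio_mem_nhds hx] with y hy using hz y (le_of_lt hy)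
  · rw [hz' x le_rfl]
    have h1 : HasDerivWithinAt (fun y => trunc x y ^ s) 0 (Iic x) x :=
      (hasDerivWithinAt_const x _ (0 : ℝ)).congr (fun y hy => hz y hy) (hz x le_rfl)
    have h2 : HasDerivWithinAt (fun y => trunc x y ^ s) 0 (Ici x) x := by
      have h3 := (hc x).hasDerivWithinAt (s := Ici x)
      rw [sub_self, Real.zero_rpow (by linarith), mul_zero] at h3
      exact h3.congr (fun y hy => by rw [trunc_of_le hy]) (by rw [trunc_of_le le_rfl])
    have := h1.union h2
    rwa [Iic_union_Ici, hasDerivWithinAt_univ] at this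
  · rw [trunc_of_le hx.le]
    refine (hc x).congr_of_eventuallyEq ?_
    filter_upwards [Ioi_mem_nhds hx] with y hy
    rw [trunc_of_le (le_of_lt hy)]

/-- The cube is the first integer power of the truncation whose second derivative is continuous, as
the energy identity demands. Its energy weight (u - k)₊ matches the squared gradient of (u -
k)₊^{3/2}. -/
theorem isNonlinearity_trunc_cube (k : ℝ) :
    IsNonlinearity (fun x => trunc k x ^ 3) (fun x => 3 * trunc k x ^ 2)
      (fun x => 6 * trunc k x) where
  deriv₁ x _ := by
    have := hasDerivAt_trunc_rpow (s := 3) (by norm_num) k x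
    norm_num at this
    exact this
  deriv₂ x _ := by
    have := (hasDerivAt_trunc_rpow (s := 2) (by norm_num) k x).const_mul 3
    norm_num at this
    have e : 6 * trunc k x = 3 * (2 * trunc k x) := by ring
    rwa [← e] at this
  cont := (continuous_const.mul (continuous_trunc k)).continuousOn

/-- The quotient x/(x - k) decreases for x > k, so its largest value beyond k' is at k'. It turns
lower order terms in u into powers of the truncation at the lower level. -/
theorem le_mul_trunc (hk : 0 ≤ k) (hkk' : k < k') (hx : k' ≤ x) :
    x ≤ k' / (k' - k) * trunc k x := by
  rw [trunc_of_le (hkk'.le.trans hx), div_mul_eq_mul_div, le_div_iff₀ (by linarith)]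
  nlinarith

end trunc

/-- The pointwise estimate behind the energy inequality for truncations. -/
theorem truncation_energy_le {q C R T w V u E ζ D₀ D₁ N I : ℝ} (hq : 0 < q) (hq1 : q < 1)
    (hC : 0 < C) (hR : 1 ≤ R) (hT : 1 ≤ T) (hw : 0 ≤ w) (hwu : w ≤ u) (hu : 1 ≤ u) (huV : u ≤ V)
    (hE : 0 ≤ E) (hI : E = I + C * R * u ^ (2 - q)) (hζ : ζ ∈ Icc (0 : ℝ) 1)
    (hD₀ : |D₀| ≤ 2 * T) (hD₁ : |D₁| ≤ 2 * ζ * T * N)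
    (hN : N ≤ C * (u ^ (-q / 2) * √E + √R * u ^ (1 - q))) :
    w ^ 3 * D₀ - (6 * w * ζ ^ 2 * I + 3 * w ^ 2 * D₁) + 3 * (w * ζ ^ 2 * E) ≤
      (2 + 12 * C + 3 * C ^ 2) * (R * T ^ 2 * (w * V ^ 2)) := by
  have hV : 0 < V := by linarith
  have hζ0 := hζ.1
  have hζ1 : ζ ^ 2 ≤ 1 := pow_le_one₀ hζ.1 hζ.2
  have hT2 : T ≤ T ^ 2 := by nlinarith
  have hT21 : 1 ≤ T ^ 2 := by nlinarith
  have hwV : w ≤ V := hwu.trans huV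
  have hw2 : w ^ 2 ≤ V ^ 2 := by gcongr
  have t1 : w ^ 3 * D₀ ≤ 2 * (R * T ^ 2 * (w * V ^ 2)) := by
    calc w ^ 3 * D₀ ≤ w ^ 3 * (2 * T) := by gcongr; exact (le_abs_self _).trans hD₀
      _ = 2 * (1 * T * (w * w ^ 2)) := by ring
      _ ≤ _ := by gcongr
  have t2 : 6 * w * ζ ^ 2 * (C * R * u ^ (2 - q)) ≤ 6 * C * (R * T ^ 2 * (w * V ^ 2)) := by
    have e : u ^ (2 - q) ≤ V ^ 2 := by
      calc u ^ (2 - q) ≤ u ^ (2 : ℝ) := Real.rpow_le_rpow_of_exponent_le hu (by linarith)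
        _ = u ^ 2 := by norm_cast
        _ ≤ _ := by gcongr
    calc _ ≤ 6 * w * 1 * (C * R * V ^ 2) := by gcongr
      _ = 6 * C * (R * 1 * (w * V ^ 2)) := by ring
      _ ≤ _ := by gcongr
  -- Levels are kept at least 1 for this reason: there the singular factor is bounded.
  have huq : u ^ (-q / 2) ≤ 1 := Real.rpow_le_one_of_one_le_of_nonpos hu (by linarith)
  have hu1q : u ^ (1 - q) ≤ V := by
    calc u ^ (1 - q) ≤ u ^ (1 : ℝ) := Real.rpow_le_rpow_of_exponent_le hu (by linarith)
      _ ≤ _ := by rw [Real.rpow_one]; exact huV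
  have hRs : √R ≤ R := by
    rw [Real.sqrt_le_left (by linarith)]; nlinarith
  have hN' : N ≤ C * (√E + R * V) := by
    refine hN.trans ?_
    have := mul_le_of_le_one_left (Real.sqrt_nonneg E) huq
    gcongr
  have t3 : -(3 * w ^ 2 * D₁) ≤ 3 * (w * ζ ^ 2 * E) +
      (6 * C + 3 * C ^ 2) * (R * T ^ 2 * (w * V ^ 2)) := by
    have a1 : -(3 * w ^ 2 * D₁) ≤ 3 * w ^ 2 * (2 * ζ * T * (C * (√E + R * V))) := by
      have : -D₁ ≤ 2 * ζ * T * (C * (√E + R * V)) :=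
        (neg_le_abs _).trans (hD₁.trans (by gcongr))
      nlinarith [sq_nonneg w]
    -- Completing the square spends half of the 6wζ²E produced by the second derivative; the other
    -- half remains on the left of the energy inequality.
    have a2 : 6 * w * ((ζ * √E) * (w * T * C)) ≤ 3 * (w * ζ ^ 2 * E)
        + 3 * C ^ 2 * (1 * T ^ 2 * (w * w ^ 2)) := by
      have := Real.sq_sqrt hE
      have k : 0 ≤ w * (ζ * √E - w * T * C) ^ 2 := by positivity
      have k' : w * (ζ * √E - w * T * C) ^ 2 =
          w * ζ ^ 2 * √E ^ 2 - 2 * (w * (ζ * √E * (w * T * C))) +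
              C ^ 2 * (1 * T ^ 2 * (w * w ^ 2)) := by
        ring
      rw [this] at k'
      linarith
    have a3 : 3 * C ^ 2 * (1 * T ^ 2 * (w * w ^ 2)) ≤ 3 * C ^ 2 * (R * T ^ 2 * (w * V ^ 2)) := by
      gcongr
    have a4 : 6 * C * (R * (ζ * T) * (w * (w * V))) ≤ 6 * C * (R * T ^ 2 * (w * V ^ 2)) := by
      have : ζ * T ≤ T ^ 2 := (mul_le_of_le_one_left (by linarith) hζ.2).trans hT2
      have : w * V ≤ V ^ 2 := by nlinarith
      gcongr
    linarith
  have hI' : I = E - C * R * u ^ (2 - q) := by linarith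
  rw [hI']
  linarith

/-- The energy (Caccioppoli) inequality for truncations. -/
theorem exists_caccioppoli (n : ℕ) {q C : ℝ} (hq : 0 < q) (hq1 : q < 1) (hC : 0 < C) :
    ∃ B : ℝ, 0 < B ∧ ∀ {K R ε T r a s τ k k' : ℝ} {u ζ : SpaceTime n → ℝ}
      {F g : SpaceTime n → Space n}, BoxSolution K u F g → FluxBounds q C R ε u F g → 0 < ε →
      1 ≤ R → 1 ≤ T → r ≤ 3 → ContDiff ℝ ∞ ζ → (∀ z, ζ z ∈ Icc (0 : ℝ) 1) →
      (∀ z, ζ z ≠ 0 → ‖z.1‖ < r ∧ s < z.2) → (∀ z, ‖fderiv ℝ ζ z‖ ≤ T) →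
      a ∈ goodTimes u → τ ∈ goodTimes u → a ≤ s → a ≤ τ → 1 ≤ k → k < k' →
      (∫ x, trunc k' (u (x, τ)) ^ 3 * ζ (x, τ) ^ 2) +
        3 * ∫ z in Metric.ball 0 r ×ˢ Ioc s τ,
          trunc k' (u z) * (ζ z ^ 2 * energyDensity q C R u F g z) ≤
      B * (R * T ^ 2 * (k' / (k' - k)) ^ 2) *
        ∫ z in Metric.ball 0 r ×ˢ Ioc s τ, trunc k (u z) ^ 3 := by
  refine ⟨2 + 12 * C + 3 * C ^ 2, by positivity, ?_⟩
  intro K R ε T r a s τ k k' u ζ F g h hF hε hR hT hr hζ hζ01 hζs hζd ha hτ has haτ hk hkk'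
  set Z : Set (SpaceTime n) := Metric.ball 0 r ×ˢ Ioc s τ with hZ
  have hZf : volume Z < ⊤ := by
    rw [hZ, Measure.volume_eq_prod, Measure.prod_prod]
    exact ENNReal.mul_lt_top Metric.isBounded_ball.measure_lt_top (by simp)
  set ζ₂ : SpaceTime n → ℝ := fun z => ζ z ^ 2 with hζ₂
  have hζ₂c : ContDiff ℝ ∞ ζ₂ := hζ.pow 2
  have hζ₂0 : ∀ z, 3 < ‖z.1‖ → ζ₂ z = 0 := fun z hz => by
    by_contra hne
    have := (hζs z fun h0 => hne (by simp [hζ₂, h0])).1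
    linarith
  have hfζ : ∀ z w, fderiv ℝ ζ₂ z w = 2 * ζ z * fderiv ℝ ζ z w := fun z w => by
    rw [((hζ.differentiable (by simp) z).hasFDerivAt.pow 2).fderiv]; simp
  set E := energyDensity q C R u F g with hE
  have hE0 : ∀ᵐ z, 0 ≤ E z := by
    filter_upwards [hF.coercive] with z hz
    have : 0 ≤ C * E z := le_trans (by positivity) hz
    exact nonneg_of_mul_nonneg_right this hC
  have hid := h.energy_identity (isNonlinearity_trunc_cube k') hζ₂c hζ₂0 ha hτ haτ
  -- The starting time a need not be the time s where the cutoff begins, only a good time not after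
  -- it; the slice there is zero because ζ is.
  have hstart : ∫ x, trunc k' (u (x, a)) ^ 3 * ζ₂ (x, a) = 0 := by
    rw [← integral_zero (Space n) ℝ]
    congr 1; ext x
    have : ζ (x, a) = 0 := by
      by_contra hne; have := (hζs _ hne).2; simp only at this; linarith
    simp [hζ₂, this]
  rw [hstart, sub_zero, setIntegral_eq_of_subset_of_forall_sdiff_eq_zero measurableSet_slab
    (s := Z) (fun z hz => ⟨mem_univ _, lt_of_le_of_lt has hz.2.1, hz.2.2⟩) fun z hz => by
      have hz0 : ζ z = 0 := by
        by_contra hne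
        have := hζs z hne
        exact hz.2 ⟨by simpa using this.1, this.2, hz.1.2.2⟩
      have : ζ₂ z = 0 := by simp [hζ₂, hz0]
      simp [hfζ, hz0, this]] at hid
  change (∫ x, trunc k' (u (x, τ)) ^ 3 * ζ₂ (x, τ)) + _ ≤ _
  have hfD : ∀ z v, |fderiv ℝ ζ₂ z v| ≤ 2 * ζ z * T * ‖v‖ := fun z v => by
    rw [hfζ, abs_mul, abs_mul, abs_two, abs_of_nonneg (hζ01 z).1, mul_assoc _ T]
    have := (hζ01 z).1
    have := ((fderiv ℝ ζ z).le_opNorm v).trans (mul_le_mul_of_nonneg_right (hζd z) (norm_nonneg v))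
    gcongr
    exact this
  have hc3 : ContinuousOn (fun x => trunc k' x ^ 3) (Ici 0) :=
    ((continuous_trunc k').pow 3).continuousOn
  have hfm : ∀ G : SpaceTime n → SpaceTime n, Measurable G →
      Measurable fun z => fderiv ℝ ζ₂ z (G z) := fun G hG =>
    (hζ₂c.continuous_fderiv_apply (by simp)).measurable.comp (measurable_id.prodMk hG)
  have i0 : IntegrableOn (fun z => fderiv ℝ ζ₂ z (0, 1)) Z := by
    refine Measure.integrableOn_of_bounded (M := 2 * T) hZf.ne
      (hfm _ measurable_const).aestronglyMeasurable (ae_of_all _ fun z => ?_)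
    have h1 := hfD z (0, 1)
    have h2 : ‖((0 : Space n), (1 : ℝ))‖ = 1 := by simp [Prod.norm_def]
    rw [h2, mul_one] at h1
    rw [Real.norm_eq_abs]
    have := (hζ01 z).2
    exact h1.trans (by nlinarith)
  have i1 : IntegrableOn (fun z => fderiv ℝ ζ₂ z (F z, 0)) Z := by
    refine (h.F_int.norm.integrableOn.const_mul (2 * T)).mono'
      (hfm _ (h.F_meas.prodMk measurable_const)).aestronglyMeasurable (ae_of_all _ fun z => ?_)
    have h1 := hfD z (F z, 0)
    have h2 : ‖(F z, (0 : ℝ))‖ = ‖F z‖ := by simp [Prod.norm_def]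
    rw [h2] at h1
    refine h1.trans ?_
    have := (hζ01 z).2
    have := norm_nonneg (F z)
    have : 2 * ζ z * T ≤ 2 * T := by nlinarith
    gcongr
  have hζm : AEStronglyMeasurable ζ₂ (volume.restrict Z) := hζ₂c.continuous.aestronglyMeasurable
  have hζb : ∀ᵐ z ∂volume.restrict Z, ‖ζ₂ z‖ ≤ 1 := ae_of_all _ fun z => by
    rw [Real.norm_of_nonneg (sq_nonneg _)]; exact pow_le_one₀ (hζ01 z).1 (hζ01 z).2
  have i2 : IntegrableOn (fun z => trunc k' (u z) * (ζ₂ z * ⟪F z, g z⟫)) Z :=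
    h.integrable_comp_mul (continuous_trunc k').continuousOn
      (h.integrable_inner.integrableOn.bdd_mul hζm hζb)
  have i3 : IntegrableOn (fun z => trunc k' (u z) * (ζ₂ z * E z)) Z :=
    h.integrable_comp_mul (continuous_trunc k').continuousOn
      ((h.integrableOn_energyDensity (by linarith) hZf).bdd_mul hζm hζb)
  have i4 : IntegrableOn (fun z => trunc k' (u z) ^ 3 * fderiv ℝ ζ₂ z (0, 1)) Z :=
    h.integrable_comp_mul hc3 i0
  have i5 : IntegrableOn (fun z => 3 * trunc k' (u z) ^ 2 * fderiv ℝ ζ₂ z (F z, 0)) Z :=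
    h.integrable_comp_mul (f := fun x => 3 * trunc k' x ^ 2)
      (continuous_const.mul ((continuous_trunc k').pow 2)).continuousOn i1
  have i6 : IntegrableOn (fun z => 6 * trunc k' (u z) * ζ₂ z * ⟪F z, g z⟫) Z := by
    have := i2.const_mul 6
    refine this.congr (ae_of_all _ fun z => ?_)
    simp only []; ring
  have i7 : IntegrableOn (fun z => trunc k (u z) ^ 3) Z :=
    h.integrableOn_comp ((continuous_trunc k).pow 3).continuousOn hZf
  have i8 : IntegrableOn (fun z => trunc k' (u z) ^ 3 * fderiv ℝ ζ₂ z (0, 1)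
      - (6 * trunc k' (u z) * ζ₂ z * ⟪F z, g z⟫
        + 3 * trunc k' (u z) ^ 2 * fderiv ℝ ζ₂ z (F z, 0))) Z := i4.sub (i6.add i5)
  have hZ' : ∫ z in Z, trunc k' (u z) * (ζ z ^ 2 * E z) =
    ∫ z in Z, trunc k' (u z) * (ζ₂ z * E z) := rfl
  rw [hid, hZ', ← integral_const_mul, ← integral_const_mul, ← integral_add i8 (i3.const_mul _)]
  refine integral_mono_ae (i8.add (i3.const_mul _)) (i7.const_mul _) ?_
  filter_upwards [ae_restrict_of_ae hE0, ae_restrict_of_ae hF.growth] with z h1 h2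
  have hu0 := (h.u_mem z).1
  by_cases hw : trunc k' (u z) = 0
  · simp only [hw]
    have := trunc_nonneg (k := k) (x := u z)
    simp
    positivity
  have huk := lt_of_trunc_ne_zero hw
  have e := truncation_energy_le (D₀ := fderiv ℝ ζ₂ z (0, 1)) (D₁ := fderiv ℝ ζ₂ z (F z, 0))
    (w := trunc k' (u z)) (V := k' / (k' - k) * trunc k (u z)) hq hq1 hC hR hT
    trunc_nonneg (trunc_le (by linarith) hu0) (by linarith)
    (le_mul_trunc (by linarith) hkk' huk.le) h1 rfl (hζ01 z) ?_ ?_ h2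
  · have e2 : trunc k' (u z) * (k' / (k' - k) * trunc k (u z)) ^ 2 ≤
        (k' / (k' - k)) ^ 2 * trunc k (u z) ^ 3 := by
      have := trunc_anti (x := u z) hkk'.le
      calc _ = (k' / (k' - k)) ^ 2 * trunc k (u z) ^ 2 * trunc k' (u z) := by ring
        _ ≤ (k' / (k' - k)) ^ 2 * trunc k (u z) ^ 2 * trunc k (u z) := by gcongr
        _ = _ := by ring
    have e3 : (2 + 12 * C + 3 * C ^ 2) * (R * T ^ 2 *
        (trunc k' (u z) * (k' / (k' - k) * trunc k (u z)) ^ 2)) ≤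
        (2 + 12 * C + 3 * C ^ 2) * (R * T ^ 2 *
          ((k' / (k' - k)) ^ 2 * trunc k (u z) ^ 3)) := by gcongr
    simp only [hζ₂]
    simp only [hζ₂] at e
    rw [← hζ₂] at e ⊢
    linarith
  · refine (hfD z _).trans ?_
    have h2 : ‖((0 : Space n), (1 : ℝ))‖ = 1 := by simp [Prod.norm_def]
    rw [h2]; have := (hζ01 z).2; nlinarith
  · refine (hfD z _).trans (le_of_eq ?_)
    have h2 : ‖(F z, (0 : ℝ))‖ = ‖F z‖ := by simp [Prod.norm_def]
    rw [h2]

end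

/-! ### One step of De Giorgi's iteration. -/

noncomputable section

/-- The cylinder `B_r × (-(r - 1) / 2, b]`. -/
def innerCyl (n : ℕ) (r b : ℝ) : Set (SpaceTime n) := Metric.ball 0 r ×ˢ Ioc (-(r - 1) / 2) b

theorem measurableSet_innerCyl {n : ℕ} {r b : ℝ} : MeasurableSet (innerCyl n r b) :=
  measurableSet_ball.prod measurableSet_Ioc

theorem innerCyl_subset {n : ℕ} {r r' b b' : ℝ} (h : r ≤ r') (hb : b ≤ b') :
    innerCyl n r b ⊆ innerCyl n r' b' :=
  prod_mono (Metric.ball_subset_ball h) (Ioc_subset_Ioc (by linarith) hb)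

theorem volume_innerCyl_lt_top {n : ℕ} {r b : ℝ} : volume (innerCyl n r b) < ⊤ := by
  rw [innerCyl, Measure.volume_eq_prod, Measure.prod_prod]
  exact ENNReal.mul_lt_top Metric.isBounded_ball.measure_lt_top (by simp)

namespace BoxSolution
variable {n : ℕ} {K : ℝ} {u : SpaceTime n → ℝ} {F g : SpaceTime n → Space n}

theorem integrableOn_trunc_cube (h : BoxSolution K u F g) (k r b : ℝ) :
    IntegrableOn (fun z => trunc k (u z) ^ 3) (innerCyl n r b) :=
  h.integrableOn_comp ((continuous_trunc k).pow 3).continuousOn volume_innerCyl_lt_top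

theorem setIntegral_trunc_mono (h : BoxSolution K u F g) {k k' r r' b b' : ℝ} (hk : k' ≤ k)
    (hr : r ≤ r') (hb : b ≤ b') : ∫ z in innerCyl n r b, trunc k (u z) ^ 3 ≤
      ∫ z in innerCyl n r' b', trunc k' (u z) ^ 3 :=
  calc _ ≤ ∫ z in innerCyl n r b, trunc k' (u z) ^ 3 :=
        integral_mono (h.integrableOn_trunc_cube k r b) (h.integrableOn_trunc_cube k' r b)
          fun _ => pow_le_pow_left₀ trunc_nonneg (trunc_anti hk) 3
    _ ≤ _ := setIntegral_mono_set (h.integrableOn_trunc_cube k' r' b')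
          (ae_of_all _ fun _ => pow_nonneg trunc_nonneg 3) (innerCyl_subset hr hb).eventuallyLE

end BoxSolution

set_option maxHeartbeats 1000000 in
/-- One step of De Giorgi's iteration. -/
theorem exists_truncation_step (n : ℕ) (hn : 2 ≤ n) {q C : ℝ} (hq : 0 < q) (hq1 : q < 1)
    (hC : 0 < C) : ∃ A : ℝ, 0 < A ∧
    ∀ {K R ε r r' b k k' : ℝ} {u : SpaceTime n → ℝ} {F g : SpaceTime n → Space n},
      BoxSolution K u F g → FluxBounds q C R ε u F g → 0 < ε → ε ≤ 1 → 1 ≤ R → 1 ≤ r → r < r' →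
      r' ≤ 2 → b ∈ goodTimes u → 0 < b → 1 ≤ k → k < k' →
      ∫ z in innerCyl n r b, trunc k' (u z) ^ 3 ≤
        A * (1 / (r' - r)) ^ 4 * (k' / (k' - k)) ^ 7 *
          (R * (R / ε) ^ (n / 2 : ℝ) / k' ^ 3 * ∫ z in innerCyl n r' b, trunc k (u z) ^ 3)
            ^ (2 / n : ℝ) * ∫ z in innerCyl n r' b, trunc k (u z) ^ 3 := by
  obtain ⟨B, hB, hcac⟩ := exists_caccioppoli n hq hq1 hC
  obtain ⟨C₀, hC₀, hcut⟩ := exists_parabolic_cutoff n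
  obtain ⟨C₁, hC₁, hfk⟩ := exists_faberKrahn_slab n hn
  set c := 2 * C₀ + 2 with hc
  refine ⟨C₁ * (32 * B * c ^ 2) ^ (2 / n : ℝ) * c ^ 2 * (3 * C * B / 2 + 2), by positivity, ?_⟩
  intro K R ε r r' b k k' u F g h hF hε hε1 hR hr hrr' hr' hb hb0 hk hkk'
  -- Cylinders with r' ≤ 2 begin at -1/2 or later, so one good time before -1/2 starts every energy
  -- inequality.
  obtain ⟨a, ha, ha1, ha2⟩ := h.exists_goodTime (a := -1) (b := -1 / 2) le_rfl (by norm_num)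
    (by norm_num)
  set d := r' - r with hd
  have hd0 : 0 < d := by linarith
  -- The energy inequality is used twice. Between rm and r', and up to the middle level km, it
  -- bounds slices and so the measure of {u > k'}; between r and rm, at the level k', it bounds the
  -- gradient.
  set rm := (r + r') / 2 with hrm
  set km := (k + k') / 2 with hkm
  set T := c / d with hT
  have hT1 : 1 ≤ T := by rw [hT, le_div_iff₀ hd0]; linarith
  set H := k' / (k' - k) with hH
  have hk'k : 0 < k' - k := by linarith
  have hk'0 : 0 < k' := by linarith
  have hH1 : 1 ≤ H := by rw [hH, le_div_iff₀ hk'k]; linarith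
  set X := ∫ z in innerCyl n r' b, trunc k (u z) ^ 3 with hX
  have hX0 : 0 ≤ X := integral_nonneg fun _ => pow_nonneg trunc_nonneg 3
  obtain ⟨ζ, hζ, hζ01, hζ1, hζs, hζd⟩ := hcut r rm (by linarith) (by linarith)
  obtain ⟨ξ, hξ, hξ01, hξ1, hξs, hξd⟩ := hcut rm r' (by linarith) (by linarith)
  have hTd : C₀ / (d / 2) ≤ T := by
    rw [hT, div_le_div_iff₀ (by positivity) hd0]; nlinarith
  have hζT : ∀ z, ‖fderiv ℝ ζ z‖ ≤ T := fun z => (hζd z).trans (by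
    rwa [show rm - r = d / 2 by rw [hrm, hd]; ring])
  have hξT : ∀ z, ‖fderiv ℝ ξ z‖ ≤ T := fun z => (hξd z).trans (by
    rwa [show r' - rm = d / 2 by rw [hrm, hd]; ring])
  -- the slice bound
  set P := 32 * B * (R * T ^ 2 * H ^ 5 / k' ^ 3 * X) with hP
  have hP0 : 0 ≤ P := by positivity
  have hslice : ∀ τ ∈ goodTimes u, τ ∈ Ioc a b →
      ∫ x, (fun v => (trunc km v / (k' - km)) ^ 3) (u (x, τ)) * (fun z => ξ z ^ 2) (x, τ) ≤ P := by
    intro τ hτ hτab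
    have e1 := hcac (k := k) (k' := km) (s := -(r' - 1) / 2) h hF hε hR hT1 (by linarith) hξ hξ01
      hξs hξT ha hτ (by linarith) hτab.1.le hk (by linarith)
    have hE : 0 ≤ ∫ z in Metric.ball 0 r' ×ˢ Ioc (-(r' - 1) / 2) τ,
        trunc km (u z) * (ξ z ^ 2 * energyDensity q C R u F g z) := by
      refine integral_nonneg_of_ae (ae_restrict_of_ae ?_)
      filter_upwards [hF.coercive] with z hz
      have : 0 ≤ C * energyDensity q C R u F g z := le_trans (by positivity) hz
      have := nonneg_of_mul_nonneg_right this hC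
      exact mul_nonneg trunc_nonneg (mul_nonneg (sq_nonneg _) this)
    have e2 : ∫ z in Metric.ball 0 r' ×ˢ Ioc (-(r' - 1) / 2) τ, trunc k (u z) ^ 3 ≤ X :=
      h.setIntegral_trunc_mono le_rfl le_rfl hτab.2
    have e3 : km / (km - k) ≤ 2 * H := by
      have : km - k = (k' - k) / 2 := by rw [hkm]; ring
      rw [this, hH, mul_div_assoc', div_le_div_iff₀ (by positivity) hk'k]
      nlinarith
    have e30 : 0 ≤ km / (km - k) := div_nonneg (by linarith) (by linarith)
    have e4 : ∫ x, trunc km (u (x, τ)) ^ 3 * ξ (x, τ) ^ 2 ≤ B * (R * T ^ 2 * (2 * H) ^ 2) * X := by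
      calc _ ≤ B * (R * T ^ 2 * (km / (km - k)) ^ 2) * ∫ z in Metric.ball 0 r' ×ˢ
            Ioc (-(r' - 1) / 2) τ, trunc k (u z) ^ 3 := by linarith
        _ ≤ _ := by
          gcongr
          exact integral_nonneg fun _ => pow_nonneg trunc_nonneg 3
    have hkk : k' - km = k' / H / 2 := by rw [hH, hkm]; field_simp; ring
    have e5 : ∀ x, (trunc km (u (x, τ)) / (k' - km)) ^ 3 * ξ (x, τ) ^ 2 =
        8 * H ^ 3 / k' ^ 3 * (trunc km (u (x, τ)) ^ 3 * ξ (x, τ) ^ 2) := fun x => by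
      rw [hkk]; field_simp; ring
    simp only [e5]
    rw [integral_const_mul]
    calc _ ≤ 8 * H ^ 3 / k' ^ 3 * (B * (R * T ^ 2 * (2 * H) ^ 2) * X) := by gcongr
      _ = P := by rw [hP]; ring
  -- the Faber–Krahn inequality
  have hz3 : ∀ (χ : SpaceTime n → ℝ) (t s : ℝ), t ≤ 2 → (∀ z, χ z ≠ 0 → ‖z.1‖ < t ∧ s < z.2) →
      ∀ z, 3 < ‖z.1‖ → χ z = 0 := fun χ t s ht hχ z hz => by
    by_contra hne
    have := (hχ z hne).1
    linarith
  -- The square of this p is the cube of the truncation. The majorant ψ is at least 1 above k' by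
  -- the normalization with k' - km, and its slices were just bounded by P.
  have hfk' := hfk h (p := fun v => trunc k' v ^ (3 / 2 : ℝ))
    (p' := fun v => 3 / 2 * trunc k' v ^ (3 / 2 - 1 : ℝ))
    (ψ := fun v => (trunc km v / (k' - km)) ^ 3) (ζ := ζ) (ξ := fun z => ξ z ^ 2) (a := a) (b := b)
    (P := P) (fun v _ => hasDerivAt_trunc_rpow (by norm_num) k' v)
    (continuous_const.mul ((continuous_trunc k').rpow_const fun _ => Or.inr
      (by norm_num))).continuousOn
    (fun v _ => Real.rpow_nonneg trunc_nonneg _)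
    (((continuous_trunc km).div_const _).pow 3).continuousOn
    (fun v _ => pow_nonneg (div_nonneg trunc_nonneg (by linarith)) 3)
    (fun v _ hv => by
      have hne : trunc k' v ≠ 0 := fun h0 => hv (by
        simp only [h0]; exact Real.zero_rpow (by norm_num))
      have hlt := lt_of_trunc_ne_zero hne
      refine one_le_pow₀ ?_
      rw [le_div_iff₀ (by linarith), trunc_of_le (by linarith)]; linarith)
    hζ (fun z => (hζ01 z).1) (hz3 ζ rm _ (by linarith) hζs) (hξ.continuous.pow 2)
    (fun z => sq_nonneg _) (fun z hz => by
      have := hz3 ξ r' _ hr' hξs z hz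
      simp [this])
    (fun z hz => by
      have := hζs z hz
      have := hξ1 z this.1.le this.2.le
      simp [this])
    ha.1.1 hb.1.2 hslice
  set Z := innerCyl n rm b with hZ
  have hZsub : Z ⊆ slab n a b := prod_mono (subset_univ _) (Ioc_subset_Ioc (by linarith) le_rfl)
  have hrhs : ∫ z in slab n a b, (2 * (3 / 2 * trunc k' (u z) ^ (3 / 2 - 1 : ℝ) * ζ z) ^ 2 *
      ‖g z‖ ^ 2 + 2 * (trunc k' (u z) ^ (3 / 2 : ℝ)) ^ 2 * ‖fderiv ℝ ζ z‖ ^ 2) ≤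
      R / ε * T ^ 2 * H ^ 2 * (3 * C * B / 2 + 2) * X := by
    rw [setIntegral_eq_of_subset_of_forall_sdiff_eq_zero measurableSet_slab hZsub fun z hz => by
      have hz0 : ζ z = 0 := by
        by_contra hne
        have := hζs z hne
        exact hz.2 ⟨by simpa using this.1, this.2, hz.1.2.2⟩
      -- The gradient of ζ itself, not of ζ², appears here; it vanishes at zeros of ζ because these
      -- are minima.
      have hmin : IsLocalMin ζ z := Eventually.of_forall fun y => by
        rw [hz0]; exact (hζ01 y).1
      simp [hz0, hmin.fderiv_eq_zero]]
    have e1 := hcac (k := k) (k' := k') (s := -(rm - 1) / 2) h hF hε hR hT1 (by linarith) hζ hζ01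
      hζs hζT ha hb (by linarith) (by linarith) hk hkk'
    have hJ : 0 ≤ ∫ x, trunc k' (u (x, b)) ^ 3 * ζ (x, b) ^ 2 := integral_nonneg fun x =>
      mul_nonneg (pow_nonneg trunc_nonneg 3) (sq_nonneg _)
    have e2 : ∫ z in Z, trunc k (u z) ^ 3 ≤ X :=
        h.setIntegral_trunc_mono le_rfl (by linarith) le_rfl
    have e3 : ∫ z in Z, trunc k' (u z) * (ζ z ^ 2 * energyDensity q C R u F g z) ≤
        B * (R * T ^ 2 * H ^ 2) * X / 3 := by
      have : B * (R * T ^ 2 * (k' / (k' - k)) ^ 2) * ∫ z in Z, trunc k (u z) ^ 3 ≤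
        B * (R * T ^ 2 * H ^ 2) * X := by gcongr
      change _ + 3 * ∫ z in Z, trunc k' (u z) * (ζ z ^ 2 * energyDensity q C R u F g z) ≤
        B * (R * T ^ 2 * (k' / (k' - k)) ^ 2) * ∫ z in Z, trunc k (u z) ^ 3 at e1
      linarith
    have i1 : IntegrableOn (fun z => trunc k' (u z) * (ζ z ^ 2 * energyDensity q C R u F g z)) Z :=
      h.integrable_comp_mul (continuous_trunc k').continuousOn
        ((h.integrableOn_energyDensity (by linarith) volume_innerCyl_lt_top).bdd_mul (c := 1)
          (hζ.continuous.pow 2).aestronglyMeasurable (ae_of_all _ fun z => by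
            rw [Real.norm_of_nonneg (sq_nonneg _)]; exact pow_le_one₀ (hζ01 z).1 (hζ01 z).2))
    have i2 := h.integrableOn_trunc_cube k rm b
    calc _ ≤ ∫ z in Z, (9 / 2 * (C / ε) * (trunc k' (u z) *
          (ζ z ^ 2 * energyDensity q C R u F g z)) + 2 * T ^ 2 * trunc k (u z) ^ 3) := by
          refine integral_mono_of_nonneg (ae_of_all _ fun z => by positivity)
            ((i1.const_mul _).add (i2.const_mul _)) (ae_restrict_of_ae ?_)
          filter_upwards [hF.coercive] with z hz
          have hw := trunc_nonneg (k := k') (x := u z)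
          have p1 : (3 / 2 * trunc k' (u z) ^ (3 / 2 - 1 : ℝ) * ζ z) ^ 2 =
              9 / 4 * (trunc k' (u z) * ζ z ^ 2) := by
            have : (trunc k' (u z) ^ (3 / 2 - 1 : ℝ)) ^ 2 = trunc k' (u z) := by
              rw [← Real.rpow_natCast, ← Real.rpow_mul hw]; norm_num
            rw [mul_pow, mul_pow, this]; ring
          have p2 : (trunc k' (u z) ^ (3 / 2 : ℝ)) ^ 2 = trunc k' (u z) ^ 3 := by
            rw [← Real.rpow_natCast, ← Real.rpow_mul hw, ← Real.rpow_natCast]; norm_num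
          rw [p1, p2]
          -- The only use of the degenerate coercivity in this step, and hence the source of the
          -- factor R/ε.
          have hgE : ‖g z‖ ^ 2 ≤ C / ε * energyDensity q C R u F g z := by
            rw [div_mul_eq_mul_div, le_div_iff₀ hε]; linarith
          have hwζ : 0 ≤ trunc k' (u z) * ζ z ^ 2 := by positivity
          have q1 := mul_le_mul_of_nonneg_left hgE hwζ
          have q2 : trunc k' (u z) ^ 3 * ‖fderiv ℝ ζ z‖ ^ 2 ≤ trunc k (u z) ^ 3 * T ^ 2 := by
            have := hζT z
            have := trunc_anti (x := u z) hkk'.le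
            have := trunc_nonneg (k := k) (x := u z)
            gcongr
          linarith
      _ = 9 / 2 * (C / ε) * (∫ z in Z, trunc k' (u z) * (ζ z ^ 2 * energyDensity q C R u F g z))
          + 2 * T ^ 2 * ∫ z in Z, trunc k (u z) ^ 3 := by
          rw [integral_add (i1.const_mul _) (i2.const_mul _), integral_const_mul,
            integral_const_mul]
      _ ≤ 9 / 2 * (C / ε) * (B * (R * T ^ 2 * H ^ 2) * X / 3) + 2 * T ^ 2 * X := by gcongr
      _ = R / ε * T ^ 2 * H ^ 2 * (3 * C * B / 2) * X + 2 * (1 * T ^ 2 * 1 * X) := by ring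
      _ ≤ R / ε * T ^ 2 * H ^ 2 * (3 * C * B / 2) * X + 2 * (R / ε * T ^ 2 * H ^ 2 * X) := by
          have : 1 ≤ R / ε := by rw [le_div_iff₀ hε]; linarith
          have : 1 ≤ H ^ 2 := one_le_pow₀ hH1
          gcongr
      _ = _ := by ring
  have hlhs : ∫ z in innerCyl n r b, trunc k' (u z) ^ 3 ≤
      ∫ z in slab n a b, (trunc k' (u z) ^ (3 / 2 : ℝ) * ζ z) ^ 2 := by
    have p2 : ∀ z, (trunc k' (u z) ^ (3 / 2 : ℝ) * ζ z) ^ 2 = trunc k' (u z) ^ 3 * ζ z ^ 2 :=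
      fun z => by
        rw [mul_pow]; congr 1
        rw [← Real.rpow_natCast, ← Real.rpow_mul trunc_nonneg, ← Real.rpow_natCast]; norm_num
    simp only [p2]
    have i3 : IntegrableOn (fun z => trunc k' (u z) ^ 3 * ζ z ^ 2) (slab n a b) := by
      refine h.integrable_comp_mul (f := fun v => trunc k' v ^ 3)
        ((continuous_trunc k').pow 3).continuousOn ?_
      refine integrableOn_slab (hζ.continuous.pow 2) fun z hz => ?_
      have := hz3 ζ rm _ (by linarith) hζs z hz
      simp [this]
    calc _ = ∫ z in innerCyl n r b, trunc k' (u z) ^ 3 * ζ z ^ 2 := by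
          refine setIntegral_congr_fun measurableSet_innerCyl fun z hz => ?_
          have := hζ1 z (mem_ball_zero_iff.1 hz.1).le hz.2.1.le
          simp [this]
      _ ≤ _ := setIntegral_mono_set i3 (ae_of_all _ fun z => mul_nonneg
            (pow_nonneg trunc_nonneg 3) (sq_nonneg _))
          ((innerCyl_subset (by linarith) le_rfl).trans hZsub).eventuallyLE
  have hn0 : (0 : ℝ) < n := by positivity
  -- Writing R/ε as the power 2/n of (R/ε)^{n/2} merges it with the slice bound P, which produces
  -- the combination R (R/ε)^{n/2}. Since n ≥ 2, the exponent 2/n ≤ 1 can be discarded on quantities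
  -- at least 1.
  have e6 : P ^ (2 / n : ℝ) * (R / ε) ≤ (32 * B * c ^ 2) ^ (2 / n : ℝ) * ((1 / d) ^ 2 * H ^ 5) *
      (R * (R / ε) ^ (n / 2 : ℝ) / k' ^ 3 * X) ^ (2 / n : ℝ) := by
    have e7 : R / ε = ((R / ε) ^ (n / 2 : ℝ)) ^ (2 / n : ℝ) := by
      rw [← Real.rpow_mul (by positivity)]
      have : (n / 2 * (2 / n) : ℝ) = 1 := by field_simp
      rw [this, Real.rpow_one]
    have e8 : P * (R / ε) ^ (n / 2 : ℝ) = (32 * B * c ^ 2) * ((1 / d) ^ 2 * H ^ 5) *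
        (R * (R / ε) ^ (n / 2 : ℝ) / k' ^ 3 * X) := by
      rw [hP, hT]; field_simp
    have e9 : ((1 / d) ^ 2 * H ^ 5) ^ (2 / n : ℝ) ≤ (1 / d) ^ 2 * H ^ 5 := by
      have hd1' : 1 ≤ 1 / d := by rw [le_div_iff₀ hd0]; linarith
      have h1 : 1 ≤ (1 / d) ^ 2 * H ^ 5 := one_le_mul_of_one_le_of_one_le (one_le_pow₀ hd1')
        (one_le_pow₀ hH1)
      calc _ ≤ ((1 / d) ^ 2 * H ^ 5) ^ (1 : ℝ) := by
            refine Real.rpow_le_rpow_of_exponent_le h1 ?_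
            rw [div_le_one hn0]; exact_mod_cast hn
        _ = _ := Real.rpow_one _
    calc P ^ (2 / n : ℝ) * (R / ε) = (P * (R / ε) ^ (n / 2 : ℝ)) ^ (2 / n : ℝ) := by
          rw [Real.mul_rpow hP0 (by positivity), ← e7]
      _ = (32 * B * c ^ 2) ^ (2 / n : ℝ) * ((1 / d) ^ 2 * H ^ 5) ^ (2 / n : ℝ) *
          (R * (R / ε) ^ (n / 2 : ℝ) / k' ^ 3 * X) ^ (2 / n : ℝ) := by
          rw [e8, Real.mul_rpow (by positivity) (by positivity),
            Real.mul_rpow (by positivity) (by positivity)]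
      _ ≤ _ := by gcongr
  calc _ ≤ C₁ * P ^ (2 / n : ℝ) * (R / ε * T ^ 2 * H ^ 2 * (3 * C * B / 2 + 2) * X) :=
        hlhs.trans (hfk'.trans (by gcongr))
    _ = C₁ * (P ^ (2 / n : ℝ) * (R / ε)) * (T ^ 2 * H ^ 2 * (3 * C * B / 2 + 2) * X) := by ring
    _ ≤ C₁ * ((32 * B * c ^ 2) ^ (2 / n : ℝ) * ((1 / d) ^ 2 * H ^ 5) *
      (R * (R / ε) ^ (n / 2 : ℝ) / k' ^ 3 * X) ^ (2 / n : ℝ)) *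
        (T ^ 2 * H ^ 2 * (3 * C * B / 2 + 2) * X) := by gcongr
    _ = _ := by rw [hT]; ring

end

/-! ### Sup bounds in the normalized cylinder. -/

noncomputable section

/-- De Giorgi's iteration. -/
theorem exists_le_of_truncation_small (n : ℕ) (hn : 2 ≤ n) {q C : ℝ} (hq : 0 < q) (hq1 : q < 1)
    (hC : 0 < C) : ∃ c : ℝ, 0 < c ∧
    ∀ {K R ε r r' b k : ℝ} {u : SpaceTime n → ℝ} {F g : SpaceTime n → Space n},
      BoxSolution K u F g → FluxBounds q C R ε u F g → 0 < ε → ε ≤ 1 → 1 ≤ R → 1 ≤ r → r < r' →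
      r' ≤ 2 → b ∈ goodTimes u → 0 < b → 1 ≤ k →
      R * (R / ε) ^ (n / 2 : ℝ) * ∫ z in innerCyl n r' b, trunc k (u z) ^ 3 ≤
        c * k ^ 3 * (r' - r) ^ (2 * n : ℝ) →
      ∀ᵐ z ∂volume.restrict (innerCyl n r b), u z ≤ 2 * k := by
  obtain ⟨A, hA, hstep⟩ := exists_truncation_step n hn hq hq1 hC
  -- The numbers come from (2 · 2^j)⁴ (4 · 2^j)⁷ = 2^{18} (2^{11})^j. The threshold for fast
  -- convergence then reads G d^{-4} (N Y₀/k³)^{2/n} ≤ 1, which is the assumed smallness with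
  -- constant G^{-n/2}.
  set G := A * 2 ^ 18 * ((2 : ℝ) ^ 11) ^ (1 / (2 / n : ℝ)) with hG
  have hG0 : 0 < G := by positivity
  refine ⟨G ^ (-(n / 2 : ℝ)), by positivity, ?_⟩
  intro K R ε r r' b k u F g h hF hε hε1 hR hr hrr' hr' hb hb0 hk hsmall
  set d := r' - r with hd
  have hd0 : 0 < d := by linarith
  have hk0 : 0 < k := by linarith
  set N := R * (R / ε) ^ (n / 2 : ℝ) with hN
  have hN0 : 0 < N := by positivity
  -- Radii shrink from r' to r while the levels rise from k to 2k. In the limit the truncation at 2k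
  -- has zero integral on the inner cylinder.
  set ρ : ℕ → ℝ := fun j => r + d * (1 / 2) ^ j with hρ
  set κ : ℕ → ℝ := fun j => k * (2 - (1 / 2) ^ j) with hκ
  set Y : ℕ → ℝ := fun j => ∫ z in innerCyl n (ρ j) b, trunc (κ j) (u z) ^ 3 with hY
  have hY0 : ∀ j, 0 ≤ Y j := fun j => integral_nonneg fun _ => pow_nonneg trunc_nonneg 3
  have hpow : ∀ j : ℕ, 0 < (1 / 2 : ℝ) ^ j ∧ (1 / 2 : ℝ) ^ j ≤ 1 := fun j =>
    ⟨by positivity, pow_le_one₀ (by norm_num) (by norm_num)⟩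
  have hinv : ∀ j : ℕ, (1 / 2 : ℝ) ^ j * 2 ^ j = 1 := fun j => by rw [← mul_pow]; norm_num
  have hlim : Tendsto Y atTop (𝓝 0) := by
    refine tendsto_zero_of_superlinear (A := A * 2 ^ 18 * (1 / d) ^ 4 * (N / k ^ 3) ^ (2 / n : ℝ))
      (b := 2 ^ 11) (δ := 2 / n) hY0 (by positivity) (by norm_num) (by positivity) (fun j => ?_) ?_
    · obtain ⟨p0, p1⟩ := hpow j
      have ps : (1 / 2 : ℝ) ^ (j + 1) = (1 / 2) ^ j / 2 := by rw [pow_succ]; ring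
      have hρs : ρ j - ρ (j + 1) = d * (1 / 2) ^ j / 2 := by simp only [hρ, ps]; ring
      have hκs : κ (j + 1) - κ j = k * (1 / 2) ^ j / 2 := by simp only [hκ, ps]; ring
      have hpos : 0 < d * (1 / 2) ^ j := by positivity
      have hpos' : 0 < k * (1 / 2) ^ j := by positivity
      have hκ1 : k ≤ κ j := le_mul_of_one_le_right hk0.le (by linarith)
      have hκ2 : k ≤ κ (j + 1) := le_mul_of_one_le_right hk0.le (by linarith [(hpow (j + 1)).2])
      have hκ3 : κ (j + 1) ≤ 2 * k := by
        simp only [hκ]; have := (hpow (j + 1)).1; nlinarith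
      have hρr' : ρ j ≤ r' := by
        have : d * (1 / 2) ^ j ≤ d := mul_le_of_le_one_right hd0.le p1
        simp only [hρ]; linarith
      have e1 := hstep (r := ρ (j + 1)) (r' := ρ j) (k := κ j) (k' := κ (j + 1)) h hF hε hε1 hR
        (by have := (hpow (j + 1)).1; simp only [hρ]; nlinarith) (by linarith) (by linarith) hb hb0
        (by linarith) (by linarith)
      have e2 : (1 / (ρ j - ρ (j + 1))) ^ 4 = (1 / d) ^ 4 * (2 * 2 ^ j) ^ 4 := by
        rw [hρs, ← mul_pow]; congr 1
        have := hinv j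
        field_simp
        linarith
      have e3 : (κ (j + 1) / (κ (j + 1) - κ j)) ^ 7 ≤ (4 * 2 ^ j) ^ 7 := by
        have : 0 < κ (j + 1) - κ j := by rw [hκs]; linarith
        have hc : 0 < κ (j + 1) := by linarith
        refine pow_le_pow_left₀ (by positivity) ?_ 7
        rw [div_le_iff₀ this, hκs]
        calc _ ≤ 2 * k := hκ3
          _ = 2 * k * ((1 / 2) ^ j * 2 ^ j) := by rw [hinv j, mul_one]
          _ = _ := by ring
      have hX := hY0 j
      have e4 : (N / κ (j + 1) ^ 3 * Y j) ^ (2 / n : ℝ) ≤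
          (N / k ^ 3) ^ (2 / n : ℝ) * Y j ^ (2 / n : ℝ) := by
        rw [← Real.mul_rpow (by positivity) hX]
        have hc : 0 < κ (j + 1) := by linarith
        refine Real.rpow_le_rpow (by positivity) ?_ (by positivity)
        gcongr
      have e40 : 0 ≤ (N / κ (j + 1) ^ 3 * Y j) ^ (2 / n : ℝ) := by
        have : 0 < κ (j + 1) := by linarith
        positivity
      have e5 : Y j ^ (1 + 2 / n : ℝ) = Y j ^ (2 / n : ℝ) * Y j := by
        rw [add_comm, Real.rpow_add_one' hX (by positivity)]
      calc Y (j + 1) ≤ _ := e1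
        _ ≤ A * ((1 / d) ^ 4 * (2 * 2 ^ j) ^ 4) * (4 * 2 ^ j) ^ 7 *
            ((N / k ^ 3) ^ (2 / n : ℝ) * Y j ^ (2 / n : ℝ)) * Y j := by
          rw [e2]; gcongr
        _ = A * 2 ^ 18 * (1 / d) ^ 4 * (N / k ^ 3) ^ (2 / n : ℝ) * ((2 : ℝ) ^ 11) ^ j *
            (Y j ^ (2 / n : ℝ) * Y j) := by
          rw [← pow_mul, mul_comm 11 j, pow_mul]; ring
        _ = _ := by rw [e5]
    · have hY00 : Y 0 ≤ ∫ z in innerCyl n r' b, trunc k (u z) ^ 3 := by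
        simp only [hY, hρ, hκ]
        norm_num [hd]
      have hc : (G ^ (-(n / 2 : ℝ))) ^ (2 / n : ℝ) = G⁻¹ := by
        rw [← Real.rpow_mul hG0.le, ← Real.rpow_neg_one]; congr 1; field_simp
      have hd4 : (d ^ (2 * n : ℝ)) ^ (2 / n : ℝ) = d ^ 4 := by
        rw [← Real.rpow_mul hd0.le, ← Real.rpow_natCast]; congr 1; push_cast; field_simp; norm_num
      have e1 : (N / k ^ 3) ^ (2 / n : ℝ) * Y 0 ^ (2 / n : ℝ) ≤ G⁻¹ * d ^ 4 := by
        rw [← Real.mul_rpow (by positivity) (hY0 0), ← hc, ← hd4,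
          ← Real.mul_rpow (by positivity) (by positivity)]
        refine Real.rpow_le_rpow (mul_nonneg (by positivity) (hY0 0)) ?_ (by positivity)
        rw [div_mul_eq_mul_div, div_le_iff₀ (by positivity)]
        calc N * Y 0 ≤ _ := mul_le_mul_of_nonneg_left hY00 hN0.le
          _ ≤ _ := hsmall
          _ = _ := by ring
      calc _ = G * (1 / d) ^ 4 * ((N / k ^ 3) ^ (2 / n : ℝ) * Y 0 ^ (2 / n : ℝ)) := by
            rw [hG]; ring
        _ ≤ G * (1 / d) ^ 4 * (G⁻¹ * d ^ 4) := by gcongr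
        _ = 1 := by field_simp
  have hzero : ∫ z in innerCyl n r b, trunc (2 * k) (u z) ^ 3 = 0 := by
    refine le_antisymm (ge_of_tendsto' hlim fun j => ?_)
      (integral_nonneg fun _ => pow_nonneg trunc_nonneg 3)
    have := (hpow j).1
    exact h.setIntegral_trunc_mono (by simp only [hκ]; nlinarith)
      (by simp only [hρ]; nlinarith) le_rfl
  rw [setIntegral_eq_zero_iff_of_nonneg_ae (ae_of_all _ fun _ => pow_nonneg trunc_nonneg 3)
    (h.integrableOn_trunc_cube _ _ _)] at hzero
  filter_upwards [hzero] with z hz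
  by_contra! hcon
  have : trunc (2 * k) (u z) = 0 := by simpa using hz
  rw [trunc_of_le hcon.le] at this
  linarith

/-- Local boundedness in terms of the mass. -/
theorem exists_le_mass (n : ℕ) (hn : 2 ≤ n) {q C : ℝ} (hq : 0 < q) (hq1 : q < 1)
    (hC : 0 < C) : ∃ γ : ℝ, 0 < γ ∧
    ∀ {K R ε b : ℝ} {u : SpaceTime n → ℝ} {F g : SpaceTime n → Space n},
      BoxSolution K u F g → FluxBounds q C R ε u F g → 0 < ε → ε ≤ 1 → 1 ≤ R →
      b ∈ goodTimes u → 0 < b → ∀ᵐ z ∂volume.restrict (innerCyl n 1 b),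
        u z ≤ γ * (1 + R * (R / ε) ^ (n / 2 : ℝ) * ∫ z in innerCyl n 2 b, u z) := by
  obtain ⟨c, hc, hiter⟩ := exists_le_of_truncation_small n hn hq hq1 hC
  set δ := (2 : ℝ) ^ (-(2 * n : ℝ)) / 2 with hδ
  have hδ0 : 0 < δ := by positivity
  have hδb : δ * 2 ^ (2 * n : ℝ) = 1 / 2 := by
    rw [hδ, Real.rpow_neg (by norm_num)]
    have : (2 : ℝ) ^ (2 * n : ℝ) ≠ 0 := by positivity
    field_simp
  have hδ1 : δ < 1 := by
    have : (2 : ℝ) ^ (-(2 * n : ℝ)) ≤ 1 :=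
      Real.rpow_le_one_of_one_le_of_nonpos (by norm_num) (by simp)
    linarith
  -- Chosen so that c (δ f/2)² J d^{2n} equals N f² W for J = D d^{-2n} N W, where f is the supremum
  -- on the larger cylinder. The cube of the level 1 + δ f/2 + J dominates (δ f/2)² J, so the
  -- smallness condition holds.
  set D := 4 / (c * δ ^ 2) with hD
  have hD0 : 0 < D := by positivity
  refine ⟨2 * 2 ^ (2 * n : ℝ) * (2 + 2 * D), by positivity, ?_⟩
  intro K R ε b u F g h hF hε hε1 hR hb hb0
  set N := R * (R / ε) ^ (n / 2 : ℝ) with hN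
  have hN0 : 0 < N := by positivity
  set W := ∫ z in innerCyl n 2 b, u z with hW
  have hW0 : 0 ≤ W := integral_nonneg fun z => (h.u_mem z).1
  have hbd : ∀ r : ℝ, IsBoundedUnder (· ≤ ·) (ae (volume.restrict (innerCyl n r b))) u := fun r =>
    ⟨K, eventually_map.2 (ae_of_all _ fun z => (h.u_mem z).2)⟩
  have hne : ∀ r : ℝ, 1 ≤ r → (ae (volume.restrict (innerCyl n r b))).NeBot := fun r hr => by
    rw [ae_neBot, Ne, Measure.restrict_eq_zero]
    have : volume (innerCyl n r b) = volume (Metric.ball (0 : Space n) r) *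
      volume (Ioc (-(r - 1) / 2) b) := Measure.prod_prod _ _
    rw [this]
    refine mul_ne_zero (Metric.measure_ball_pos _ _ (by linarith)).ne' ?_
    rw [Real.volume_Ioc, Ne, ENNReal.ofReal_eq_zero]
    linarith
  have hcob : ∀ r : ℝ, 1 ≤ r →
      IsCoboundedUnder (· ≤ ·) (ae (volume.restrict (innerCyl n r b))) u := fun r hr => by
    have := hne r hr
    exact (isBoundedUnder_of ⟨0, fun z => (h.u_mem z).1⟩ :
      IsBoundedUnder (· ≥ ·) _ u).isCoboundedUnder_le
  set f : ℝ → ℝ := fun r => essSup u (volume.restrict (innerCyl n r b)) with hf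
  have hle : ∀ r : ℝ, ∀ᵐ z ∂volume.restrict (innerCyl n r b), u z ≤ f r := fun r =>
    ae_le_essSup (hbd r)
  have hf0 : ∀ r : ℝ, 1 ≤ r → 0 ≤ f r := fun r hr => by
    have := hne r hr
    obtain ⟨z, hz⟩ := (hle r).exists
    exact (h.u_mem z).1.trans hz
  have key := absorb_of_forall_lt (f := f) (r₀ := 1) (r₁ := 2) (S := K) (A := 2 + 2 * D * (N * W))
    (b := 2 * n) (δ := δ) (by norm_num) (by positivity) hδ0.le hδb.le hδ1 (fun r hr =>
      essSup_le_of_ae_le _ (ae_of_all _ fun z => (h.u_mem z).2) (hcob r hr.1)) ?_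
  · filter_upwards [hle 1] with z hz
    have e : (2 - 1 : ℝ) ^ (-(2 * n : ℝ)) = 1 := by norm_num
    rw [e, mul_one] at key
    calc u z ≤ _ := hz.trans key
      _ ≤ 2 * 2 ^ (2 * n : ℝ) * ((2 + 2 * D) * (1 + N * W)) := by
        gcongr
        have : 0 ≤ N * W := by positivity
        linarith
      _ = _ := by ring
  · intro r r' hr hrr' hr'
    set d := r' - r with hd
    have hd0 : 0 < d := by linarith
    have hd1 : d ≤ 1 := by linarith
    have hM := hf0 r' (by linarith)
    set J := D * d ^ (-(2 * n : ℝ)) * (N * W) with hJ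
    have hJ0 : 0 ≤ J := by positivity
    -- Interpolation: two of the three powers are estimated by the supremum, which is later
    -- absorbed, and one is left as mass. This makes the final bound linear in W.
    have hX : ∫ z in innerCyl n r' b, trunc (1 + δ * f r' / 2 + J) (u z) ^ 3 ≤ f r' ^ 2 * W := by
      calc _ ≤ ∫ z in innerCyl n r' b, f r' ^ 2 * u z := by
            refine integral_mono_ae (h.integrableOn_trunc_cube _ _ _)
              (h.u_int.integrableOn.const_mul _) ?_
            filter_upwards [hle r'] with z hz
            have h0 := (h.u_mem z).1
            have h1 := trunc_le (k := 1 + δ * f r' / 2 + J) (by positivity) h0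
            have h2 := trunc_nonneg (k := 1 + δ * f r' / 2 + J) (x := u z)
            calc trunc (1 + δ * f r' / 2 + J) (u z) ^ 3 ≤ u z ^ 3 := by gcongr
              _ = u z ^ 2 * u z := by ring
              _ ≤ _ := by gcongr
        _ = f r' ^ 2 * ∫ z in innerCyl n r' b, u z := integral_const_mul _ _
        _ ≤ _ := by
            gcongr
            exact setIntegral_mono_set h.u_int.integrableOn (ae_of_all _ fun z => (h.u_mem z).1)
              (innerCyl_subset hr' le_rfl).eventuallyLE
    have hae := hiter (k := 1 + δ * f r' / 2 + J) h hF hε hε1 hR hr hrr' hr' hb hb0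
      (by have : 0 ≤ δ * f r' / 2 := by positivity
          linarith) (by
        have k1 : (δ * f r' / 2) ^ 2 * J ≤ (1 + δ * f r' / 2 + J) ^ 3 := by
          have a0 : 0 ≤ δ * f r' / 2 := by positivity
          calc (δ * f r' / 2) ^ 2 * J ≤ (1 + δ * f r' / 2 + J) ^ 2 * (1 + δ * f r' / 2 + J) := by
                gcongr <;> linarith
            _ = _ := by ring
        have k2 : d ^ (-(2 * n : ℝ)) * d ^ (2 * n : ℝ) = 1 := by
          rw [← Real.rpow_add hd0]; simp
        calc _ ≤ N * (f r' ^ 2 * W) := by gcongr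
          _ = c * ((δ * f r' / 2) ^ 2 * (D * (d ^ (-(2 * n : ℝ)) * d ^ (2 * n : ℝ)) *
              (N * W))) := by
            rw [k2, hD]; field_simp; norm_num
          _ = c * ((δ * f r' / 2) ^ 2 * J) * d ^ (2 * n : ℝ) := by rw [hJ]; ring
          _ ≤ _ := by gcongr)
    have h1 : f r ≤ 2 * (1 + δ * f r' / 2 + J) := essSup_le_of_ae_le _ hae (hcob r hr)
    have h2 : 1 ≤ d ^ (-(2 * n : ℝ)) :=
      Real.one_le_rpow_of_pos_of_le_one_of_nonpos hd0 hd1 (by simp)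
    calc f r ≤ _ := h1
      _ = δ * f r' + (2 * 1 + 2 * D * (N * W) * d ^ (-(2 * n : ℝ))) := by rw [hJ]; ring
      _ ≤ δ * f r' + (2 * d ^ (-(2 * n : ℝ)) + 2 * D * (N * W) * d ^ (-(2 * n : ℝ))) := by gcongr
      _ = _ := by ring

/-- The Harnack-type estimate in the normalized cylinder. -/
theorem exists_le_mass_slice (n : ℕ) (hn : 2 ≤ n) {q C : ℝ} (hq : 0 < q) (hq1 : q < 1)
    (hC : 0 < C) : ∃ γ : ℝ, 0 < γ ∧
    ∀ {K R ε : ℝ} {u : SpaceTime n → ℝ} {F g : SpaceTime n → Space n},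
      BoxSolution K u F g → FluxBounds q C R ε u F g → 0 < ε → ε ≤ 1 → 1 ≤ R →
      ∀ τ ∈ goodTimes u, ∀ᵐ z ∂volume.restrict (Metric.ball 0 1 ×ˢ Ioo 0 1),
        u z ≤ γ * (1 + R * (R / ε) ^ (n / 2 : ℝ) *
          ((∫ x in Metric.ball 0 4, u (x, τ)) + R ^ (1 / (2 * q)))) := by
  obtain ⟨γ₁, hγ₁, h₁⟩ := exists_le_mass n hn hq hq1 hC
  obtain ⟨γ₂, hγ₂, h₂⟩ := exists_mass_le_mass n hq hq1 hC
  refine ⟨γ₁ * (1 + 2 * γ₂), by positivity, ?_⟩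
  intro K R ε u F g h hF hε hε1 hR τ hτ
  set N := R * (R / ε) ^ (n / 2 : ℝ) with hN
  set I := (∫ x in Metric.ball 0 4, u (x, τ)) + R ^ (1 / (2 * q)) with hI
  have hI0 : 0 ≤ I := add_nonneg (integral_nonneg fun x => (h.u_mem _).1) (by positivity)
  -- The iteration ends at good times b < 1; a sequence of them tending to 1 exhausts the open
  -- cylinder with one common constant.
  have hgood : ∀ j : ℕ, ∃ b ∈ goodTimes u, b ∈ Ioo (1 - 1 / ((j : ℝ) + 1)) 1 := fun j => by
    have : 0 < 1 / ((j : ℝ) + 1) := by positivity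
    have : 1 / ((j : ℝ) + 1) ≤ 1 := by
      rw [div_le_one (by positivity)]; linarith [j.cast_nonneg (α := ℝ)]
    exact h.exists_goodTime (by linarith) (by linarith) le_rfl
  choose b hb hb1 using hgood
  have hb0 : ∀ j, 0 < b j := fun j => by
    have : 1 / ((j : ℝ) + 1) ≤ 1 := by
      rw [div_le_one (by positivity)]; linarith [j.cast_nonneg (α := ℝ)]
    linarith [(hb1 j).1]
  -- The L¹ Harnack inequality at almost every time slice, compared with the fixed time τ, which may
  -- lie anywhere in (-1, 1).
  have hW : ∀ j, ∫ z in innerCyl n 2 (b j), u z ≤ 2 * (γ₂ * I) := fun j => by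
    have hi : IntegrableOn u (innerCyl n 2 (b j)) := h.u_int.integrableOn
    rw [IntegrableOn, innerCyl, Measure.volume_eq_prod, ← Measure.prod_restrict] at hi
    rw [innerCyl, Measure.volume_eq_prod, ← Measure.prod_restrict, integral_prod_symm _ hi]
    calc _ ≤ ∫ σ in Ioc (-(2 - 1 : ℝ) / 2) (b j), γ₂ * I := by
          refine integral_mono_of_nonneg (ae_of_all _ fun σ => integral_nonneg fun x =>
            (h.u_mem _).1) (integrableOn_const (by simp)) ?_
          filter_upwards [ae_restrict_of_ae h.ae_mem_goodTimes, ae_restrict_mem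
            measurableSet_Ioc] with σ h1 h2
          exact h₂ h hF hε hR τ hτ σ (h1 ⟨by linarith [h2.1], h2.2.trans_lt (hb1 j).2⟩)
      _ ≤ 2 * (γ₂ * I) := by
          have := hb0 j
          have := (hb1 j).2
          rw [setIntegral_const, measureReal_def, Real.volume_Ioc, ENNReal.toReal_ofReal
            (by linarith), smul_eq_mul]
          gcongr
          linarith
  have hall : ∀ j, ∀ᵐ z, z ∈ innerCyl n 1 (b j) →
      u z ≤ γ₁ * (1 + N * ∫ z in innerCyl n 2 (b j), u z) := fun j =>
    (ae_restrict_iff' measurableSet_innerCyl).1 (h₁ h hF hε hε1 hR (hb j) (hb0 j))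
  rw [ae_restrict_iff' (measurableSet_ball.prod measurableSet_Ioo)]
  filter_upwards [ae_all_iff.2 hall] with z hz hzm
  obtain ⟨j, hj⟩ := exists_nat_one_div_lt (show 0 < 1 - z.2 by linarith [hzm.2.2])
  have hmem : z ∈ innerCyl n 1 (b j) :=
    ⟨hzm.1, by have := hzm.2.1; norm_num; exact this, by linarith [(hb1 j).1]⟩
  calc u z ≤ _ := hz j hmem
    _ ≤ γ₁ * (1 + N * (2 * (γ₂ * I))) := by
      gcongr
      exact hW j
    _ = γ₁ * (1 * 1 + 2 * γ₂ * (N * I)) := by ring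
    _ ≤ γ₁ * (1 + 2 * γ₂) * (1 + N * I) := by
      have : 0 ≤ N * I := by positivity
      have : 0 ≤ γ₁ * γ₂ := by positivity
      have : 0 ≤ γ₁ * (N * I) := by positivity
      nlinarith

end

/-! ### Weak gradients: chain rule and vanishing on the zero set. -/

noncomputable section

section stampacchia
variable {n : ℕ} {K : ℝ} {u : SpaceTime n → ℝ} {g : SpaceTime n → Space n} {O : Set (SpaceTime n)}

/-- Weak gradients can be restricted to compact sets. -/
theorem WeakGradOn.indicator (h : WeakGradOn O u g) {L : Set (SpaceTime n)} (hLO : L ⊆ O) :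
    WeakGradOn (interior L) (L.indicator u) (L.indicator g) := by
  intro φ hφ hc hs v
  have hsL := hs.trans interior_subset
  have e1 : ∀ z, L.indicator u z * fderiv ℝ φ z (v, 0) = u z * fderiv ℝ φ z (v, 0) := fun z => by
    by_cases hz : z ∈ L
    · rw [indicator_of_mem hz]
    · have : fderiv ℝ φ z = 0 := by
        by_contra hne
        exact hz (hsL (support_fderiv_subset ℝ hne))
      simp [this]
  have e2 : ∀ z, φ z * ⟪L.indicator g z, v⟫ = φ z * ⟪g z, v⟫ := fun z => by
    by_cases hz : z ∈ L
    · rw [indicator_of_mem hz]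
    · have : φ z = 0 := image_eq_zero_of_notMem_tsupport fun h0 => hz (hsL h0)
      simp [this]
  simp only [e1, e2]
  exact h φ hφ hc (hsL.trans hLO) v

theorem norm_mollify_le (hg : Integrable g) (j : ℕ) (z : SpaceTime n) :
    ‖mollify j g z‖ ≤ mollify j (fun w => ‖g w‖) z := by
  refine norm_integral_le_of_norm_le (integrable_mollifier_smul hg.norm z) (ae_of_all _ fun w => ?_)
  rw [norm_smul, Real.norm_of_nonneg (mollifier_nonneg _), smul_eq_mul]

/-- The chain rule for weak gradients, tested against a smooth function. -/
theorem WeakGradOn.integral_comp (hO : IsOpen O) (hu : Integrable u) (hmem : ∀ z, u z ∈ Icc 0 K)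
    (hg : Integrable g) (h : WeakGradOn O u g) {f f' : ℝ → ℝ}
    (hf : ∀ x, 0 ≤ x → HasDerivAt f (f' x) x) (hf' : ContinuousOn f' (Ici 0))
    {φ : SpaceTime n → ℝ} (hφ : ContDiff ℝ ∞ φ) (hc : HasCompactSupport φ) (hs : tsupport φ ⊆ O)
    (v : Space n) :
    ∫ z, f (u z) * fderiv ℝ φ z (v, 0) = -∫ z, φ z * (f' (u z) * ⟪g z, v⟫) := by
  have hfc : ContinuousOn f (Ici 0) := fun x hx => (hf x hx).continuousAt.continuousWithinAt
  have hmm : ∀ j z, mollify j u z ∈ Icc 0 K := fun j z => mollify_mem_Icc hu hmem z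
  have hcu : ∀ j, Continuous (mollify j u) := fun j => (mollify_contDiff hu).continuous
  have hcg : ∀ j, Continuous (mollify j g) := fun j => (mollify_contDiff hg).continuous
  have hcf : ∀ j, Continuous fun z => f (mollify j u z) := fun j =>
    hfc.comp_continuous (hcu j) fun z => (hmm j z).1
  have hcf' : ∀ j, Continuous fun z => f' (mollify j u z) := fun j =>
    hf'.comp_continuous (hcu j) fun z => (hmm j z).1
  have hcφ : Continuous fun z => fderiv ℝ φ z (v, 0) :=
    (hφ.continuous_fderiv (by simp)).clm_apply continuous_const
  have hcsφ : HasCompactSupport fun z => fderiv ℝ φ z (v, 0) :=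
    (hc.fderiv ℝ).comp_left (g := fun L : SpaceTime n →L[ℝ] ℝ => L (v, 0)) (by simp)
  obtain ⟨C₁, hC₁⟩ := (isCompact_Icc (a := (0 : ℝ)) (b := K)).exists_bound_of_continuousOn
    (hfc.mono fun x hx => hx.1)
  obtain ⟨C₂, hC₂⟩ := (isCompact_Icc (a := (0 : ℝ)) (b := K)).exists_bound_of_continuousOn
    (hf'.mono fun x hx => hx.1)
  obtain ⟨C₃, hC₃⟩ := hφ.continuous.bounded_above_of_compact_support hc
  have hC₂0 : 0 ≤ C₂ := (norm_nonneg _).trans (hC₂ _ (hmm 0 0))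
  have hC₃0 : 0 ≤ C₃ := (norm_nonneg _).trans (hC₃ 0)
  have hlim₁ : Tendsto (fun j => ∫ z, f (mollify j u z) * fderiv ℝ φ z (v, 0)) atTop
      (𝓝 (∫ z, f (u z) * fderiv ℝ φ z (v, 0))) := by
    refine tendsto_integral_of_dominated_convergence (fun z => C₁ * ‖fderiv ℝ φ z (v, 0)‖)
      (fun j => ((hcf j).mul hcφ).aestronglyMeasurable)
      ((hcφ.integrable_of_hasCompactSupport hcsφ).norm.const_mul _)
      (fun j => ae_of_all _ fun z => ?_) ?_
    · rw [norm_mul]; gcongr; exact hC₁ _ (hmm j z)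
    · filter_upwards [mollify_tendsto hu] with z hz
      refine Tendsto.mul_const _ ?_
      exact (hf _ (hmem z).1).continuousAt.tendsto.comp hz
  have hlim₂ : Tendsto (fun j => ∫ z, φ z * (f' (mollify j u z) * ⟪mollify j g z, v⟫)) atTop
      (𝓝 (∫ z, φ z * (f' (u z) * ⟪g z, v⟫))) := by
    -- The gradient is only integrable here, so the domination is by the mollified norm rather than
    -- by its square.
    have := tendsto_setIntegral_of_le_mollify (S := univ) (K₀ := ∅) (C := C₃ * (C₂ * ‖v‖))
      (H := fun j z => φ z * (f' (mollify j u z) * ⟪mollify j g z, v⟫))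
      (H' := fun z => φ z * (f' (u z) * ⟪g z, v⟫)) hg.norm (fun z => norm_nonneg _)
      MeasurableSet.univ isCompact_empty (by positivity) (fun j => (hφ.continuous.mul
        ((hcf' j).mul ((hcg j).inner continuous_const))).aestronglyMeasurable) ?_ ?_
    · simpa using this
    · refine Eventually.of_forall fun j z _ => ?_
      have h1 := norm_mollify_le hg j z
      have h2 := (abs_real_inner_le_norm (mollify j g z) v).trans
        (mul_le_mul_of_nonneg_right h1 (norm_nonneg v))
      have h3 := hC₂ _ (hmm j z)
      have h4 := hC₃ z
      rw [Real.norm_eq_abs] at h3 h4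
      rw [abs_mul, abs_mul]
      calc _ ≤ C₃ * (C₂ * (mollify j (fun w => ‖g w‖) z * ‖v‖)) := by gcongr
        _ = _ := by simp; ring
    · filter_upwards [mollify_tendsto hu, mollify_tendsto hg] with z hz1 hz2 _
      refine Tendsto.const_mul _ (Tendsto.mul ?_ (hz2.inner tendsto_const_nhds))
      have hcw := hf' (u z) (hmem z).1
      exact hcw.tendsto.comp (tendsto_nhdsWithin_iff.2 ⟨hz1, Eventually.of_forall fun j =>
        (hmm j z).1⟩)
  refine tendsto_nhds_unique hlim₁ (hlim₂.neg.congr' ?_)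
  filter_upwards [h.fderiv_mollify_eq hO hc hs hu hg] with j hj
  have hd : ∀ z, HasFDerivAt (fun z => f (mollify j u z))
      (f' (mollify j u z) • fderiv ℝ (mollify j u) z) z := fun z =>
    (hf _ (hmm j z).1).comp_hasFDerivAt z
      (((mollify_contDiff hu).differentiable (by simp) z).hasFDerivAt)
  have hcd : Continuous fun z => fderiv ℝ (fun z => f (mollify j u z)) z (v, 0) := by
    have e : ∀ z, fderiv ℝ (fun z => f (mollify j u z)) z (v, 0) =
        f' (mollify j u z) * fderiv ℝ (mollify j u) z (v, 0) := fun z => by rw [(hd z).fderiv]; rfl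
    simp only [e]
    exact (hcf' j).mul (((mollify_contDiff hu).continuous_fderiv (by simp)).clm_apply
      continuous_const)
  rw [integral_mul_fderiv_eq_neg_fderiv_mul_of_integrable
    ((hcd.mul hφ.continuous).integrable_of_hasCompactSupport hc.mul_left)
    (((hcf j).mul hcφ).integrable_of_hasCompactSupport hcsφ.mul_left)
    (((hcf j).mul hφ.continuous).integrable_of_hasCompactSupport hc.mul_left)
    (fun z _ => (hd z).differentiableAt) (fun z _ => hφ.differentiable (by simp) z)]
  congr 2; ext z
  by_cases hz : z ∈ tsupport φ
  · rw [(hd z).fderiv, smul_apply, hj z hz v, smul_eq_mul]; ring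
  · simp [image_eq_zero_of_notMem_tsupport hz]

/-- The weak gradient of a nonnegative function vanishes almost everywhere on its zero set. -/
theorem WeakGradOn.ae_eq_zero (hO : IsOpen O) (hu : Measurable u) (hmem : ∀ z, u z ∈ Icc 0 K)
    (hg : LocallyIntegrableOn g O) (h : WeakGradOn O u g) :
    ∀ᵐ z, z ∈ O → u z = 0 → g z = 0 := by
  have hS : MeasurableSet {z | u z = 0} := hu (measurableSet_singleton 0)
  have hloc : LocallyIntegrableOn ({z | u z = 0}.indicator g) O := fun z hz => by
    obtain ⟨t, ht, hi⟩ := hg z hz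
    exact ⟨t, ht, hi.indicator hS⟩
  have key := hO.ae_eq_zero_of_integral_contDiff_smul_eq_zero hloc ?_
  · filter_upwards [key] with z hz hzO h0
    have := hz hzO
    rwa [indicator_of_mem (by exact h0)] at this
  intro φ hφ hc hs
  -- Cutting u and g off outside a compact set containing the support in its interior makes them
  -- globally integrable without changing the tested identity.
  obtain ⟨L, hL, hφL, hLO⟩ := exists_compact_between hc hO hs
  have hu₁ : Integrable (L.indicator u) := by
    refine (integrable_indicator_iff hL.measurableSet).2
      (Measure.integrableOn_of_bounded (M := K) hL.measure_lt_top.ne hu.aestronglyMeasurable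
        (ae_of_all _ fun z => ?_))
    rw [Real.norm_of_nonneg (hmem z).1]; exact (hmem z).2
  have hg₁ : Integrable (L.indicator g) :=
    (integrable_indicator_iff hL.measurableSet).2 (hg.integrableOn_compact_subset hLO hL)
  have hmem₁ : ∀ z, L.indicator u z ∈ Icc 0 K := fun z => by
    by_cases hz : z ∈ L
    · rw [indicator_of_mem hz]; exact hmem z
    · rw [indicator_of_notMem hz]; exact ⟨le_rfl, (hmem z).1.trans (hmem z).2⟩
  have hw := h.indicator hLO
  set u₁ := L.indicator u with hu₁d
  set g₁ := L.indicator g with hg₁d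
  have hu₁m : Measurable u₁ := hu.indicator hL.measurableSet
  obtain ⟨C₃, hC₃⟩ := hφ.continuous.bounded_above_of_compact_support hc
  have hv : ∀ v : Space n, ∫ z, φ z * ⟪({z | u z = 0}.indicator g) z, v⟫ = 0 := by
    intro v
    have hcφ : Continuous fun z => fderiv ℝ φ z (v, 0) :=
      (hφ.continuous_fderiv (by simp)).clm_apply continuous_const
    have hcsφ : HasCompactSupport fun z => fderiv ℝ φ z (v, 0) :=
      (hc.fderiv ℝ).comp_left (g := fun L : SpaceTime n →L[ℝ] ℝ => L (v, 0)) (by simp)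
    have hiv : Integrable fun z => φ z * ⟪g₁ z, v⟫ := by
      have : Integrable fun z => ⟪g₁ z, v⟫ := hg₁.inner_const v
      exact this.bdd_mul hφ.continuous.aestronglyMeasurable (ae_of_all _ hC₃)
    -- the functions `x - κ + κ² / (x + κ)` approximate the identity
    set κ : ℕ → ℝ := fun j => 1 / ((j : ℝ) + 1) with hκ
    have hκ0 : ∀ j, 0 < κ j := fun j => by simp only [hκ]; positivity
    have hκl : Tendsto κ atTop (𝓝 0) := tendsto_one_div_add_atTop_nhds_zero_nat
    have hid : ∀ j, ∫ z, (u₁ z - κ j + κ j ^ 2 / (u₁ z + κ j)) * fderiv ℝ φ z (v, 0) =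
        -∫ z, φ z * ((1 - κ j ^ 2 / (u₁ z + κ j) ^ 2) * ⟪g₁ z, v⟫) := fun j => by
      refine hw.integral_comp (f := fun x => x - κ j + κ j ^ 2 / (x + κ j))
        (f' := fun x => 1 - κ j ^ 2 / (x + κ j) ^ 2) isOpen_interior hu₁ hmem₁ hg₁ (fun x hx => ?_)
        (fun x hx => ?_) hφ hc hφL v
      · have hx0 : x + κ j ≠ 0 := by have := hκ0 j; positivity
        have d1 : HasDerivAt (fun x => x + κ j) 1 x := (hasDerivAt_id x).add_const _
        have d2 := ((hasDerivAt_id x).sub_const (κ j)).add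
            ((hasDerivAt_const x (κ j ^ 2)).div d1 hx0)
        refine d2.congr_deriv ?_
        ring
      · have hx0 : x + κ j ≠ 0 := by
          have := hκ0 j; have : 0 ≤ x := hx; positivity
        refine ContinuousAt.continuousWithinAt ?_
        exact continuousAt_const.sub (continuousAt_const.div (by fun_prop) (pow_ne_zero 2 hx0))
    have hl1 : Tendsto (fun j => ∫ z, (u₁ z - κ j + κ j ^ 2 / (u₁ z + κ j)) *
        fderiv ℝ φ z (v, 0)) atTop (𝓝 (∫ z, u₁ z * fderiv ℝ φ z (v, 0))) := by
      refine tendsto_integral_of_dominated_convergence (fun z => K * ‖fderiv ℝ φ z (v, 0)‖)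
        (fun j => ?_) ((hcφ.integrable_of_hasCompactSupport hcsφ).norm.const_mul _)
        (fun j => ae_of_all _ fun z => ?_) (ae_of_all _ fun z => ?_)
      · exact (((hu₁m.sub_const _).add (measurable_const.div (hu₁m.add_const _))).mul
          hcφ.measurable).aestronglyMeasurable
      · rw [norm_mul]
        have h0 := (hmem₁ z).1
        have h1 := hκ0 j
        -- This form shows that the approximants lie between 0 and u. Their derivatives vanish at u
        -- = 0 for every j and tend to 1 where u > 0.
        have e : u₁ z - κ j + κ j ^ 2 / (u₁ z + κ j) = u₁ z ^ 2 / (u₁ z + κ j) := by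
          field_simp; ring
        have : ‖u₁ z - κ j + κ j ^ 2 / (u₁ z + κ j)‖ ≤ K := by
          rw [e, Real.norm_of_nonneg (by positivity)]
          refine le_trans ?_ (hmem₁ z).2
          rw [div_le_iff₀ (by positivity)]; nlinarith
        gcongr
      · refine Tendsto.mul_const _ ?_
        have h0 := (hmem₁ z).1
        rcases h0.eq_or_lt with h1 | h1
        · have e : ∀ j, u₁ z - κ j + κ j ^ 2 / (u₁ z + κ j) = u₁ z := fun j => by
            have := hκ0 j
            rw [← h1]; field_simp; ring
          simp only [e]; exact tendsto_const_nhds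
        · have := (tendsto_const_nhds (x := u₁ z)).sub hκl |>.add ((hκl.pow 2).div
            ((tendsto_const_nhds (x := u₁ z)).add hκl) (by simpa using h1.ne'))
          simpa using this
    have hl2 : Tendsto (fun j => ∫ z, φ z * ((1 - κ j ^ 2 / (u₁ z + κ j) ^ 2) * ⟪g₁ z, v⟫)) atTop
        (𝓝 (∫ z, {z | u₁ z ≠ 0}.indicator (fun z => φ z * ⟪g₁ z, v⟫) z)) := by
      refine tendsto_integral_of_dominated_convergence (fun z => ‖φ z * ⟪g₁ z, v⟫‖)
        (fun j => ?_) hiv.norm (fun j => ae_of_all _ fun z => ?_) (ae_of_all _ fun z => ?_)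
      · refine hφ.continuous.aestronglyMeasurable.mul (AEStronglyMeasurable.mul ?_
          (hg₁.inner_const v).aestronglyMeasurable)
        exact (measurable_const.sub (measurable_const.div
          ((hu₁m.add_const _).pow_const 2))).aestronglyMeasurable
      · have h0 := (hmem₁ z).1
        have e1 : κ j ^ 2 / (u₁ z + κ j) ^ 2 ≤ 1 := by
          rw [div_le_one (by positivity)]; gcongr; linarith
        have e0 : 0 ≤ κ j ^ 2 / (u₁ z + κ j) ^ 2 := by positivity
        rw [norm_mul, norm_mul, norm_mul]
        gcongr
        refine mul_le_of_le_one_left (norm_nonneg _) ?_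
        rw [Real.norm_of_nonneg (by linarith)]; linarith
      · have h0 := (hmem₁ z).1
        rcases h0.eq_or_lt with h1 | h1
        · have e : ∀ j, φ z * ((1 - κ j ^ 2 / (u₁ z + κ j) ^ 2) * ⟪g₁ z, v⟫) = 0 := fun j => by
            have := hκ0 j
            rw [← h1, zero_add, div_self (by positivity)]; simp
          simp only [e]
          rw [indicator_of_notMem (by simp [← h1])]; exact tendsto_const_nhds
        · rw [indicator_of_mem (by exact h1.ne')]
          have := (tendsto_const_nhds (x := (1 : ℝ))).sub ((hκl.pow 2).div
            (((tendsto_const_nhds (x := u₁ z)).add hκl).pow 2) (by simpa using h1.ne'))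
          have := (this.mul_const ⟪g₁ z, v⟫).const_mul (φ z)
          simpa using this
    -- In the limit, g restricted to {u ≠ 0} is also a weak gradient of u; comparison with g itself
    -- shows that the part on {u = 0} integrates to zero against every test function.
    have h1 : ∫ z, u₁ z * fderiv ℝ φ z (v, 0) =
        -∫ z, {z | u₁ z ≠ 0}.indicator (fun z => φ z * ⟪g₁ z, v⟫) z :=
      tendsto_nhds_unique hl1 (hl2.neg.congr fun j => (hid j).symm)
    have h2 := hw φ hφ hc hφL v
    rw [h2, neg_inj] at h1
    have hS₁ : MeasurableSet {z | u₁ z ≠ 0} := hu₁m (measurableSet_singleton 0).compl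
    have h3 : ∫ z, (φ z * ⟪g₁ z, v⟫ - {z | u₁ z ≠ 0}.indicator (fun z => φ z * ⟪g₁ z, v⟫) z) =
        0 := by
      rw [integral_sub hiv (hiv.indicator hS₁), h1, sub_self]
    refine Eq.trans ?_ h3
    congr 1; ext z
    by_cases hz : z ∈ L
    · have e1 : g₁ z = g z := indicator_of_mem hz _
      have e2 : u₁ z = u z := indicator_of_mem hz _
      by_cases h0 : u z = 0
      · rw [indicator_of_mem (by exact h0), indicator_of_notMem (by simp [e2, h0]), e1, sub_zero]
      · rw [indicator_of_notMem (by exact h0), indicator_of_mem (by simpa [e2] using h0)]; simp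
    · have : φ z = 0 := image_eq_zero_of_notMem_tsupport fun h0 => hz (interior_subset (hφL h0))
      simp [this, indicator_apply]
  refine ext_inner_right ℝ fun v => ?_
  rw [inner_zero_left]
  refine Eq.trans ?_ (hv v)
  rw [real_inner_comm, ← integral_inner]
  · simp only [inner_smul_right, real_inner_comm]
  · have := (hloc.integrableOn_compact_subset hs hc)
    have h1 : IntegrableOn (fun z => φ z • {z | u z = 0}.indicator g z) (tsupport φ) :=
      this.bdd_smul C₃ hφ.continuous.aestronglyMeasurable (ae_of_all _ hC₃)
    refine (integrableOn_iff_integrable_of_support_subset fun z hz => ?_).1 h1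
    by_contra hn
    exact hz (by simp [image_eq_zero_of_notMem_tsupport hn])

end stampacchia

end

/-! ### From linear structure conditions to the normalized flux bounds. -/

noncomputable section

/-- The structure constant of the normalized equation. -/
def fluxConst (d₀ d₁ c C₃ C₄ : ℝ) : ℝ := d₁ + 1 / (c * d₀) + C₃ * √(d₁ / c) + d₁ * √C₄

theorem fluxConst_pos {d₀ d₁ c C₃ C₄ : ℝ} (hd₀ : 0 < d₀) (hd₁ : 0 < d₁) (hc : 0 < c)
    (hC₃ : 0 ≤ C₃) : 0 < fluxConst d₀ d₁ c C₃ C₄ := by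
  unfold fluxConst; positivity

/-- A diffusion coefficient times a vector field with linear structure conditions. -/
structure IsScaledFlux {n : ℕ} (q d₀ d₁ c C₂ C₃ C₄ ε ρ v : ℝ) (F g : Space n) : Prop where
  eq_smul : ∃ (D : ℝ) (A : Space n), F = D • A ∧ ε * d₀ ≤ D ∧ D ≤ d₁ * v ^ (-q) ∧
    c * ‖g‖ ^ 2 - C₂ * ρ ^ 2 * v ^ 2 ≤ ⟪A, g⟫ ∧ ‖A‖ ≤ C₃ * ‖g‖ + C₄ * ρ * v

/-- The upper bound on D turns the negative part D C₂ρ²v² of the coercivity into at most C R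
v^{2-q}, so the energy density dominates D c‖g‖². The lower bound on D then gives coercivity, and
splitting D‖g‖ as √D · √D‖g‖ gives growth with only half of the singularity. -/
theorem IsScaledFlux.bounds {n : ℕ} {q d₀ d₁ c C₂ C₃ C₄ ε ρ v R : ℝ} {F g : Space n}
    (h : IsScaledFlux q d₀ d₁ c C₂ C₃ C₄ ε ρ v F g) (hd₀ : 0 < d₀) (hd₁ : 0 < d₁) (hc : 0 < c)
    (hC₂ : 0 ≤ C₂) (hC₃ : 0 ≤ C₃) (hC₄ : 0 ≤ C₄) (hε : 0 < ε) (hρ : 0 < ρ) (hv : 0 < v)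
    (hR : R = 2 + (C₂ + C₄) * ρ ^ 2) {C : ℝ} (hC : C = fluxConst d₀ d₁ c C₃ C₄) :
    ε * ‖g‖ ^ 2 ≤ C * (⟪F, g⟫ + C * R * v ^ (2 - q)) ∧
      ‖F‖ ≤ C * (v ^ (-q / 2) * √(⟪F, g⟫ + C * R * v ^ (2 - q)) + √R * v ^ (1 - q)) := by
  obtain ⟨D, A, rfl, hD₀, hD₁, hco, hgr⟩ := h.eq_smul
  have hCd : d₁ ≤ C := by
    rw [hC, fluxConst]
    have : 0 ≤ 1 / (c * d₀) + C₃ * √(d₁ / c) + d₁ * √C₄ := by positivity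
    linarith
  have hC1 : 1 / (c * d₀) ≤ C := by
    rw [hC, fluxConst]
    have : 0 ≤ d₁ + C₃ * √(d₁ / c) + d₁ * √C₄ := by positivity
    linarith
  have hC3 : C₃ * √(d₁ / c) ≤ C := by
    rw [hC, fluxConst]
    have : 0 ≤ d₁ + 1 / (c * d₀) + d₁ * √C₄ := by positivity
    linarith
  have hC4 : d₁ * √C₄ ≤ C := by
    rw [hC, fluxConst]
    have : 0 ≤ d₁ + 1 / (c * d₀) + C₃ * √(d₁ / c) := by positivity
    linarith
  have hC0 : 0 < C := by linarith
  have hD : 0 < D := lt_of_lt_of_le (by positivity) hD₀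
  have hR2 : C₂ * ρ ^ 2 ≤ R := by
    have : 0 ≤ C₄ * ρ ^ 2 := by positivity
    rw [hR]; linarith
  have hR4 : C₄ * ρ ^ 2 ≤ R := by
    have : 0 ≤ C₂ * ρ ^ 2 := by positivity
    rw [hR]; linarith
  have hR0 : 0 ≤ R := le_trans (by positivity) hR2
  have hDv : D * v ^ 2 ≤ d₁ * v ^ (2 - q) := by
    calc D * v ^ 2 ≤ d₁ * v ^ (-q) * v ^ 2 := by gcongr
      _ = d₁ * (v ^ (-q) * v ^ (2 : ℝ)) := by rw [mul_assoc]; norm_cast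
      _ = _ := by rw [← Real.rpow_add hv]; ring_nf
  have hDv1 : D * v ≤ d₁ * v ^ (1 - q) := by
    calc D * v ≤ d₁ * v ^ (-q) * v := by gcongr
      _ = d₁ * (v ^ (-q) * v ^ (1 : ℝ)) := by rw [mul_assoc, Real.rpow_one]
      _ = _ := by rw [← Real.rpow_add hv]; ring_nf
  set E := ⟪D • A, g⟫ + C * R * v ^ (2 - q) with hE
  have hED : D * (c * ‖g‖ ^ 2) ≤ E := by
    have h1 : D * (c * ‖g‖ ^ 2 - C₂ * ρ ^ 2 * v ^ 2) ≤ ⟪D • A, g⟫ := by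
      rw [real_inner_smul_left]; gcongr
    have h2 : C₂ * ρ ^ 2 * (D * v ^ 2) ≤ R * (C * v ^ (2 - q)) := by
      have : d₁ * v ^ (2 - q) ≤ C * v ^ (2 - q) := by gcongr
      calc _ ≤ R * (d₁ * v ^ (2 - q)) := by gcongr
        _ ≤ _ := by gcongr
    rw [hE]; linarith
  constructor
  · calc ε * ‖g‖ ^ 2 = 1 / (c * d₀) * (ε * d₀ * (c * ‖g‖ ^ 2)) := by field_simp
      _ ≤ 1 / (c * d₀) * (D * (c * ‖g‖ ^ 2)) := by gcongr
      _ ≤ C * E := by gcongr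
  · have h1 : D * ‖g‖ ≤ √(d₁ / c) * (v ^ (-q / 2) * √E) := by
      have e1 : v ^ (-q / 2) = √(v ^ (-q)) := by
        rw [Real.sqrt_eq_rpow, ← Real.rpow_mul hv.le]; congr 1; ring
      rw [e1, ← Real.sqrt_mul (by positivity), ← Real.sqrt_mul (by positivity)]
      refine Real.le_sqrt_of_sq_le ?_
      calc (D * ‖g‖) ^ 2 = D * (D * (c * ‖g‖ ^ 2)) / c := by field_simp
        _ ≤ d₁ * v ^ (-q) * E / c := by gcongr
        _ = _ := by ring
    -- Taking a square root of C₄ρ² ≤ R keeps √R, not R, in the growth bound; this is what yields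
    -- the exponent 1/(2q) later.
    have h2 : C₄ * ρ ≤ √C₄ * √R := by
      calc C₄ * ρ = √C₄ * √(C₄ * ρ ^ 2) := by
            rw [Real.sqrt_mul hC₄, Real.sqrt_sq hρ.le, ← mul_assoc, Real.mul_self_sqrt hC₄]
        _ ≤ _ := by gcongr
    calc ‖D • A‖ = D * ‖A‖ := by rw [norm_smul, Real.norm_of_nonneg hD.le]
      _ ≤ D * (C₃ * ‖g‖ + C₄ * ρ * v) := by gcongr
      _ = C₃ * (D * ‖g‖) + C₄ * ρ * (D * v) := by ring
      _ ≤ C₃ * (√(d₁ / c) * (v ^ (-q / 2) * √E)) + √C₄ * √R * (d₁ * v ^ (1 - q)) := by gcongr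
      _ = C₃ * √(d₁ / c) * (v ^ (-q / 2) * √E) + d₁ * √C₄ * (√R * v ^ (1 - q)) := by ring
      _ ≤ C * (v ^ (-q / 2) * √E) + C * (√R * v ^ (1 - q)) := by gcongr
      _ = _ := by ring

theorem WeakGradOn.congr {n : ℕ} {O : Set (SpaceTime n)} {u u' : SpaceTime n → ℝ}
    {g g' : SpaceTime n → Space n} (h : WeakGradOn O u g) (hu : ∀ᵐ z, z ∈ O → u' z = u z)
    (hg : ∀ᵐ z, z ∈ O → g' z = g z) : WeakGradOn O u' g' := by
  intro φ hφ hc hs v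
  refine Eq.trans (integral_congr_ae ?_)
      ((h φ hφ hc hs v).trans (congrArg _ (integral_congr_ae ?_)))
  · filter_upwards [hu] with z hz
    by_cases hzs : z ∈ tsupport φ
    · simp only [hz (hs hzs)]
    · have : fderiv ℝ φ z = 0 := by
        by_contra hne
        exact hzs (support_fderiv_subset ℝ hne)
      simp [this]
  · filter_upwards [hg] with z hz
    by_cases hzs : z ∈ tsupport φ
    · simp only [hz (hs hzs)]
    · simp [image_eq_zero_of_notMem_tsupport hzs]

theorem WeakDivOn.congr {n : ℕ} {O : Set (SpaceTime n)} {u u' : SpaceTime n → ℝ}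
    {F F' : SpaceTime n → Space n} (h : WeakDivOn O u F) (hu : ∀ᵐ z, z ∈ O → u' z = u z)
    (hF : ∀ᵐ z, z ∈ O → F' z = F z) : WeakDivOn O u' F' := by
  intro φ hφ hc hs
  have hd : ∀ z ∉ tsupport φ, fderiv ℝ φ z = 0 := fun z hzs => by
    by_contra hne
    exact hzs (support_fderiv_subset ℝ hne)
  refine Eq.trans (integral_congr_ae ?_) ((h φ hφ hc hs).trans (integral_congr_ae ?_))
  · filter_upwards [hu] with z hz
    by_cases hzs : z ∈ tsupport φ
    · simp only [hz (hs hzs)]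
    · simp [hd z hzs]
  · filter_upwards [hF] with z hz
    by_cases hzs : z ∈ tsupport φ
    · simp only [hz (hs hzs)]
    · simp [hd z hzs]

/-- Measurable representatives of a solution in the normalized cylinder. -/
theorem exists_boxSolution {n : ℕ} {q d₀ d₁ c C₂ C₃ C₄ ε ρ R K : ℝ} {v : SpaceTime n → ℝ}
    {F g : SpaceTime n → Space n} (hq : 0 < q) (hq1 : q < 1) (hd₀ : 0 < d₀) (hd₁ : 0 < d₁)
    (hc : 0 < c) (hC₂ : 0 ≤ C₂) (hC₃ : 0 ≤ C₃) (hC₄ : 0 ≤ C₄) (hε : 0 < ε) (hρ : 0 < ρ)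
    (hR : R = 2 + (C₂ + C₄) * ρ ^ 2)
    (hvm : AEStronglyMeasurable v (volume.restrict (unitBox n)))
    (hmem : ∀ᵐ z, z ∈ unitBox n → v z ∈ Icc 0 K) (hg : LocallyIntegrableOn g (unitBox n))
    (hF : MemLp F 2 (volume.restrict (unitBox n))) (hgrad : WeakGradOn (unitBox n) v g)
    (hdiv : WeakDivOn (unitBox n) v F)
    (hpos : ∀ᵐ z, z ∈ unitBox n → 0 < v z →
      IsScaledFlux q d₀ d₁ c C₂ C₃ C₄ ε ρ (v z) (F z) (g z))
    (hzero : ∀ᵐ z, z ∈ unitBox n → v z = 0 → g z = 0 → F z = 0) :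
    ∃ (u : SpaceTime n → ℝ) (F' g' : SpaceTime n → Space n), BoxSolution K u F' g' ∧
      FluxBounds q (fluxConst d₀ d₁ c C₃ C₄) R ε u F' g' ∧
      ∀ᵐ z, z ∈ unitBox n → u z = v z := by
  have hbox : MeasurableSet (unitBox n) := isOpen_unitBox.measurableSet
  have hgm : AEStronglyMeasurable g (volume.restrict (unitBox n)) := hg.aestronglyMeasurable
  obtain ⟨C, hC⟩ : ∃ C, C = fluxConst d₀ d₁ c C₃ C₄ := ⟨_, rfl⟩
  have hC0 : 0 < C := hC ▸ fluxConst_pos hd₀ hd₁ hc hC₃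
  have hR0 : 0 < R := by rw [hR]; positivity
  have hK : 0 ≤ K := by
    by_contra! hneg
    have h1 : ∀ᵐ z, z ∉ unitBox n := by
      filter_upwards [hmem] with z hz hzb
      have := hz hzb
      linarith [this.1, this.2]
    have h2 : volume (unitBox n) = 0 := measure_eq_zero_iff_ae_notMem.2 h1
    exact (isOpen_unitBox.measure_pos volume ⟨0, by simp [unitBox]⟩).ne' h2
  -- Clamping the measurable representative makes the bounds 0 ≤ u ≤ K hold at every point, not just
  -- almost everywhere.
  set u : SpaceTime n → ℝ := (unitBox n).indicator fun z => max 0 (min K (hvm.mk v z)) with hu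
  set F' : SpaceTime n → Space n := (unitBox n).indicator (hF.1.mk F) with hF'
  set g' : SpaceTime n → Space n := (unitBox n).indicator (hgm.mk g) with hg'
  have hum : Measurable u :=
    (measurable_const.max (measurable_const.min hvm.stronglyMeasurable_mk.measurable)).indicator
      hbox
  have hFm : Measurable F' := hF.1.stronglyMeasurable_mk.measurable.indicator hbox
  have hgm' : Measurable g' := hgm.stronglyMeasurable_mk.measurable.indicator hbox
  have huK : ∀ z, u z ∈ Icc 0 K := fun z => by
    by_cases hz : z ∈ unitBox n
    · rw [hu, indicator_of_mem hz]
      exact ⟨le_max_left _ _, max_le hK (min_le_left _ _)⟩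
    · rw [hu, indicator_of_notMem hz]; exact ⟨le_rfl, hK⟩
  have huv : ∀ᵐ z, z ∈ unitBox n → u z = v z := by
    filter_upwards [(ae_restrict_iff' hbox).1 hvm.ae_eq_mk, hmem] with z h1 h2 hz
    rw [hu, indicator_of_mem hz, ← h1 hz, min_eq_right (h2 hz).2, max_eq_right (h2 hz).1]
  have hFF : ∀ᵐ z, z ∈ unitBox n → F' z = F z := by
    filter_upwards [(ae_restrict_iff' hbox).1 hF.1.ae_eq_mk] with z h1 hz
    rw [hF', indicator_of_mem hz, h1 hz]
  have hgg : ∀ᵐ z, z ∈ unitBox n → g' z = g z := by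
    filter_upwards [(ae_restrict_iff' hbox).1 hgm.ae_eq_mk] with z h1 hz
    rw [hg', indicator_of_mem hz, h1 hz]
  have hu0 : ∀ z, z ∉ unitBox n → u z = 0 := fun z hz => indicator_of_notMem hz _
  have hF0 : ∀ z, z ∉ unitBox n → F' z = 0 := fun z hz => indicator_of_notMem hz _
  have hg0 : ∀ z, z ∉ unitBox n → g' z = 0 := fun z hz => indicator_of_notMem hz _
  have hgrad' := hgrad.congr huv hgg
  have hgloc : LocallyIntegrableOn g' (unitBox n) := by
    rw [locallyIntegrableOn_iff isOpen_unitBox.isLocallyClosed] at hg ⊢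
    intro k hk hkc
    refine (hg k hk hkc).congr ?_
    filter_upwards [ae_restrict_of_ae hgg, ae_restrict_mem hkc.measurableSet] with z h1 h2
    exact (h1 (hk h2)).symm
  -- On {u = 0} the structure conditions say nothing about the coefficient; the vanishing gradient
  -- is what makes the flux vanish there too.
  have hstam := hgrad'.ae_eq_zero isOpen_unitBox hum huK hgloc
  have hzero' : ∀ᵐ z, u z = 0 → g' z = 0 ∧ F' z = 0 := by
    filter_upwards [hstam, hzero, huv, hFF, hgg] with z h1 h2 h3 h4 h5 h0
    by_cases hz : z ∈ unitBox n
    · have := h1 hz h0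
      exact ⟨this, by
        rw [h4 hz]; exact h2 hz (by rw [← h3 hz]; exact h0) (by rw [← h5 hz]; exact this)⟩
    · exact ⟨hg0 z hz, hF0 z hz⟩
  have hpos' : ∀ᵐ z, 0 < u z → IsScaledFlux q d₀ d₁ c C₂ C₃ C₄ ε ρ (u z) (F' z) (g' z) := by
    filter_upwards [hpos, huv, hFF, hgg] with z h1 h2 h3 h4 h0
    by_cases hz : z ∈ unitBox n
    · rw [h2 hz, h3 hz, h4 hz]
      exact h1 hz (by rw [← h2 hz]; exact h0)
    · rw [hu0 z hz] at h0; exact absurd h0 (lt_irrefl _)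
  have hflux : FluxBounds q C R ε u F' g' := by
    constructor
    · filter_upwards [hzero', hpos'] with z h1 h2
      rcases (huK z).1.eq_or_lt with h0 | h0
      · simp [(h1 h0.symm).1, energyDensity, ← h0, Real.zero_rpow (show 2 - q ≠ 0 by linarith)]
      · exact ((h2 h0).bounds hd₀ hd₁ hc hC₂ hC₃ hC₄ hε hρ h0 hR hC).1
    · filter_upwards [hzero', hpos'] with z h1 h2
      rcases (huK z).1.eq_or_lt with h0 | h0
      · have := (huK z).1
        rw [(h1 h0.symm).2, norm_zero]
        positivity
      · exact ((h2 h0).bounds hd₀ hd₁ hc hC₂ hC₃ hC₄ hε hρ h0 hR hC).2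
  have hFsq : Integrable fun z => ‖F' z‖ ^ 2 := by
    have h1 : IntegrableOn (fun z => ‖F z‖ ^ 2) (unitBox n) :=
        hF.integrable_norm_pow (p := 2) (by simp)
    have h2 := (integrable_indicator_iff hbox).2 h1
    refine h2.congr ?_
    filter_upwards [hFF] with z hz
    by_cases hzb : z ∈ unitBox n
    · rw [indicator_of_mem hzb, hz hzb]
    · rw [indicator_of_notMem hzb, hF0 z hzb]; simp
  refine ⟨u, F', g', ⟨hum, hFm, hgm', huK, hu0, hF0, hg0, hFsq, ?_, hgrad', hdiv.congr huv hFF⟩,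
    hC ▸ hflux, huv⟩
  -- Square integrability of the gradient was not assumed: it follows from that of the flux by
  -- coercivity. This bound depends on ε and K, but only finiteness is used.
  have hb : Integrable ((unitBox n).indicator fun _ => 2 * C ^ 2 * R / ε * K ^ (2 - q)) :=
    (integrable_indicator_iff hbox).2 (integrableOn_const volume_unitBox_lt_top.ne)
  refine ((hFsq.const_mul (C ^ 2 / ε ^ 2)).add hb).mono'
    (hgm'.norm.pow_const 2).aestronglyMeasurable ?_
  filter_upwards [hflux.coercive] with z hz
  rw [Real.norm_of_nonneg (sq_nonneg _)]
  by_cases hzb : z ∈ unitBox n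
  · simp only [Pi.add_apply]
    rw [indicator_of_mem hzb]
    have h1 := real_inner_le_norm (F' z) (g' z)
    have h2 : u z ^ (2 - q) ≤ K ^ (2 - q) := Real.rpow_le_rpow (huK z).1 (huK z).2 (by linarith)
    have h3 : ε * ‖g' z‖ ^ 2 ≤ C * (‖F' z‖ * ‖g' z‖ + C * R * K ^ (2 - q)) :=
      hz.trans (by unfold energyDensity; gcongr)
    have h4 : 0 ≤ (ε * ‖g' z‖ - C * ‖F' z‖) ^ 2 := sq_nonneg _
    have h5 : ‖g' z‖ ^ 2 * ε ^ 2 ≤ C ^ 2 * ‖F' z‖ ^ 2 + 2 * C ^ 2 * R * K ^ (2 - q) * ε := by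
      nlinarith
    have e : C ^ 2 / ε ^ 2 * ‖F' z‖ ^ 2 + 2 * C ^ 2 * R / ε * K ^ (2 - q) =
      (C ^ 2 * ‖F' z‖ ^ 2 + 2 * C ^ 2 * R * K ^ (2 - q) * ε) / ε ^ 2 := by field_simp
    rw [e, le_div_iff₀ (by positivity)]
    exact h5
  · rw [hg0 z hzb]
    simp only [Pi.add_apply]
    rw [indicator_of_notMem hzb]
    simp
    positivity

end

/-! ### Affine changes of variables in the weak formulations. -/

noncomputable section

section affine
variable {V : Type*} [NormedAddCommGroup V] [NormedSpace ℝ V]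

/-- The affine homeomorphism `x ↦ a + L x`. -/
def affineHomeomorph (a : V) (L : V ≃L[ℝ] V) : V ≃ₜ V := L.toHomeomorph.trans (Homeomorph.addLeft a)

theorem affineHomeomorph_apply (a : V) (L : V ≃L[ℝ] V) (x : V) :
    affineHomeomorph a L x = a + L x := rfl

variable [FiniteDimensional ℝ V] [MeasurableSpace V] [BorelSpace V]

/-- Uniqueness of Haar measure. The value of the factor is not needed, since it multiplies both
sides of every weak identity. -/
theorem exists_map_affineHomeomorph (μ : Measure V) [μ.IsAddHaarMeasure] (a : V) (L : V ≃L[ℝ] V) :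
    ∃ k : NNReal, 0 < k ∧ μ.map (affineHomeomorph a L) = k • μ := by
  have h1 : (μ.map L).IsAddHaarMeasure := L.isAddHaarMeasure_map μ
  refine ⟨(μ.map L).addHaarScalarFactor μ,
    Measure.addHaarScalarFactor_pos_of_isAddHaarMeasure _ _, ?_⟩
  rw [← Measure.isAddLeftInvariant_eq_smul (μ.map L) μ]
  have e : (affineHomeomorph a L : V → V) = (fun x => a + x) ∘ L := rfl
  rw [e, ← Measure.map_map (measurable_const_add a) L.continuous.measurable,
    map_add_left_eq_self]

variable {μ : Measure V} [μ.IsAddHaarMeasure] {a : V} {L : V ≃L[ℝ] V}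

theorem ae_affineHomeomorph_iff {p : V → Prop} :
    (∀ᵐ x ∂μ, p (affineHomeomorph a L x)) ↔ ∀ᵐ x ∂μ, p x := by
  obtain ⟨k, hk, hmap⟩ := exists_map_affineHomeomorph μ a L
  rw [← (affineHomeomorph a L).measurableEmbedding.ae_map_iff, hmap,
    Measure.ae_smul_measure_iff hk.ne']

theorem exists_integral_affineHomeomorph (μ : Measure V) [μ.IsAddHaarMeasure] (a : V)
    (L : V ≃L[ℝ] V) : ∃ k : ℝ, 0 < k ∧ ∀ f : V → ℝ,
      ∫ x, f (affineHomeomorph a L x) ∂μ = k * ∫ x, f x ∂μ := by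
  obtain ⟨k, hk, hmap⟩ := exists_map_affineHomeomorph μ a L
  refine ⟨k, hk, fun f => ?_⟩
  rw [← (affineHomeomorph a L).measurableEmbedding.integral_map, hmap, integral_smul_nnreal_measure]
  rfl

theorem memLp_comp_affineHomeomorph {W : Type*} [NormedAddCommGroup W] {f : V → W} {s : Set V}
    {p : ENNReal} (h : MemLp f p (μ.restrict s)) :
    MemLp (f ∘ affineHomeomorph a L) p (μ.restrict (affineHomeomorph a L ⁻¹' s)) := by
  obtain ⟨k, hk, hmap⟩ := exists_map_affineHomeomorph μ a L
  rw [← (affineHomeomorph a L).measurableEmbedding.memLp_map_measure_iff,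
    ← (affineHomeomorph a L).measurableEmbedding.restrict_map, hmap, Measure.restrict_smul]
  exact h.smul_measure (c := (k : ENNReal)) ENNReal.coe_ne_top

theorem locallyIntegrableOn_comp_affineHomeomorph {W : Type*} [NormedAddCommGroup W] {f : V → W}
    {s : Set V} (hs : IsOpen s) (h : LocallyIntegrableOn f s μ) :
    LocallyIntegrableOn (f ∘ affineHomeomorph a L) (affineHomeomorph a L ⁻¹' s) μ := by
  rw [locallyIntegrableOn_iff (hs.preimage (affineHomeomorph a L).continuous).isLocallyClosed]
  rw [locallyIntegrableOn_iff hs.isLocallyClosed] at h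
  intro k hk hkc
  have h1 := h _ (image_subset_iff.2 hk) (hkc.image (affineHomeomorph a L).continuous)
  have h2 := memLp_comp_affineHomeomorph (a := a) (L := L) (memLp_one_iff_integrable.2 h1)
  rw [preimage_image_eq _ (affineHomeomorph a L).injective] at h2
  exact memLp_one_iff_integrable.1 h2

end affine

/-- The dilation `(x, τ) ↦ (ρ x, ℓ τ)`. -/
def dilation (n : ℕ) {ρ ℓ : ℝ} (hρ : ρ ≠ 0) (hℓ : ℓ ≠ 0) : SpaceTime n ≃L[ℝ] SpaceTime n :=
  ((LinearEquiv.smulOfNeZero ℝ (Space n) ρ hρ).prodCongr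
    (LinearEquiv.smulOfNeZero ℝ ℝ ℓ hℓ)).toContinuousLinearEquiv

theorem dilation_apply {n : ℕ} {ρ ℓ : ℝ} (hρ : ρ ≠ 0) (hℓ : ℓ ≠ 0) (z : SpaceTime n) :
    dilation n hρ hℓ z = (ρ • z.1, ℓ * z.2) := rfl

section pullback
variable {n : ℕ} {ρ ℓ M s : ℝ} {y : Space n} {Q : Set (SpaceTime n)} {u : SpaceTime n → ℝ}
  {F g : SpaceTime n → Space n}

/-- Pulling back test functions along an affine map. -/
theorem exists_testFunction_comp (a : SpaceTime n) (L : SpaceTime n ≃L[ℝ] SpaceTime n)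
    {φ : SpaceTime n → ℝ} (hφ : ContDiff ℝ ∞ φ) (hc : HasCompactSupport φ)
    (hs : tsupport φ ⊆ affineHomeomorph a L ⁻¹' Q) : ∃ ψ : SpaceTime n → ℝ, ContDiff ℝ ∞ ψ ∧
      HasCompactSupport ψ ∧ tsupport ψ ⊆ Q ∧ (∀ z, φ z = ψ (affineHomeomorph a L z)) ∧
      ∀ z w, fderiv ℝ φ z w = fderiv ℝ ψ (affineHomeomorph a L z) (L w) := by
  have hψ : ContDiff ℝ ∞ (φ ∘ (affineHomeomorph a L).symm) := by
    have e : ((affineHomeomorph a L).symm : SpaceTime n → SpaceTime n) =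
      fun z => L.symm (-a + z) := rfl
    rw [e]
    exact hφ.comp (L.symm.contDiff.comp (contDiff_const.add contDiff_id))
  have hφψ : ∀ z, φ z = (φ ∘ (affineHomeomorph a L).symm) (affineHomeomorph a L z) := fun z => by
    simp
  refine ⟨_, hψ, hc.comp_homeomorph _, ?_, hφψ, fun z w => ?_⟩
  · rw [tsupport_comp_eq_preimage]
    intro z hz
    have := hs hz
    simpa using this
  · have h1 : HasFDerivAt (affineHomeomorph a L) (L : SpaceTime n →L[ℝ] SpaceTime n) z :=
      (L.hasFDerivAt).const_add a
    have h2 := ((hψ.differentiable (by simp) (affineHomeomorph a L z)).hasFDerivAt).comp z h1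
    have e : (φ ∘ (affineHomeomorph a L).symm) ∘ affineHomeomorph a L = φ := by
      ext z; exact (hφψ z).symm
    rw [e] at h2
    rw [h2.fderiv]; rfl

/-- The spatial derivative of a pulled back test function carries a factor ρ; the identity for the
original test function is multiplied by ρ/M. -/
theorem WeakGradOn.comp_affine (h : WeakGradOn Q u g) (hρ : ρ ≠ 0) (hℓ : ℓ ≠ 0)
    (a : SpaceTime n) (M : ℝ) :
    WeakGradOn (affineHomeomorph a (dilation n hρ hℓ) ⁻¹' Q)
      (fun z => u (affineHomeomorph a (dilation n hρ hℓ) z) / M)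
      (fun z => (ρ / M) • g (affineHomeomorph a (dilation n hρ hℓ) z)) := by
  intro φ hφ hc hs v
  obtain ⟨ψ, hψ, hψc, hψs, h1, h2⟩ := exists_testFunction_comp a (dilation n hρ hℓ) hφ hc hs
  obtain ⟨k, hk, hint⟩ := exists_integral_affineHomeomorph volume a (dilation n hρ hℓ)
  have e := h ψ hψ hψc hψs v
  have e1 := hint fun z => ρ / M * (u z * fderiv ℝ ψ z (v, 0))
  have e2 := hint fun z => ρ / M * (ψ z * ⟪g z, v⟫)
  have e3 : ∫ z, ρ / M * (u z * fderiv ℝ ψ z (v, 0)) = -∫ z, ρ / M * (ψ z * ⟪g z, v⟫) := by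
    rw [integral_const_mul, integral_const_mul, e, mul_neg]
  rw [e3, mul_neg, ← e2] at e1
  calc _ = _ := integral_congr_ae (ae_of_all _ fun z => ?_)
    _ = _ := e1
    _ = _ := congrArg _ (integral_congr_ae (ae_of_all _ fun z => ?_))
  · simp only [h2, dilation_apply, mul_zero]
    have : ((ρ • v, (0 : ℝ)) : SpaceTime n) = ρ • (v, 0) := by simp
    rw [this, map_smul, smul_eq_mul]; ring
  · simp only [h1, real_inner_smul_left]; ring

/-- The time derivative carries ℓ and the spatial one ρ, so the flux is rescaled by ℓ/(Mρ). -/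
theorem WeakDivOn.comp_affine (h : WeakDivOn Q u F) (hρ : ρ ≠ 0) (hℓ : ℓ ≠ 0)
    (a : SpaceTime n) (M : ℝ) :
    WeakDivOn (affineHomeomorph a (dilation n hρ hℓ) ⁻¹' Q)
      (fun z => u (affineHomeomorph a (dilation n hρ hℓ) z) / M)
      (fun z => (ℓ / (M * ρ)) • F (affineHomeomorph a (dilation n hρ hℓ) z)) := by
  intro φ hφ hc hs
  obtain ⟨ψ, hψ, hψc, hψs, h1, h2⟩ := exists_testFunction_comp a (dilation n hρ hℓ) hφ hc hs
  obtain ⟨k, hk, hint⟩ := exists_integral_affineHomeomorph volume a (dilation n hρ hℓ)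
  have e := h ψ hψ hψc hψs
  have e1 := hint fun z => ℓ / M * (u z * fderiv ℝ ψ z (0, 1))
  have e2 := hint fun z => ℓ / M * fderiv ℝ ψ z (F z, 0)
  have e3 : ∫ z, ℓ / M * (u z * fderiv ℝ ψ z (0, 1)) = ∫ z, ℓ / M * fderiv ℝ ψ z (F z, 0) := by
    rw [integral_const_mul, integral_const_mul, e]
  rw [e3, ← e2] at e1
  calc _ = _ := integral_congr_ae (ae_of_all _ fun z => ?_)
    _ = _ := e1
    _ = _ := integral_congr_ae (ae_of_all _ fun z => ?_)
  · simp only [h2, dilation_apply, smul_zero, mul_one]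
    have : (((0 : Space n), ℓ) : SpaceTime n) = ℓ • (0, 1) := by simp
    rw [this, map_smul, smul_eq_mul]; ring
  · simp only [h2, dilation_apply, mul_zero]
    have : ∀ w : Space n, ((ρ • (ℓ / (M * ρ)) • w, (0 : ℝ)) : SpaceTime n) = (ℓ / M) • (w, 0) := by
      intro w
      rw [smul_smul, show ρ * (ℓ / (M * ρ)) = ℓ / M by
        rw [mul_div_assoc', mul_comm ρ ℓ, mul_div_mul_right _ _ hρ]]
      simp
    rw [this, map_smul, smul_eq_mul]

theorem affineHomeomorph_preimage_cylinder (y : Space n) {ρ ℓ : ℝ} (hρ : 0 < ρ) (hℓ : 0 < ℓ)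
    (s r a b : ℝ) :
    affineHomeomorph ((y, s) : SpaceTime n) (dilation n hρ.ne' hℓ.ne') ⁻¹'
      (Metric.ball y (r * ρ) ×ˢ Ioo (s + ℓ * a) (s + ℓ * b)) = Metric.ball 0 r ×ˢ Ioo a b := by
  ext z
  simp only [mem_preimage, affineHomeomorph_apply, dilation_apply, mem_prod, Prod.fst_add,
    Prod.snd_add, Metric.mem_ball, dist_self_add_left, dist_zero_right, norm_smul, mem_Ioo,
    add_lt_add_iff_left, Real.norm_of_nonneg hρ.le]
  rw [mul_comm ρ, mul_lt_mul_iff_left₀ hρ, mul_lt_mul_iff_right₀ hℓ, mul_lt_mul_iff_right₀ hℓ]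

/-- Here the Jacobian does matter: it is the ρ^{-n} in front of the mass. -/
theorem setIntegral_ball_comp (y : Space n) (hρ : 0 < ρ) (r : ℝ) (f : Space n → ℝ) :
    ∫ x in Metric.ball 0 r, f (y + ρ • x) = (ρ ^ n)⁻¹ * ∫ x in Metric.ball y (r * ρ), f x := by
  rw [← integral_indicator measurableSet_ball, ← integral_indicator measurableSet_ball]
  have e : ∀ x, (Metric.ball (0 : Space n) r).indicator (fun x => f (y + ρ • x)) x =
      (fun x => (Metric.ball y (r * ρ)).indicator f (y + x)) (ρ • x) := fun x => by
    have : x ∈ Metric.ball (0 : Space n) r ↔ y + ρ • x ∈ Metric.ball y (r * ρ) := by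
      simp only [Metric.mem_ball, dist_self_add_left, dist_zero_right, norm_smul,
        Real.norm_of_nonneg hρ.le]
      rw [mul_comm ρ, mul_lt_mul_iff_left₀ hρ]
    by_cases hx : x ∈ Metric.ball (0 : Space n) r
    · simp only [indicator_of_mem hx, indicator_of_mem (this.1 hx)]
    · simp only [indicator_of_notMem hx, indicator_of_notMem fun h => hx (this.2 h)]
  rw [integral_congr_ae (ae_of_all _ e), Measure.integral_comp_smul volume
    (fun x => (Metric.ball y (r * ρ)).indicator f (y + x)), integral_add_left_eq_self,
      finrank_euclideanSpace_fin,
    abs_of_pos (by positivity), smul_eq_mul]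

end pullback

end

/-! ### Undoing the intrinsic scaling. -/

noncomputable section

/-- The Harnack-type estimate in a cylinder that is short in time. -/
theorem exists_le_mass_cylinder (n : ℕ) (hn : 2 ≤ n) {q d₀ d₁ c C₂ C₃ C₄ : ℝ} (hq : 0 < q)
    (hq1 : q < 1) (hd₀ : 0 < d₀) (hd₁ : 0 < d₁) (hc : 0 < c) (hC₂ : 0 ≤ C₂) (hC₃ : 0 ≤ C₃)
    (hC₄ : 0 ≤ C₄) : ∃ γ : ℝ, 0 < γ ∧
    ∀ {ρ s t K R ε M : ℝ} {y : Space n} {Q : Set (SpaceTime n)} {u D : SpaceTime n → ℝ}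
      {A g : SpaceTime n → Space n},
      0 < ρ → s < t → ε = (t - s) / ρ ^ 2 → ε ≤ 1 → R = 2 + (C₂ + C₄) * ρ ^ 2 →
      M = ε ^ (1 / q) → Q = Metric.ball y (4 * ρ) ×ˢ Ioo (2 * s - t) t →
      LocallyIntegrableOn u Q → LocallyIntegrableOn g Q →
      MemLp (fun z => D z • A z) 2 (volume.restrict Q) → (∀ᵐ z, z ∈ Q → u z ∈ Icc 0 K) →
      WeakGradOn Q u g → WeakDivOn Q u (fun z => D z • A z) →
      (∀ᵐ z, z ∈ Q → c * ‖g z‖ ^ 2 - C₂ * u z ^ 2 ≤ ⟪A z, g z⟫ ∧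
        ‖A z‖ ≤ C₃ * ‖g z‖ + C₄ * u z) →
      (∀ᵐ z, z ∈ Q → 0 < u z → d₀ ≤ D z ∧ D z ≤ d₁ * u z ^ (-q)) →
      ∀ᵐ σ : ℝ, σ ∈ Ioo (2 * s - t) t → ∀ᵐ z, z ∈ Metric.ball y ρ ×ˢ Ioo s t →
        u z ≤ γ * (R * (R / ε) ^ (n / 2 : ℝ) * (ρ ^ n)⁻¹ * (∫ x in Metric.ball y (4 * ρ), u (x, σ))
          + M * (1 + R * (R / ε) ^ (n / 2 : ℝ) * R ^ (1 / (2 * q)))) := by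
  obtain ⟨γ, hγ, hmain⟩ := exists_le_mass_slice n hn hq hq1
    (fluxConst_pos (C₄ := C₄) hd₀ hd₁ hc hC₃)
  refine ⟨γ, hγ, ?_⟩
  intro ρ s t K R ε M y Q u D A g hρ hst hεd hε1 hR hM hQ hu hg hF hmem hgrad hdiv hA hD
  set ℓ := t - s with hℓd
  have hℓ : 0 < ℓ := by linarith
  have hε : 0 < ε := by rw [hεd]; positivity
  have hM0 : 0 < M := by rw [hM]; positivity
  have hR1 : 1 ≤ R := by
    have : 0 ≤ (C₂ + C₄) * ρ ^ 2 := by positivity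
    linarith
  -- The unit M is fixed by this relation: it converts ε u^{-q} into v^{-q} with no leftover factor.
  have hMq : M ^ q = ε := by
    rw [hM, ← Real.rpow_mul hε.le, one_div_mul_cancel hq.ne', Real.rpow_one]
  set Φ := affineHomeomorph ((y, s) : SpaceTime n) (dilation n hρ.ne' hℓ.ne') with hΦ
  have hpre : Φ ⁻¹' Q = unitBox n := by
    rw [hQ, unitBox, ← affineHomeomorph_preimage_cylinder y hρ hℓ s 4 (-1) 1]
    have e1 : s + ℓ * -1 = 2 * s - t := by rw [hℓd]; ring
    have e2 : s + ℓ * 1 = t := by rw [hℓd]; ring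
    rw [e1, e2]
  have hQo : IsOpen Q := by rw [hQ]; exact Metric.isOpen_ball.prod isOpen_Ioo
  have hmemQ : ∀ z, z ∈ unitBox n → Φ z ∈ Q := fun z hz => by
    rw [← hpre] at hz; exact hz
  have hpull : ∀ {p : SpaceTime n → Prop}, (∀ᵐ z, z ∈ Q → p z) →
      ∀ᵐ z, z ∈ unitBox n → p (Φ z) := fun {p} h => by
    filter_upwards [(ae_affineHomeomorph_iff (a := ((y, s) : SpaceTime n))
      (L := dilation n hρ.ne' hℓ.ne')).2 h] with z hz hzb
    exact hz (hmemQ z hzb)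
  have hρM : 0 < ρ / M := by positivity
  obtain ⟨u', F', g', hbox, hflux, huv⟩ := exists_boxSolution (n := n) (q := q) (d₀ := d₀)
    (d₁ := d₁) (c := c) (C₂ := C₂) (C₃ := C₃) (C₄ := C₄) (ε := ε) (ρ := ρ) (R := R) (K := K / M)
    (v := fun z => u (Φ z) / M) (F := fun z => (ℓ / (M * ρ)) • (D (Φ z) • A (Φ z)))
    (g := fun z => (ρ / M) • g (Φ z)) hq hq1 hd₀ hd₁ hc hC₂ hC₃ hC₄ hε hρ hR
    (by
      have := (locallyIntegrableOn_comp_affineHomeomorph (a := ((y, s) : SpaceTime n))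
        (L := dilation n hρ.ne' hℓ.ne') hQo hu).aestronglyMeasurable
      rw [← hΦ, hpre] at this
      exact (this.mul_const M⁻¹).congr (ae_of_all _ fun z => by simp [div_eq_mul_inv]))
    (by
      filter_upwards [hpull hmem] with z hz hzb
      have := hz hzb
      exact ⟨div_nonneg this.1 hM0.le, div_le_div_of_nonneg_right this.2 hM0.le⟩)
    (by
      have := locallyIntegrableOn_comp_affineHomeomorph (a := ((y, s) : SpaceTime n))
        (L := dilation n hρ.ne' hℓ.ne') hQo hg
      rw [← hΦ, hpre] at this
      exact this.smul (ρ / M))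
    (by
      have := memLp_comp_affineHomeomorph (a := ((y, s) : SpaceTime n))
        (L := dilation n hρ.ne' hℓ.ne') hF
      rw [← hΦ, hpre] at this
      exact this.const_smul (ℓ / (M * ρ)))
    (by have := hgrad.comp_affine hρ.ne' hℓ.ne' (y, s) M; rwa [← hΦ, hpre] at this)
    (by have := hdiv.comp_affine hρ.ne' hℓ.ne' (y, s) M; rwa [← hΦ, hpre] at this)
    (by
      filter_upwards [hpull hA, hpull hD] with z h1 h2 hzb hv
      obtain ⟨hco, hgr⟩ := h1 hzb
      have huz : 0 < u (Φ z) := by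
        have := mul_pos hv hM0
        rwa [div_mul_cancel₀ _ hM0.ne'] at this
      obtain ⟨hD0, hD1⟩ := h2 hzb huz
      -- Since ℓ/(Mρ) = ε · ρ/M, the factor ε goes to the coefficient and ρ/M to the vector field,
      -- where it matches the scaling of the gradient.
      refine ⟨ε * D (Φ z), (ρ / M) • A (Φ z), ?_, by gcongr, ?_, ?_, ?_⟩
      · rw [smul_smul, smul_smul]; congr 1; rw [hεd]; field_simp
      · rw [Real.div_rpow huz.le hM0.le, Real.rpow_neg hM0.le, hMq]
        calc _ ≤ ε * (d₁ * u (Φ z) ^ (-q)) := by gcongr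
          _ = _ := by field_simp
      · rw [real_inner_smul_left, real_inner_smul_right, norm_smul, Real.norm_of_nonneg hρM.le]
        have := mul_le_mul_of_nonneg_left hco (sq_nonneg (ρ / M))
        calc _ = (ρ / M) ^ 2 * (c * ‖g (Φ z)‖ ^ 2 - C₂ * u (Φ z) ^ 2) := by field_simp
          _ ≤ _ := this
          _ = _ := by ring
      · rw [norm_smul, norm_smul, Real.norm_of_nonneg hρM.le]
        calc _ ≤ ρ / M * (C₃ * ‖g (Φ z)‖ + C₄ * u (Φ z)) := by gcongr
          _ = _ := by ring)
    (by
      filter_upwards [hpull hA] with z h1 hzb hv hg0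
      obtain ⟨-, hgr⟩ := h1 hzb
      have h2 : u (Φ z) = 0 := by simpa [hM0.ne'] using hv
      have h3 : g (Φ z) = 0 := by simpa [hρM.ne', hρ.ne', hM0.ne'] using hg0
      rw [h2, h3, norm_zero, mul_zero, mul_zero, add_zero] at hgr
      rw [norm_le_zero_iff.1 hgr]; simp)
  set N := R * (R / ε) ^ (n / 2 : ℝ) with hN
  -- The time part of the change of variables, used on its own to carry "almost every time" back to
  -- the original interval.
  set L₁ : ℝ ≃L[ℝ] ℝ := (LinearEquiv.smulOfNeZero ℝ ℝ ℓ hℓ.ne').toContinuousLinearEquiv with hL₁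
  have hL₁a : ∀ τ, affineHomeomorph s L₁ τ = s + ℓ * τ := fun τ => rfl
  refine (ae_affineHomeomorph_iff (a := s) (L := L₁)).1 ?_
  filter_upwards [hbox.ae_mem_goodTimes, ae_time_of_ae huv] with τ hτ1 hτ2 hτm
  rw [hL₁a] at hτm ⊢
  have hτ : τ ∈ Ioo (-1 : ℝ) 1 := by
    constructor
    · have := hτm.1
      by_contra! hcon
      have := mul_le_mul_of_nonneg_left hcon hℓ.le
      linarith
    · have := hτm.2
      by_contra! hcon
      have := mul_le_mul_of_nonneg_left hcon hℓ.le
      linarith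
  have hslice : ∫ x in Metric.ball 0 4, u' (x, τ) =
      M⁻¹ * ((ρ ^ n)⁻¹ * ∫ x in Metric.ball y (4 * ρ), u (x, s + ℓ * τ)) := by
    rw [← setIntegral_ball_comp y hρ 4 (fun x => u (x, s + ℓ * τ)), ← integral_const_mul]
    refine setIntegral_congr_ae measurableSet_ball ?_
    filter_upwards [hτ2] with x hx hxb
    rw [hx ⟨hxb, hτ⟩, div_eq_inv_mul]
    rfl
  have hfin := hmain hbox hflux hε hε1 hR1 τ (hτ1 hτ)
  rw [hslice, ae_restrict_iff' (measurableSet_ball.prod measurableSet_Ioo)] at hfin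
  refine (ae_affineHomeomorph_iff (a := ((y, s) : SpaceTime n))
    (L := dilation n hρ.ne' hℓ.ne')).1 ?_
  filter_upwards [hfin, huv] with z h1 h2 hz
  rw [← hΦ] at hz ⊢
  have hz1 : z ∈ (Metric.ball 0 1 ×ˢ Ioo 0 1 : Set (SpaceTime n)) := by
    rw [← affineHomeomorph_preimage_cylinder y hρ hℓ s 1 0 1, ← hΦ]
    have e1 : s + ℓ * 0 = s := by ring
    have e2 : s + ℓ * 1 = t := by rw [hℓd]; ring
    rw [e1, e2, one_mul]
    exact hz
  have hzb : z ∈ unitBox n :=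
    ⟨Metric.ball_subset_ball (by norm_num) hz1.1, by linarith [hz1.2.1], hz1.2.2⟩
  have h3 := h1 hz1
  rw [h2 hzb, div_le_iff₀ hM0] at h3
  refine h3.trans (le_of_eq ?_)
  field_simp
  ring

end

/-! ### The homogeneous power form, and translation of the weak formulations. -/

noncomputable section

/-- Bound of a power of `2 + (C₂ + C₄) ρ²` by the lower order term of the estimate. -/
theorem exists_rpow_le_lowerOrder {q C₂ C₄ : ℝ} (hq : 0 < q) (hC₂ : 0 ≤ C₂)
    (hC₄ : 0 ≤ C₄) : ∃ c : ℝ, 0 ≤ c ∧ ∀ ρ : ℝ, 0 < ρ → (2 + (C₂ + C₄) * ρ ^ 2) ^ (1 / (2 * q)) ≤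
      c * (√(1 + C₄) + (C₄ + √(C₂ + C₄)) * ρ ^ (1 / q)) := by
  set e := 1 / (2 * q) with he
  have he0 : 0 < e := by positivity
  set σ := C₂ + C₄ with hσ
  have hσ0 : 0 ≤ σ := by positivity
  refine ⟨2 ^ e * (2 ^ e + σ ^ (e - 1 / 2)), by positivity, fun ρ hρ => ?_⟩
  -- Only √σ has to appear explicitly; the rest of the power of σ = C₂ + C₄ goes into the constant,
  -- and 2e = 1/q gives the power of ρ.
  have h1 : (σ * ρ ^ 2) ^ e = σ ^ (e - 1 / 2) * √σ * ρ ^ (1 / q) := by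
    rw [Real.mul_rpow hσ0 (by positivity)]
    congr 1
    · rcases hσ0.eq_or_lt with h0 | h0
      · rw [← h0, Real.zero_rpow he0.ne']; simp
      · rw [Real.sqrt_eq_rpow, ← Real.rpow_add h0]; congr 1; ring
    · rw [← Real.rpow_natCast, ← Real.rpow_mul hρ.le]; congr 1; rw [he]; push_cast; field_simp
  have h2 : (2 + σ * ρ ^ 2) ^ e ≤ 2 ^ e * (2 ^ e + (σ * ρ ^ 2) ^ e) := by
    have h4 : 2 + σ * ρ ^ 2 ≤ 2 * max 2 (σ * ρ ^ 2) := by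
      have := le_max_left 2 (σ * ρ ^ 2); have := le_max_right 2 (σ * ρ ^ 2); linarith
    calc (2 + σ * ρ ^ 2) ^ e ≤ (2 * max 2 (σ * ρ ^ 2)) ^ e :=
          Real.rpow_le_rpow (by positivity) h4 he0.le
      _ = 2 ^ e * max 2 (σ * ρ ^ 2) ^ e := Real.mul_rpow (by norm_num) (by positivity)
      _ ≤ _ := by
        gcongr
        have a1 : 0 ≤ (2 : ℝ) ^ e := by positivity
        have a2 : 0 ≤ (σ * ρ ^ 2) ^ e := by positivity
        rcases max_choice 2 (σ * ρ ^ 2) with h | h <;> rw [h] <;> linarith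
  refine h2.trans ?_
  rw [h1]
  have b1 : 1 ≤ √(1 + C₄) := Real.one_le_sqrt.2 (by linarith)
  set B := √(1 + C₄) + (C₄ + √σ) * ρ ^ (1 / q) with hB
  have k1 : 1 ≤ B := by
    have : 0 ≤ (C₄ + √σ) * ρ ^ (1 / q) := by positivity
    linarith
  have k2 : √σ * ρ ^ (1 / q) ≤ B := by
    have : 0 ≤ C₄ * ρ ^ (1 / q) := by positivity
    rw [hB]; nlinarith
  calc 2 ^ e * (2 ^ e + σ ^ (e - 1 / 2) * √σ * ρ ^ (1 / q))
      = 2 ^ e * (2 ^ e * 1 + σ ^ (e - 1 / 2) * (√σ * ρ ^ (1 / q))) := by ring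
    _ ≤ 2 ^ e * (2 ^ e * B + σ ^ (e - 1 / 2) * B) := by gcongr
    _ = _ := by ring

/-- Comparison of the scaled linear estimate with the homogeneous power form. -/
theorem linear_le_power {n : ℕ} {q θ ρ ℓ R ε M I B Z c : ℝ} (hq : 0 < q) (hθ : θ = 2 - n * q)
    (hθ0 : 0 < θ) (hρ : 0 < ρ) (hℓ : 0 < ℓ) (hε : ε = ℓ / ρ ^ 2) (hε1 : ε ≤ 1)
    (hM : M = ε ^ (1 / q)) (hR : 1 ≤ R) (hI : 0 ≤ I) (hB : 1 ≤ B) (hc : 0 ≤ c) (hZ : Z ≤ c * B) :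
    R * (R / ε) ^ (n / 2 : ℝ) * (ρ ^ n)⁻¹ * I + M * (1 + R * (R / ε) ^ (n / 2 : ℝ) * Z) ≤
      (2 + c) * (R ^ ((n + 2) / θ) * (ℓ + ρ ^ 2) ^ ((n + 2) / θ) / ℓ ^ (2 * (n + 1) / θ) *
          I ^ (2 / θ) +
        (1 + R ^ ((n + 2) / θ) * (ℓ + ρ ^ 2) ^ ((n + 2) / θ) / ℓ ^ ((n + 2) / θ) * B ^ (2 / θ)) *
          M) := by
  have hε0 : 0 < ε := by rw [hε]; positivity
  have hM0 : 0 < M := by rw [hM]; positivity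
  have hR0 : 0 < R := by linarith
  set p := 2 / θ with hp
  -- Holds because θ = 2 - nq ≤ 2.
  have hp1 : 1 ≤ p := by
    rw [hp, le_div_iff₀ hθ0, hθ]
    have : 0 ≤ n * q := by positivity
    linarith
  set N := R * (R / ε) ^ (n / 2 : ℝ) with hN
  have hRε : 1 ≤ R / ε := by rw [le_div_iff₀ hε0]; linarith
  have hN1 : 1 ≤ N := one_le_mul_of_one_le_of_one_le hR (Real.one_le_rpow hRε (by positivity))
  set Γ := (R * ((ℓ + ρ ^ 2) / ℓ)) ^ ((n + 2) / 2 : ℝ) with hΓ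
  have hΓ0 : 0 < Γ := by positivity
  -- Uses 1/ε = ρ²/ℓ ≤ (ℓ + ρ²)/ℓ, after one factor R has been enlarged to R/ε.
  have hNΓ : N ≤ Γ := by
    have h1 : R / ε ≤ R * ((ℓ + ρ ^ 2) / ℓ) := by
      rw [hε, div_div_eq_mul_div, mul_div_assoc]
      gcongr
      linarith
    calc N ≤ (R / ε) * (R / ε) ^ (n / 2 : ℝ) := by
          rw [hN]; gcongr
          rw [le_div_iff₀ hε0]
          exact mul_le_of_le_one_right hR0.le hε1
      _ = (R / ε) ^ ((n + 2) / 2 : ℝ) := by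
          rw [show ((n + 2) / 2 : ℝ) = 1 + n / 2 by ring, Real.rpow_add (by positivity),
            Real.rpow_one]
      _ ≤ Γ := by rw [hΓ]; gcongr
  have hΓp : Γ ^ p = R ^ ((n + 2) / θ) * (ℓ + ρ ^ 2) ^ ((n + 2) / θ) / ℓ ^ ((n + 2) / θ) := by
    have e : ((n + 2) / 2 * p : ℝ) = (n + 2) / θ := by rw [hp]; field_simp
    rw [hΓ, ← Real.rpow_mul (by positivity), e, Real.mul_rpow hR0.le (by positivity),
      Real.div_rpow (by positivity) hℓ.le, mul_div_assoc]
  have hΓℓ : Γ ^ p * ℓ ^ (-(n / θ)) =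
      R ^ ((n + 2) / θ) * (ℓ + ρ ^ 2) ^ ((n + 2) / θ) / ℓ ^ (2 * (n + 1) / θ) := by
    rw [hΓp, Real.rpow_neg hℓ.le, ← div_eq_mul_inv, div_div, ← Real.rpow_add hℓ]
    congr 2; ring
  rw [← hΓp, ← hΓℓ]
  -- With p = 2/θ, both (1 - p)/q and -np/2 equal -n/θ, so ε and ρ² carry the same exponent and only
  -- ερ² = ℓ survives.
  have hsc : M ^ (1 - p) * ((ρ ^ n)⁻¹) ^ p = ℓ ^ (-(n / θ)) := by
    have e1 : M ^ (1 - p) = ε ^ (-(n / θ)) := by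
      rw [hM, ← Real.rpow_mul hε0.le]; congr 1
      rw [hp]; field_simp; rw [hθ]; ring
    have e2 : ((ρ ^ n)⁻¹) ^ p = (ρ ^ 2) ^ (-(n / θ)) := by
      rw [Real.inv_rpow (by positivity), ← Real.rpow_natCast, ← Real.rpow_natCast,
        ← Real.rpow_mul hρ.le, ← Real.rpow_mul hρ.le, ← Real.rpow_neg hρ.le]
      congr 1; rw [hp]; push_cast; ring
    rw [e1, e2, ← Real.mul_rpow hε0.le (by positivity), hε, div_mul_cancel₀ _ (by positivity)]
  -- The mass measured in units of M obeys X ≤ 1 + X^p; the 1 joins the lower order term and X^p is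
  -- scale free by the previous identity.
  have t1 : N * (ρ ^ n)⁻¹ * I ≤ M + Γ ^ p * ℓ ^ (-(n / θ)) * I ^ p := by
    set X := N * (ρ ^ n)⁻¹ * I / M with hX
    have hX0 : 0 ≤ X := by positivity
    have h1 := rpow_le_one_add_rpow (v := X) hX0 zero_le_one hp1
    rw [Real.rpow_one] at h1
    have h2 : X ^ p = N ^ p * ((ρ ^ n)⁻¹) ^ p * I ^ p / M ^ p := by
      rw [hX, Real.div_rpow (by positivity) hM0.le, Real.mul_rpow (by positivity) hI,
        Real.mul_rpow (by positivity) (by positivity)]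
    have h3 : M * X ^ p = N ^ p * (M ^ (1 - p) * ((ρ ^ n)⁻¹) ^ p) * I ^ p := by
      rw [h2, Real.rpow_sub hM0, Real.rpow_one]; ring
    have h4 : N * (ρ ^ n)⁻¹ * I = M * X := by rw [hX]; field_simp
    rw [h4]
    calc M * X ≤ M * (1 + X ^ p) := by gcongr
      _ = M + N ^ p * ℓ ^ (-(n / θ)) * I ^ p := by rw [mul_add, mul_one, h3, hsc]
      _ ≤ _ := by gcongr
  have t2 : N * Z ≤ c * (Γ ^ p * B ^ p) := by
    have h1 : 1 ≤ Γ * B := one_le_mul_of_one_le_of_one_le (hN1.trans hNΓ) hB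
    have h2 : Γ * B ≤ Γ ^ p * B ^ p := by
      rw [← Real.mul_rpow hΓ0.le (by linarith)]
      calc Γ * B = (Γ * B) ^ (1 : ℝ) := (Real.rpow_one _).symm
        _ ≤ _ := Real.rpow_le_rpow_of_exponent_le h1 hp1
    calc N * Z ≤ N * (c * B) := by gcongr
      _ ≤ Γ * (c * B) := by gcongr
      _ = c * (Γ * B) := by ring
      _ ≤ _ := by gcongr
  have t3 := mul_le_mul_of_nonneg_left t2 hM0.le
  have p1 : 0 ≤ Γ ^ p * ℓ ^ (-(n / θ)) * I ^ p := by positivity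
  have p2 : 0 ≤ Γ ^ p * B ^ p * M := by positivity
  have p3 := mul_nonneg hc p1
  have p4 := mul_nonneg hc hM0.le
  linarith

section testFunctions
variable {n : ℕ} {φ : SpaceTime n → ℝ} {E : Set (Space n)} {T : ℝ} {O : Set (SpaceTime n)}

theorem inner_spaceGrad (hφ : ContDiff ℝ ∞ φ) (z : SpaceTime n) (v : Space n) :
    ⟪v, spaceGrad φ z⟫ = fderiv ℝ φ z (v, 0) := by
  have h1 : HasFDerivAt (fun x => φ (x, z.2))
      ((fderiv ℝ φ z).comp (ContinuousLinearMap.inl ℝ (Space n) ℝ)) z.1 :=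
    hasFDerivAt_slice (hφ.differentiable (by simp) (z.1, z.2)).hasFDerivAt
  rw [spaceGrad, real_inner_comm, gradient, InnerProductSpace.toDual_symm_apply, h1.fderiv]
  rfl

theorem timeDeriv_eq (hφ : ContDiff ℝ ∞ φ) (z : SpaceTime n) :
    timeDeriv φ z = fderiv ℝ φ z (0, 1) := by
  have h1 : HasFDerivAt φ (fderiv ℝ φ z) (z.1, z.2) :=
    (hφ.differentiable (by simp) z).hasFDerivAt
  have h2 : HasDerivAt (fun τ : ℝ => (z.1, τ)) ((0 : Space n), (1 : ℝ)) z.2 :=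
    (hasDerivAt_const _ _).prodMk (hasDerivAt_id _)
  exact (h1.comp_hasDerivAt z.2 h2).deriv

theorem continuous_spaceGrad (hφ : ContDiff ℝ ∞ φ) : Continuous (spaceGrad φ) := by
  have e : spaceGrad φ = fun z => (InnerProductSpace.toDual ℝ (Space n)).symm
      ((fderiv ℝ φ z).comp (ContinuousLinearMap.inl ℝ (Space n) ℝ)) := by
    ext1 z
    refine ext_inner_left ℝ fun v => ?_
    rw [inner_spaceGrad hφ, real_inner_comm, InnerProductSpace.toDual_symm_apply]; rfl
  rw [e]
  exact (InnerProductSpace.toDual ℝ (Space n)).symm.continuous.comp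
    ((hφ.continuous_fderiv (by simp)).clm_comp continuous_const)

theorem spaceGrad_eq_zero (hφ : ContDiff ℝ ∞ φ) {z : SpaceTime n} (hz : z ∉ tsupport φ) :
    spaceGrad φ z = 0 := by
  have h0 : fderiv ℝ φ z = 0 := by
    by_contra hne
    exact hz (support_fderiv_subset ℝ hne)
  refine ext_inner_left ℝ fun v => ?_
  rw [inner_spaceGrad hφ, h0]; simp

theorem integrable_of_locallyIntegrableOn {W : Type*} [NormedAddCommGroup W] {f : SpaceTime n → W}
    {G : SpaceTime n → ℝ} (hG : LocallyIntegrableOn G O) {S : Set (SpaceTime n)}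
    (hS : IsCompact S) (hSO : S ⊆ O) {C : ℝ}
    (hf : AEStronglyMeasurable f (volume.restrict S)) (hb : ∀ z, ‖f z‖ ≤ C * G z)
    (hf0 : ∀ z, z ∉ S → f z = 0) : Integrable f := by
  have h1 : IntegrableOn f S := ((hG.integrableOn_compact_subset hSO hS).const_mul C).mono' hf
    (ae_of_all _ hb)
  refine (integrableOn_iff_integrable_of_support_subset fun z hz => ?_).1 h1
  by_contra hn
  exact hz (hf0 z hn)

/-- The vector identity is paired with a fixed direction. Integrals over the domain equal integrals
over all of space-time since test functions vanish outside. -/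
theorem HasWeakSpaceGrad.weakGradOn {u : SpaceTime n → ℝ} {g : SpaceTime n → Space n}
    (h : HasWeakSpaceGrad E T u g) : WeakGradOn (E ×ˢ Ioo 0 T) u g := by
  intro φ hφ hc hs v
  have hO : E ×ˢ Ioo 0 T ⊆ parDomain E T := prod_mono_right Ioo_subset_Ioc_self
  have e := h.integral_eq φ ⟨hφ, hc, hs⟩
  have hcg := continuous_spaceGrad hφ
  have hgc : HasCompactSupport (spaceGrad φ) := hc.of_isClosed_subset (isClosed_tsupport _)
    (closure_minimal (fun z hz => by
      by_contra hn; exact hz (spaceGrad_eq_zero hφ hn)) (isClosed_tsupport _))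
  obtain ⟨C₁, hC₁⟩ := hcg.bounded_above_of_compact_support hgc
  obtain ⟨C₂, hC₂⟩ := hφ.continuous.bounded_above_of_compact_support hc
  have i1 : Integrable fun z => u z • spaceGrad φ z := by
    refine integrable_of_locallyIntegrableOn (C := C₁) h.locallyIntegrable.norm hc hs
      ((h.locallyIntegrable.integrableOn_compact_subset hs hc).aestronglyMeasurable.smul
        hcg.aestronglyMeasurable) (fun z => ?_) fun z hz => by
          rw [spaceGrad_eq_zero hφ hz, smul_zero]
    rw [norm_smul, mul_comm]; gcongr; exact hC₁ z
  have i2 : Integrable fun z => φ z • g z := by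
    refine integrable_of_locallyIntegrableOn (C := C₂) h.locallyIntegrable_grad.norm hc hs
      (hφ.continuous.aestronglyMeasurable.smul
        (h.locallyIntegrable_grad.integrableOn_compact_subset hs hc).aestronglyMeasurable)
      (fun z => ?_) fun z hz => by rw [image_eq_zero_of_notMem_tsupport hz, zero_smul]
    rw [norm_smul]; gcongr; exact hC₂ z
  rw [setIntegral_eq_integral_of_forall_compl_eq_zero fun z hz => by
      rw [spaceGrad_eq_zero hφ fun h0 => hz (hO (hs h0)), smul_zero],
    setIntegral_eq_integral_of_forall_compl_eq_zero fun z hz => by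
      rw [image_eq_zero_of_notMem_tsupport fun h0 => hz (hO (hs h0)), zero_smul]] at e
  have e2 := congrArg (fun w => ⟪v, w⟫) e
  simp only [inner_neg_right] at e2
  rw [← integral_inner i1, ← integral_inner i2] at e2
  simp only [inner_smul_right, inner_spaceGrad hφ] at e2
  rw [e2]
  simp only [real_inner_comm]

/-- The integral of the difference may be split only because each term is integrable: on the compact
support, an L² flux is integrable. -/
theorem weakDivOn_of_integral_eq_zero {u : SpaceTime n → ℝ} {F : SpaceTime n → Space n}
    (hu : LocallyIntegrableOn u (E ×ˢ Ioo 0 T))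
    (hF : MemLp F 2 (volume.restrict (parDomain E T)))
    (h : ∀ φ : SpaceTime n → ℝ, IsTestFunction E T φ →
      ∫ z in parDomain E T, (⟪F z, spaceGrad φ z⟫ - u z * timeDeriv φ z) = 0) :
    WeakDivOn (E ×ˢ Ioo 0 T) u F := by
  intro φ hφ hc hs
  have hO : E ×ˢ Ioo 0 T ⊆ parDomain E T := prod_mono_right Ioo_subset_Ioc_self
  have e := h φ ⟨hφ, hc, hs⟩
  have hcg := continuous_spaceGrad hφ
  have hgc : HasCompactSupport (spaceGrad φ) := hc.of_isClosed_subset (isClosed_tsupport _)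
    (closure_minimal (fun z hz => by
      by_contra hn; exact hz (spaceGrad_eq_zero hφ hn)) (isClosed_tsupport _))
  have hd0 : ∀ z, z ∉ tsupport φ → fderiv ℝ φ z = 0 := fun z hz => by
    by_contra hne
    exact hz (support_fderiv_subset ℝ hne)
  have hct : Continuous fun z => fderiv ℝ φ z (0, 1) :=
    (hφ.continuous_fderiv (by simp)).clm_apply continuous_const
  have htc : HasCompactSupport fun z => fderiv ℝ φ z (0, 1) :=
    (hc.fderiv ℝ).comp_left (g := fun L : SpaceTime n →L[ℝ] ℝ => L (0, 1)) (by simp)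
  obtain ⟨C₁, hC₁⟩ := hcg.bounded_above_of_compact_support hgc
  obtain ⟨C₂, hC₂⟩ := hct.bounded_above_of_compact_support htc
  have hFK : IntegrableOn F (tsupport φ) := by
    have h1 : MemLp F 2 (volume.restrict (tsupport φ)) :=
      hF.mono_measure (Measure.restrict_mono (hs.trans hO) le_rfl)
    have : IsFiniteMeasure (volume.restrict (tsupport φ)) :=
      ⟨by rw [Measure.restrict_apply_univ]; exact hc.measure_lt_top⟩
    exact h1.integrable one_le_two
  have i1 : Integrable fun z => ⟪F z, spaceGrad φ z⟫ := by
    have h1 : IntegrableOn (fun z => ⟪F z, spaceGrad φ z⟫) (tsupport φ) := by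
      refine (hFK.norm.const_mul C₁).mono' (hFK.aestronglyMeasurable.inner
        hcg.aestronglyMeasurable) (ae_of_all _ fun z => ?_)
      refine (norm_inner_le_norm _ _).trans ?_
      rw [mul_comm]; gcongr; exact hC₁ z
    refine (integrableOn_iff_integrable_of_support_subset fun z hz => ?_).1 h1
    by_contra hn
    exact hz (by simp only [spaceGrad_eq_zero hφ hn, inner_zero_right])
  have i2 : Integrable fun z => u z * fderiv ℝ φ z (0, 1) := by
    refine integrable_of_locallyIntegrableOn (C := C₂) hu.norm hc hs
      ((hu.integrableOn_compact_subset hs hc).aestronglyMeasurable.mul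
        hct.aestronglyMeasurable) (fun z => ?_) fun z hz => by simp [hd0 z hz]
    rw [norm_mul, mul_comm]; gcongr; exact hC₂ z
  simp only [timeDeriv_eq hφ] at e
  rw [setIntegral_eq_integral_of_forall_compl_eq_zero fun z hz => by
      have hn : z ∉ tsupport φ := fun h0 => hz (hO (hs h0))
      rw [spaceGrad_eq_zero hφ hn, hd0 z hn]; simp, integral_sub i1 i2, sub_eq_zero] at e
  simp only [inner_spaceGrad hφ] at e
  exact e.symm

end testFunctions

theorem WeakGradOn.mono {n : ℕ} {O O' : Set (SpaceTime n)} {u : SpaceTime n → ℝ}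
    {g : SpaceTime n → Space n} (h : WeakGradOn O u g) (hO : O' ⊆ O) : WeakGradOn O' u g :=
  fun φ hφ hc hs => h φ hφ hc (hs.trans hO)

theorem WeakDivOn.mono {n : ℕ} {O O' : Set (SpaceTime n)} {u : SpaceTime n → ℝ}
    {F : SpaceTime n → Space n} (h : WeakDivOn O u F) (hO : O' ⊆ O) : WeakDivOn O' u F :=
  fun φ hφ hc hs => h φ hφ hc (hs.trans hO)

end

/-! ### The essential infimum over time, and application to the system. -/

noncomputable section

/-- A bound by a power of almost every value of a bounded function passes to its essential
infimum. -/
theorem le_mul_essInf_rpow {X : Type*} [MeasurableSpace X] {μ : Measure X} [(ae μ).NeBot]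
    {f : X → ℝ} {b S γ P N p : ℝ} (h0 : ∀ᵐ x ∂μ, 0 ≤ f x) (hb : ∀ᵐ x ∂μ, f x ≤ b) (hγ : 0 ≤ γ)
    (hP : 0 ≤ P) (hp : 0 ≤ p) (h : ∀ᵐ x ∂μ, S ≤ γ * (P * f x ^ p + N)) :
    S ≤ γ * (P * essInf f μ ^ p + N) := by
  have hco := isCoboundedUnder_ge_of_eventually_le (ae μ) hb
  have hcont : ContinuousAt (fun a : ℝ => γ * (P * (essInf f μ + a) ^ p + N)) 0 := by
    have : Continuous fun a : ℝ => γ * (P * (essInf f μ + a) ^ p + N) :=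
      continuous_const.mul ((continuous_const.mul
        ((Real.continuous_rpow_const hp).comp (continuous_const.add continuous_id))).add
          continuous_const)
    exact this.continuousAt
  have hlim : Tendsto (fun a : ℝ => γ * (P * (essInf f μ + a) ^ p + N)) (𝓝[>] 0)
      (𝓝 (γ * (P * essInf f μ ^ p + N))) := by
    have := hcont.tendsto
    rw [add_zero] at this
    exact this.mono_left nhdsWithin_le_nhds
  refine ge_of_tendsto hlim ?_
  filter_upwards [self_mem_nhdsWithin] with a ha
  -- Values this close to the essential infimum are taken on a set of positive measure, which
  -- therefore meets the full-measure set where the bound holds; then a decreases to 0.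
  have hfreq : ∃ᶠ x in ae μ, f x < essInf f μ + a := by
    intro hcon
    have : essInf f μ + a ≤ essInf f μ := le_essInf_of_ae_le _
      (hcon.mono fun x hx => not_lt.1 hx) hco
    linarith [mem_Ioi.1 ha]
  obtain ⟨x, hx, hx0, hxS⟩ := (hfreq.and_eventually (h0.and h)).exists
  refine hxS.trans ?_
  gcongr

/-- Two-sided bounds of the singular coefficient `U ^ (m - 1)`. -/
theorem rpow_coefficient_bounds {m lam β L U u : ℝ} (hm : m < 1) (hlam : 0 < lam) (hu : 0 < u)
    (hU : lam * u ^ β ≤ U) (hL : U ≤ L) :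
    L ^ (m - 1) ≤ U ^ (m - 1) ∧ U ^ (m - 1) ≤ lam ^ (m - 1) * u ^ (-(β * (1 - m))) := by
  have h1 : 0 < lam * u ^ β := by positivity
  have h2 : 0 < U := h1.trans_le hU
  refine ⟨Real.rpow_le_rpow_of_nonpos h2 hL (by linarith), ?_⟩
  refine (Real.rpow_le_rpow_of_nonpos h1 hU (by linarith)).trans (le_of_eq ?_)
  rw [Real.mul_rpow hlam.le (by positivity), ← Real.rpow_mul hu.le]
  congr 2; ring

theorem le_rpow_of_mul_rpow_le {lam β L u : ℝ} (hlam : 0 < lam) (hβ : 0 < β) (hu : 0 ≤ u)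
    (h : lam * u ^ β ≤ L) : u ≤ (L / lam) ^ (1 / β) := by
  have h1 : u ^ β ≤ L / lam := by rw [le_div_iff₀ hlam]; linarith
  calc u = (u ^ β) ^ (1 / β) := by
        rw [← Real.rpow_mul hu, mul_one_div_cancel hβ.ne', Real.rpow_one]
    _ ≤ _ := Real.rpow_le_rpow (by positivity) h1 (by positivity)

variable {n k : ℕ} {E : Set (Space n)} {T m : ℝ} {y : Space n} {ρ s t : ℝ}

/-- The point (y, t) belongs to the closed-top cylinder and gives t ≤ T, so interior times stay
strictly below T. -/
theorem openCylinder_subset (hρ : 0 < ρ) (hst : s < t)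
    (h : cylinder y ρ s t ⊆ parDomain E T) :
    Metric.ball y ρ ×ˢ Ioo s t ⊆ E ×ˢ Ioo 0 T := by
  intro z hz
  have h1 := h (show z ∈ cylinder y ρ s t from ⟨hz.1, Ioo_subset_Ioc_self hz.2⟩)
  have h2 := h (show (y, t) ∈ cylinder y ρ s t from
    ⟨Metric.mem_ball_self hρ, right_mem_Ioc.2 hst⟩)
  exact ⟨h1.1, h1.2.1, hz.2.2.trans_le h2.2.2⟩

/-- The top slice, a null set, is the only difference between the two cylinders. -/
theorem ae_cylinder_iff {p : SpaceTime n → Prop} :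
    (∀ᵐ z, z ∈ cylinder y ρ s t → p z) ↔ ∀ᵐ z, z ∈ Metric.ball y ρ ×ˢ Ioo s t → p z := by
  have h0 : ∀ᵐ z : SpaceTime n, z.2 ≠ t :=
    Measure.quasiMeasurePreserving_snd.ae (Measure.ae_ne volume t)
  constructor <;> intro h
  · exact h.mono fun z hz hzb => hz ⟨hzb.1, Ioo_subset_Ioc_self hzb.2⟩
  · filter_upwards [h, h0] with z h1 h2 hz
    exact h1 ⟨hz.1, hz.2.1, lt_of_le_of_ne hz.2.2 h2⟩

theorem essSup_cylinder_le {f : SpaceTime n → ℝ} {b : ℝ} (hρ : 0 < ρ) (hst : s < t)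
    (h0 : ∀ᵐ z, z ∈ Metric.ball y ρ ×ˢ Ioo s t → 0 ≤ f z)
    (hb : ∀ᵐ z, z ∈ Metric.ball y ρ ×ˢ Ioo s t → f z ≤ b) :
    essSup f (volume.restrict (cylinder y ρ s t)) ≤ b := by
  have hms : MeasurableSet (cylinder y ρ s t) := measurableSet_ball.prod measurableSet_Ioc
  have hne : (ae ((volume : Measure (SpaceTime n)).restrict (cylinder y ρ s t))).NeBot := by
    rw [ae_neBot, Ne, Measure.restrict_eq_zero]
    refine ((Metric.isOpen_ball.prod isOpen_Ioo).measure_pos volume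
      (((Metric.nonempty_ball (x := y)).2 hρ).prod (nonempty_Ioo.2 hst)) |>.trans_le
        (measure_mono (prod_mono_right Ioo_subset_Ioc_self))).ne'
  exact essSup_le_of_ae_le b ((ae_restrict_iff' hms).2 (ae_cylinder_iff.2 hb))
    (isCoboundedUnder_le_of_eventually_le _ ((ae_restrict_iff' hms).2 (ae_cylinder_iff.2 h0)))

theorem setIntegral_ball_mem_Icc {f : Space n → ℝ} {K : ℝ}
    (h : ∀ᵐ x, x ∈ Metric.ball y ρ → f x ∈ Icc 0 K) :
    ∫ x in Metric.ball y ρ, f x ∈ Icc 0 (K * volume.real (Metric.ball y ρ)) := by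
  have h1 := (ae_restrict_iff' measurableSet_ball).2 h
  refine ⟨integral_nonneg_of_ae (h1.mono fun x hx => hx.1), ?_⟩
  calc ∫ x in Metric.ball y ρ, f x ≤ ∫ _ in Metric.ball y ρ, K :=
        integral_mono_of_nonneg (h1.mono fun x hx => hx.1)
          (integrableOn_const measure_ball_lt_top.ne) (h1.mono fun x hx => hx.2)
    _ = _ := by simp [mul_comm]

/-- The Harnack-type estimate in a cylinder that is short in time, with the integral at almost
every time, in its homogeneous form. -/
theorem exists_le_mass_of_isWeakSolution (n : ℕ) (hn : 2 ≤ n) {m β lam₀ c C₂ C₃ C₄ L θ : ℝ}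
    (hm0 : 0 < m) (hm1 : m < 1) (hlam : 0 < lam₀) (hβ : 0 < β) (hq1 : β * (1 - m) < 1)
    (hθ : θ = 2 - n * (β * (1 - m))) (hθ0 : 0 < θ) (hc : 0 < c) (hC₂ : 0 ≤ C₂) (hC₃ : 0 ≤ C₃)
    (hC₄ : 0 ≤ C₄) (hL : 0 < L) : ∃ γ : ℝ, 0 < γ ∧
    ∀ {k : ℕ} {lam bet : Fin k → ℝ} {i : Fin k} {E : Set (Space n)} {T : ℝ}
      {U : (Fin k → ℝ) → ℝ} {A : Space n → ℝ → Space n → ℝ → Space n}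
      {u : Fin k → SpaceTime n → ℝ} {y : Space n} {ρ s t : ℝ},
      lam i = lam₀ → bet i = β → IsOpen E → FluxStructure E T c C₂ C₃ C₄ A →
      IsWeakSolution E T m U A u → Dominates E T lam bet U u →
      (∀ᵐ z ∂volume.restrict (parDomain E T), (U fun j => u j z) ≤ L) →
      0 < ρ → s < t → t - s ≤ ρ ^ 2 → cylinder y (4 * ρ) (2 * s - t) t ⊆ parDomain E T →
      ∀ᵐ σ : ℝ, σ ∈ Ioo (2 * s - t) t → ∀ᵐ z, z ∈ Metric.ball y ρ ×ˢ Ioo s t →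
        u i z ≤ γ * ((2 + (C₂ + C₄) * ρ ^ 2) ^ ((n + 2) / θ) * (t - s + ρ ^ 2) ^ ((n + 2) / θ)
                / (t - s) ^ (2 * (n + 1) / θ)
              * (∫ x in Metric.ball y (4 * ρ), u i (x, σ)) ^ (2 / θ)
            + (1 + (2 + (C₂ + C₄) * ρ ^ 2) ^ ((n + 2) / θ) * (t - s + ρ ^ 2) ^ ((n + 2) / θ)
                  / (t - s) ^ ((n + 2) / θ)
                * (√(1 + C₄) + (C₄ + √(C₂ + C₄)) * ρ ^ (1 / (β * (1 - m)))) ^ (2 / θ))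
              * ((t - s) / ρ ^ 2) ^ (1 / (β * (1 - m)))) := by
  have hq : 0 < β * (1 - m) := mul_pos hβ (by linarith)
  set q := β * (1 - m) with hqd
  -- The lower bound d₀ on the coefficient is where the constant acquires its dependence on Λ; d₁
  -- comes from λ u^β ≤ U.
  obtain ⟨γ, hγ, hmain⟩ := exists_le_mass_cylinder n hn (d₀ := m * L ^ (m - 1))
    (d₁ := m * lam₀ ^ (m - 1)) hq hq1 (by positivity) (by positivity) hc hC₂ hC₃ hC₄
  obtain ⟨c₁, hc₁, hlow⟩ := exists_rpow_le_lowerOrder hq hC₂ hC₄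
  refine ⟨γ * (2 + c₁), by positivity, ?_⟩
  intro k lam bet i E T U A u y ρ s t hli hbi hE hA hsol hdom hUL hρ hst hts hcyl
  obtain ⟨Du, hDu⟩ := hsol
  obtain ⟨hw, hF, hdiv⟩ := hDu i
  set Q : Set (SpaceTime n) := Metric.ball y (4 * ρ) ×ˢ Ioo (2 * s - t) t with hQ
  have hQO : Q ⊆ E ×ˢ Ioo 0 T := openCylinder_subset (by positivity) (by linarith) hcyl
  have hOP : E ×ˢ Ioo 0 T ⊆ parDomain E T := prod_mono_right Ioo_subset_Ioc_self
  have hQP : Q ⊆ parDomain E T := hQO.trans hOP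
  have hPm : MeasurableSet (parDomain E T) := hE.measurableSet.prod measurableSet_Ioc
  have hF' : MemLp (fun z => (m * (U fun j => u j z) ^ (m - 1)) • A (Du i z) (u i z) z.1 z.2) 2
      (volume.restrict (parDomain E T)) := by
    simp only [mul_smul]
    exact hF.const_smul m
  have hD := weakDivOn_of_integral_eq_zero hw.locallyIntegrable hF' fun φ hφ => by
    rw [← hdiv φ hφ]
    simp only [real_inner_smul_left]
  have hdom' := (ae_restrict_iff' hPm).1 hdom
  have hUL' := (ae_restrict_iff' hPm).1 hUL
  have hco' := (ae_restrict_iff' hPm).1 hA.coercive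
  have hgr' := (ae_restrict_iff' hPm).1 hA.growth
  have hmem : ∀ᵐ z, z ∈ Q → u i z ∈ Icc 0 ((L / lam₀) ^ (1 / β)) := by
    filter_upwards [hdom', hUL'] with z h1 h2 hz
    obtain ⟨h3, h4⟩ := h1 (hQP hz) i
    rw [hli, hbi] at h4
    exact ⟨h3, le_rpow_of_mul_rpow_le hlam hβ h3 (h4.trans (h2 (hQP hz)))⟩
  have hfin := hmain (ρ := ρ) (s := s) (t := t) (y := y) (Q := Q) (u := u i)
    (D := fun z => m * (U fun j => u j z) ^ (m - 1))
    (A := fun z => A (Du i z) (u i z) z.1 z.2) (g := Du i) hρ hst rfl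
    (by rw [div_le_one (by positivity)]; exact hts) rfl rfl hQ
    (hw.locallyIntegrable.mono_set hQO) (hw.locallyIntegrable_grad.mono_set hQO)
    (hF'.mono_measure (Measure.restrict_mono hQP le_rfl)) hmem (hw.weakGradOn.mono hQO)
    (hD.mono hQO)
    (by
      filter_upwards [hdom', hco', hgr'] with z h1 h2 h3 hz
      have h0 := (h1 (hQP hz) i).1
      exact ⟨h2 (hQP hz) _ _ h0, h3 (hQP hz) _ _ h0⟩)
    (by
      filter_upwards [hdom', hUL'] with z h1 h2 hz hu
      have h4 := (h1 (hQP hz) i).2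
      rw [hli, hbi] at h4
      obtain ⟨h5, h6⟩ := rpow_coefficient_bounds hm1 hlam hu h4 (h2 (hQP hz))
      exact ⟨by gcongr, by rw [mul_assoc]; gcongr⟩)
  filter_upwards [hfin, ae_time_of_ae hmem] with σ h1 h2 hσ
  filter_upwards [h1 hσ] with z h3 hz
  refine (h3 hz).trans ?_
  rw [mul_assoc γ]
  refine mul_le_mul_of_nonneg_left ?_ hγ.le
  have hR : 1 ≤ 2 + (C₂ + C₄) * ρ ^ 2 := by
    have : 0 ≤ (C₂ + C₄) * ρ ^ 2 := by positivity
    linarith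
  refine linear_le_power hq hθ hθ0 hρ (sub_pos.2 hst) rfl
    (by rw [div_le_one (by positivity)]; exact hts) rfl hR
    (setIntegral_ball_mem_Icc (h2.mono fun x hx hxb => hx ⟨hxb, hσ⟩)).1 ?_ hc₁ (hlow ρ hρ)
  have h4 : 1 ≤ √(1 + C₄) := Real.one_le_sqrt.2 (by linarith)
  have h5 : 0 ≤ (C₄ + √(C₂ + C₄)) * ρ ^ (1 / q) := by positivity
  linarith

end

end SingularSystem

/-! ### Short and long cylinders, and the conclusion. -/

theorem lemma3p4 (n : ℕ) (hn : 2 ≤ n) (m α lam_i bet_i c C₂ C₃ C₄ L θ : ℝ)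
    (hm0 : 0 < m) (hm1 : m < 1) (hlam_i : 0 < lam_i) (hbet_i : 0 < bet_i)
    (hm : 1 - 1 / bet_i < m)
    (hθ_def : θ = n * bet_i * (m - 1) + 2) (hθ : 0 < θ)
    (hα : α ∈ Set.Ioo (-1 : ℝ) 0)
    (hα₁ : bet_i * (m - 1) + 1 + α ∈ Set.Ioo (0 : ℝ) 1)
    (hα₂ : 1 + α ∈ Set.Ioo (0 : ℝ) 1)
    (hα₃ : bet_i * (m - 1) + 1 - α ∈ Set.Ioo (0 : ℝ) 1)
    (hc : 0 < c) (hC₂ : 0 ≤ C₂) (hC₃ : 0 ≤ C₃) (hC₄ : 0 ≤ C₄) (hL : 0 < L) :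
    ∃ γ : ℝ, 0 < γ ∧
      ∀ (k : ℕ) (lam bet : Fin k → ℝ), (∀ j, 0 < lam j) → (∀ j, 0 ≤ bet j) →
      ∀ i : Fin k, lam i = lam_i → bet i = bet_i →
      ∀ (E : Set (SingularSystem.Space n)) (T : ℝ), IsOpen E → 0 < T →
      ∀ U : (Fin k → ℝ) → ℝ, ContinuousOn U {ξ | ∀ j, 0 ≤ ξ j} →
      ∀ A : SingularSystem.Space n → ℝ → SingularSystem.Space n → ℝ → SingularSystem.Space n,
      SingularSystem.FluxStructure E T c C₂ C₃ C₄ A →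
      ∀ u : Fin k → SingularSystem.SpaceTime n → ℝ,
      SingularSystem.IsWeakSolution E T m U A u →
      SingularSystem.Dominates E T lam bet U u →
      (∀ j, ∃ M : ℝ, ∀ᵐ z ∂volume.restrict (SingularSystem.parDomain E T), u j z ≤ M) →
      (∀ᵐ z ∂volume.restrict (SingularSystem.parDomain E T), (U fun j => u j z) ≤ L) →
      ∀ (y : SingularSystem.Space n) (ρ s t : ℝ), 0 < ρ → s < t →
      SingularSystem.cylinder y (4 * ρ) (2 * s - t) t ⊆ SingularSystem.parDomain E T →
      essSup (u i) (volume.restrict (SingularSystem.cylinder y ρ s t)) ≤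
        γ * ((2 + (C₂ + C₄) * ρ ^ 2) ^ ((n + 2) / θ) * (t - s + ρ ^ 2) ^ ((n + 2) / θ)
                / (t - s) ^ (2 * (n + 1) / θ)
              * (essInf (fun τ => ∫ x in Metric.ball y (4 * ρ), u i (x, τ))
                  (volume.restrict (Set.Ioo (2 * s - t) t))) ^ (2 / θ)
            + (1 + (2 + (C₂ + C₄) * ρ ^ 2) ^ ((n + 2) / θ) * (t - s + ρ ^ 2) ^ ((n + 2) / θ)
                  / (t - s) ^ ((n + 2) / θ)
                * (√(1 + C₄) + (C₄ + √(C₂ + C₄)) * ρ ^ (1 / (bet_i * (1 - m)))) ^ (2 / θ))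
              * ((t - s) / ρ ^ 2) ^ (1 / (bet_i * (1 - m)))) := by
  have hq1 : bet_i * (1 - m) < 1 := by
    have := mul_lt_mul_of_pos_left (show 1 - m < 1 / bet_i by linarith) hbet_i
    rwa [mul_one_div_cancel hbet_i.ne'] at this
  obtain ⟨γ, hγ, hmain⟩ :=
    SingularSystem.exists_le_mass_of_isWeakSolution n hn hm0 hm1 hlam_i hbet_i hq1
    (show θ = 2 - n * (bet_i * (1 - m)) by rw [hθ_def]; ring) hθ hc hC₂ hC₃ hC₄ hL
  have hK : 0 < (L / lam_i) ^ (1 / bet_i) := by positivity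
  set K := (L / lam_i) ^ (1 / bet_i) with hKd
  -- γ serves the cylinders with t - s ≤ ρ²; K, the a priori bound on u, serves the others.
  refine ⟨γ + K, by positivity, ?_⟩
  intro k lam bet _ _ i hli hbi E T hE _ U _ A hA u hsol hdom _ hUL y ρ s t hρ hst hcyl
  have hPm : MeasurableSet (SingularSystem.parDomain E T) := hE.measurableSet.prod measurableSet_Ioc
  have hmem : ∀ᵐ z, z ∈ Metric.ball y (4 * ρ) ×ˢ Ioo (2 * s - t) t → u i z ∈ Icc 0 K := by
    filter_upwards [(ae_restrict_iff' hPm).1 hdom, (ae_restrict_iff' hPm).1 hUL] with z h1 h2 hz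
    have hz' : z ∈ SingularSystem.parDomain E T := hcyl ⟨hz.1, Ioo_subset_Ioc_self hz.2⟩
    obtain ⟨h3, h4⟩ := h1 hz' i
    rw [hli, hbi] at h4
    exact ⟨h3, SingularSystem.le_rpow_of_mul_rpow_le hlam_i hbet_i h3 (h4.trans (h2 hz'))⟩
  have hsub : Metric.ball y ρ ×ˢ Ioo s t ⊆ Metric.ball y (4 * ρ) ×ˢ Ioo (2 * s - t) t :=
    prod_mono (Metric.ball_subset_ball (by linarith)) (Ioo_subset_Ioo_left (by linarith))
  have hu0 : ∀ᵐ z, z ∈ Metric.ball y ρ ×ˢ Ioo s t → 0 ≤ u i z :=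
    hmem.mono fun z hz hzb => (hz (hsub hzb)).1
  have hne : (ae (volume.restrict (Ioo (2 * s - t) t))).NeBot := by
    rw [ae_neBot, Ne, Measure.restrict_eq_zero, Real.volume_Ioo]
    simp; linarith
  have hI : ∀ᵐ τ ∂volume.restrict (Ioo (2 * s - t) t),
      ∫ x in Metric.ball y (4 * ρ), u i (x, τ) ∈
        Icc 0 (K * volume.real (Metric.ball y (4 * ρ))) := by
    rw [ae_restrict_iff' measurableSet_Ioo]
    filter_upwards [SingularSystem.ae_time_of_ae hmem] with τ h1 hτ
    exact SingularSystem.setIntegral_ball_mem_Icc (h1.mono fun x hx hxb => hx ⟨hxb, hτ⟩)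
  have hJ : 0 ≤ essInf (fun τ => ∫ x in Metric.ball y (4 * ρ), u i (x, τ))
      (volume.restrict (Ioo (2 * s - t) t)) :=
    le_essInf_of_ae_le _ (hI.mono fun τ hτ => hτ.1)
      (Filter.isCoboundedUnder_ge_of_eventually_le _ (hI.mono fun τ hτ => hτ.2))
  set J := essInf (fun τ => ∫ x in Metric.ball y (4 * ρ), u i (x, τ))
    (volume.restrict (Ioo (2 * s - t) t)) with hJd
  rcases le_total (t - s) (ρ ^ 2) with hts | hts
  · refine (SingularSystem.le_mul_essInf_rpow (hI.mono fun τ hτ => hτ.1)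
      (hI.mono fun τ hτ => hτ.2) hγ.le
      (by positivity) (by positivity) ?_).trans
      (mul_le_mul_of_nonneg_right (le_add_of_nonneg_right hK.le) (by positivity))
    rw [ae_restrict_iff' measurableSet_Ioo]
    filter_upwards [hmain hli hbi hE hA hsol hdom hUL hρ hst hts hcyl] with σ h1 hσ
    exact SingularSystem.essSup_cylinder_le hρ hst hu0 (h1 hσ)
  -- For t - s ≥ ρ² the last factor is at least 1, so u ≤ K suffices and every other term is merely
  -- nonnegative.
  · have hM : 1 ≤ ((t - s) / ρ ^ 2) ^ (1 / (bet_i * (1 - m))) :=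
      Real.one_le_rpow (by rw [le_div_iff₀ (by positivity)]; linarith) (by positivity)
    refine (SingularSystem.essSup_cylinder_le hρ hst hu0
      (hmem.mono fun z hz hzb => (hz (hsub hzb)).2)).trans ?_
    calc K ≤ (γ + K) * (0 + (1 + 0) * 1) := by linarith
      _ ≤ _ := by gcongr <;> positivity
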